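/- **Conventions.** Let $R$ be a commutative ring. All bigraded $R$-modules are $(\mathbb Z,\mathbb Z)$-bigraded, $V=\bigoplus_{i,j}V_i^j$; an element of $V_i^j$ has bidegree $(i,j)$, horizontal degree $i$ and vertical degree $\mathrm{vdeg}=j$. Signs are governed by the pairing $\langle x,y\rangle=x_1y_1+x_2y_2$ of bidegrees $(x_1,x_2),(y_1,y_2)$: moving a homogeneous map $f$ past an element $x$ produces $(-1)^{\langle f,x\rangle}$. Shifts are vertical: $(SV)_i^j=V_i^{j-1}$, so $S$ has bidegree $(0,1)$; in the formulas below $S$ and $S^{-1}$ are only regradings of the same underlying module, all signs being written out. $V$ is *horizontally bounded on the right* if there is $N$ with $V_i^j=0$ for all $i>N$ and all $j$. **Derived $A_\infty$-algebras.** A derived $A_\infty$-algebra is a bigraded module $A$ with multilinear maps $m_{ij}:A^{\otimes j}\to A$ of bidegree $(i,2-i-j)$, $i\ge0$, $j\ge1$, such that for all $u\ge0$, $v\ge1$ $$\sum_{\substack{u=i+p,\ v=j+q-1\\ j=1+r+t}}(-1)^{rq+t+pj}\,m_{ij}(1^{\otimes r}\otimes m_{pq}\otimes1^{\otimes t})=0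 .$$ **Brace algebras.** A brace algebra is a bigraded module with multilinear maps $b_n(x;x_1,\dots,x_n)$ of bidegree $(0,0)$, $n\ge 0$, with $b_0(x)=x$ and, for homogeneous elements, $$b_m(b_n(x;x_1,\dots,x_n);y_1,\dots,y_m)=\sum(-1)^{\sum_{p=1}^n\sum_{v<i_p}\langle x_p,y_v\rangle}\,b_l(x;y_1,\dots,b_{k_1}(x_1;y_{i_1},\dots),\dots,b_{k_n}(x_n;y_{i_n},\dots),\dots,y_m),$$ the sum running over all order preserving insertions: in all sums of this kind, the $t$-th (possibly empty) block consists of $k_t\ge0$ consecutive entries starting with index $i_t$, and $1\le i_1$, $i_t+k_t\le i_{t+1}$, with $i_{j+1}=m+1$ for the last block $j$. **The Hochschild complex.** For a bigraded module $A$, let $\mathfrak s\mathrm{End}_A$ be the bigraded module whose component of (natural) bidegree $(p,q)$ is $\prod_{n\ge0}$ of the modules of multilinear maps $A^{\otimes n}\to A$ of bidegree $(p,q+1-n)$. The brace of elements $x,x_1,\dots,x_n$, the $x_t$ being of natural bidegree $(a_t,c_t)$, is $$b_n(x;x_1,\dots,x_n)=\sum(-1)^{\eta}\,x(1^{\otimes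 h_0}\otimes x_1\otimes 1^{\otimes h_1}\otimes\cdots\otimes x_n\otimes1^{\otimes h_n}),$$ $$\eta=\sum_{0\le j<l\le n}h_jq_l+\sum_{1\le j<l\le n}k_jq_l+\sum_{j=1}^n(k_j+q_j-1)(n-j)+\sum_{1\le j\le l\le n}(k_j+q_j-1)h_l ,$$ the sum being over all $h_0,\dots,h_n\ge0$ and all arities $k_t\ge 0$ of the components of $x_t$, with $q_t=c_t+1-k_t$. The Hochschild complex of $A$ is the bigraded module $S\mathfrak s\mathrm{End}_A$. If $A$ is a derived $A_\infty$-algebra, put $m_{i\bullet}=(m_{ij})_{j\ge1}\in\mathfrak s\mathrm{End}_A$, of natural bidegree $(i,1-i)$, and, for homogeneous $x,x_1,\dots,x_j\in\mathfrak s\mathrm{End}_A$, $$M_{i1}(Sx)=S b_1(m_{i\bullet};x)-(-1)^{\langle x,m_{i\bullet}\rangle}Sb_1(x;m_{i\bullet}),$$ $$M_{ij}(Sx_1,\dots,Sx_j)=(-1)^{\sum_{v=1}^j(j-v)\mathrm{vdeg}(x_v)}\,S b_j(m_{i\bullet};x_1,\dots,x_j)\quad(j\ge2).$$ **Derived $J$-algebras.**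 A derived $J$-algebra is a derived $A_\infty$-algebra $V$ with structure maps $M_{ij}$ such that $S^{-1}V$ is a brace algebra, with braces $b_n$, and such that for all $i,n\ge0$ and all homogeneous $x,x_1,\dots,x_j,y_1,\dots,y_n\in S^{-1}V$ (degrees are those in $S^{-1}V$) the following hold. (1) One has $$(-1)^{\sum_{v=1}^n(n-v)\mathrm{vdeg}(y_v)}Sb_n(S^{-1}M_{i1}(Sx);y_1,\dots,y_n)=\sum_{\substack{l+k-1=n,\ k\ge 0\\1\le i_1\le n-k+1}}(-1)^{\varepsilon}M_{il}(Sy_1,\dots,Sb_k(x;y_{i_1},\dots,y_{i_1+k-1}),\dots,Sy_n)$$ $$-(-1)^{\langle x,(i,1-i)\rangle}\sum_{\substack{l+k-1=n,\ l\ge1\\1\le i_1\le n-l+1}}(-1)^{\eta}Sb_k(x;y_1,\dots,S^{-1}M_{il}(Sy_{i_1},\dots,Sy_{i_1+l-1}),\dots,y_n),$$ $$\varepsilon=\sum_{v=1}^{i_1-1}\langle y_v,S^{1-k}x\rangle+\sum_{v=1}^{k}(k-v)\mathrm{vdeg}(y_{i_1+v-1})+(l-i_1)\mathrm{vdeg}(x),$$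 $$\eta=\sum_{v=1}^{i_1-1}(k-v)\mathrm{vdeg}(y_v)+\sum_{v=1}^{i_1-1}\langle y_v,(i,2-i-l)\rangle+\sum_{v=i_1}^{i_1+l-1}(k-i_1)\mathrm{vdeg}(y_v)+\sum_{v=i_1}^{n-l}(k-v-1)\mathrm{vdeg}(y_{v+l}).$$ (2) For $j>1$, $$(-1)^{\sum_{v=1}^n(n-v)\mathrm{vdeg}(y_v)}Sb_n(S^{-1}M_{ij}(Sx_1,\dots,Sx_j);y_1,\dots,y_n)$$ $$=\sum(-1)^{\varepsilon}M_{il}(Sy_1,\dots,Sb_{k_1}(x_1;y_{i_1},\dots),\dots,Sb_{k_j}(x_j;y_{i_j},\dots),\dots,Sy_n),$$ the sum running over all non-negative integers with $l+k_1+\dots+k_j-j=n$ and all order preserving insertions, where, with $i_0=1$, $k_0=0$, $i_{j+1}=n+1$, $$\varepsilon=\sum_{\substack{1\le t\le j\\1\le v\le k_t}}(k_t-v)\mathrm{vdeg}(y_{i_t+v-1})+\sum_{1\le v<l\le j}k_v\,\mathrm{vdeg}(S^{1-k_l}x_l)+\sum_{\substack{0\le t<l\le j\\i_t\le v<i_{t+1}}}\langle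 Sy_v,S^{1-k_l}x_l\rangle$$ $$+\sum_{0\le v<l\le j}(i_{v+1}-i_v-k_v)\mathrm{vdeg}(S^{1-k_l}x_l)+\sum_{1\le v\le l\le j}(i_{l+1}-i_l-k_l)\mathrm{vdeg}(x_v).$$ **Corollary (the derived Deligne conjecture).** If $A$ is a derived $A_\infty$-algebra that is horizontally bounded on the right, then its Hochschild complex $S\mathfrak s\mathrm{End}_A$, with the maps $M_{ij}$ and with the braces $b_n$ on $\mathfrak s\mathrm{End}_A$ given above, is a derived $J$-algebra. -/

import Mathlib

open scoped DirectSum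

namespace DerivedDeligne

/-! ### Bigraded modules

A `(ℤ, ℤ)`-bigraded `R`-module is a module `V` that is the internal direct sum of submodules
`𝒱 (i, j)`; here `i` is the horizontal and `j` the vertical degree. -/

section Bigraded

variable {R V : Type*} [CommRing R] [AddCommGroup V] [Module R V]

/-- The scalar product of bidegrees which governs all Koszul signs. -/
def pairing (a b : ℤ × ℤ) : ℤ := a.1 * b.1 + a.2 * b.2

/-- The sign `(-1) ^ e`. -/
def sgn (e : ℤ) : ℤ := (Int.negOnePow e : ℤˣ)

/-- The vertical shift `S ^ s` of a bigraded module: `(S ^ s V)_i ^ j = V_i ^ (j - s)`. The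
underlying module is unchanged, and the shift map `S` is the identity of that module, regarded as a
map of bidegree `(0, 1)`. -/
def vshift (𝒱 : ℤ × ℤ → Submodule R V) (s : ℤ) : ℤ × ℤ → Submodule R V :=
  fun d => 𝒱 (d.1, d.2 - s)

/-- There is an `N` such that all components of horizontal degree `> N` vanish. -/
def HorizontallyBoundedRight (𝒱 : ℤ × ℤ → Submodule R V) : Prop :=
  ∃ N : ℤ, ∀ i j : ℤ, N < i → 𝒱 (i, j) = ⊥

/-- A multilinear map `V ^ n → V` is homogeneous of bidegree `d`. -/
def IsHomogeneousMap (𝒱 : ℤ × ℤ → Submodule R V) {n : ℕ}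
    (f : MultilinearMap R (fun _ : Fin n => V) V) (d : ℤ × ℤ) : Prop :=
  ∀ (β : Fin n → ℤ × ℤ) (a : Fin n → V), (∀ s, a s ∈ 𝒱 (β s)) → f a ∈ 𝒱 (d + ∑ s, β s)

/-- The linear map with `x ↦ (-1) ^ ⟨d, deg x⟩ x` for homogeneous `x`. -/
noncomputable def twist (𝒱 : ℤ × ℤ → Submodule R V) [DirectSum.Decomposition 𝒱] (d : ℤ × ℤ) :
    V →ₗ[R] V :=
  DirectSum.toModule R (ℤ × ℤ) V (fun b => sgn (pairing d b) • (𝒱 b).subtype) ∘ₗ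
    (DirectSum.decomposeLinearEquiv 𝒱).toLinearMap

end Bigraded

/-! ### Evaluation on lists, and order preserving insertions

Finite sequences `y_1, …, y_n` are written as functions `y` on `ℕ`, of which only the values at
`1, …, n` are used. -/

section Insertions

variable {R V : Type*} [CommRing R] [AddCommGroup V] [Module R V]

/-- The value of a family of multilinear maps, one for each arity, on the entries of a list. -/
def evalList (f : ∀ n : ℕ, MultilinearMap R (fun _ : Fin n => V) V) (L : List V) : V :=
  f L.length L.get

/-- `b_n(x; y_1, …, y_n)` for the list `y_1, …, y_n`. -/
def braceEval (b : ∀ n : ℕ, MultilinearMap R (fun _ : Fin (n + 1) => V) V) (x : V) (L : List V) :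
    V :=
  b L.length (Fin.cons x L.get : Fin (L.length + 1) → V)

/-- The list `y_a, …, y_(e - 1)`. -/
def seg {W : Type*} (y : ℕ → W) (a e : ℕ) : List W := (List.range' a (e - a)).map y

/-- Data for inserting `j` blocks into `y_1, …, y_n`: for the `t`-th block, the pair `(i_t, k_t)` of
its first index and its length. -/
abbrev InsertionData (j n : ℕ) : Type := Fin j → Fin (n + 2) × Fin (n + 1)

/-- The numbers `i_t`, with the conventions `i_0 = 1` and `i_(j + 1) = n + 1`. -/
def InsertionData.start {j n : ℕ} (p : InsertionData j n) (t : ℕ) : ℕ :=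
  if t = 0 then 1 else if h : t - 1 < j then ((p ⟨t - 1, h⟩).1 : ℕ) else n + 1

/-- The numbers `k_t`, with the convention `k_0 = 0`. -/
def InsertionData.len {j n : ℕ} (p : InsertionData j n) (t : ℕ) : ℕ :=
  if t = 0 then 0 else if h : t - 1 < j then ((p ⟨t - 1, h⟩).2 : ℕ) else 0

/-- The order preserving insertions of `j` (possibly empty) blocks `y_(i_t), …, y_(i_t + k_t - 1)`
into `y_1, …, y_n`: one demands `i_t + k_t ≤ i_(t + 1)` for `0 ≤ t ≤ j`. -/
def insertions (j n : ℕ) : Finset (InsertionData j n) :=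
  Finset.univ.filter fun p => ∀ t ≤ j, p.start t + p.len t ≤ p.start (t + 1)

/-- The number `i_(t + 1) - i_t - k_t` of entries between the `t`-th block and the next one. -/
def InsertionData.gap {j n : ℕ} (p : InsertionData j n) (t : ℕ) : ℤ :=
  (p.start (t + 1) : ℤ) - p.start t - p.len t

/-- The list that is obtained from `y_1, …, y_(i_(t + 1) - 1)` by replacing the blocks number
`1, …, t` by the single entries `z_1, …, z_t`. -/
def weaveUpTo {W : Type*} (i k : ℕ → ℕ) (z y : ℕ → W) : ℕ → List W
  | 0 => seg y (i 0 + k 0) (i 1)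
  | t + 1 => weaveUpTo i k z y t ++ z (t + 1) :: seg y (i (t + 1) + k (t + 1)) (i (t + 2))

/-- The list `y_1, …, y_(i_1 - 1), z_1, y_(i_1 + k_1), …, y_(i_j - 1), z_j, y_(i_j + k_j), …, y_n`,
in which the `t`-th block of `y_1, …, y_n` is replaced by the single entry `z_t`. -/
def weave {W : Type*} {j n : ℕ} (p : InsertionData j n) (z y : ℕ → W) : List W :=
  weaveUpTo p.start p.len z y j

/-- The `t`-th block `y_(i_t), …, y_(i_t + k_t - 1)`. -/
def block {W : Type*} {j n : ℕ} (p : InsertionData j n) (y : ℕ → W) (t : ℕ) : List W :=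
  seg y (p.start t) (p.start t + p.len t)

end Insertions

/-! ### Derived `A_∞`-algebras, brace algebras, derived `J`-algebras -/

section Algebras

variable {R V : Type*} [CommRing R] [AddCommGroup V] [Module R V]

/-- `m i j : V ^ j → V`, for `i ≥ 0` and `j ≥ 1`, are the structure maps of a derived `A_∞`-algebra
on the bigraded module `V`. There is no operation of arity zero, that is, `m i 0 = 0`. The last
summand in the exponent is the Koszul sign of
`(1 ^ r ⊗ m_pq ⊗ 1 ^ t) (a_1 ⊗ … ⊗ a_v)`. -/
structure IsDerivedAInfinityAlgebra (𝒱 : ℤ × ℤ → Submodule R V)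
    (m : ℕ → ∀ j : ℕ, MultilinearMap R (fun _ : Fin j => V) V) : Prop where
  arity_zero : ∀ i, m i 0 = 0
  homogeneous : ∀ i j : ℕ, 1 ≤ j → IsHomogeneousMap 𝒱 (m i j) ((i : ℤ), 2 - ((i : ℤ) + j))
  relation : ∀ u v : ℕ, 1 ≤ v → ∀ (β : ℕ → ℤ × ℤ) (a : ℕ → V), (∀ w, a w ∈ 𝒱 (β w)) →
    ∑ ip ∈ Finset.HasAntidiagonal.antidiagonal u, ∑ r ∈ Finset.range v, ∑ q ∈ Finset.Icc 1 (v - r),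
      (let i := ip.1
       let p := ip.2
       let t := v - r - q
       let j := r + 1 + t
       sgn ((r * q + t + p * j : ℕ) +
          pairing ((p : ℤ), 2 - ((p : ℤ) + q)) (∑ w ∈ Finset.Icc 1 r, β w)) •
        evalList (m i) (seg a 1 (r + 1) ++
          evalList (m p) (seg a (r + 1) (r + q + 1)) :: seg a (r + q + 1) (v + 1))) = 0

/-- `b n`, written `b_n(x; x_1, …, x_n)`, are the braces of a (bigraded) brace algebra. -/
structure IsBraceAlgebra (𝒱 : ℤ × ℤ → Submodule R V)
    (b : ∀ n : ℕ, MultilinearMap R (fun _ : Fin (n + 1) => V) V) : Prop where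
  homogeneous : ∀ n, IsHomogeneousMap 𝒱 (b n) (0, 0)
  brace_zero : ∀ x : V, braceEval b x [] = x
  relation : ∀ (n m : ℕ) (x₀ : V) (α : ℕ → ℤ × ℤ) (x : ℕ → V) (β : ℕ → ℤ × ℤ) (y : ℕ → V),
    (∀ t, x t ∈ 𝒱 (α t)) → (∀ v, y v ∈ 𝒱 (β v)) →
    braceEval b (braceEval b x₀ (seg x 1 (n + 1))) (seg y 1 (m + 1)) =
      ∑ p ∈ insertions n m,
        sgn (∑ t ∈ Finset.Icc 1 n, ∑ v ∈ Finset.Ico 1 (p.start t), pairing (α t) (β v)) •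
          braceEval b x₀ (weave p (fun t => braceEval b (x t) (block p y t)) y)

/-- The sign exponent in front of
`M_il(Sy_1, …, Sb_k(x; y_(i_1), …, y_(i_1 + k - 1)), …, Sy_n)`, where `l + k - 1 = n`, for
`x` of bidegree `α` and `y_v` of bidegree `β v` in `S⁻¹V`. -/
def jSignOuter {n : ℕ} (p : InsertionData 1 n) (α : ℤ × ℤ) (β : ℕ → ℤ × ℤ) : ℤ :=
  let i₁ := p.start 1
  let k := p.len 1
  let l : ℤ := n - k + 1
  ∑ v ∈ Finset.Ico 1 i₁, pairing (β v) (α.1, α.2 + 1 - k) +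
    ∑ v ∈ Finset.Icc 1 k, (β (i₁ + v - 1)).2 * ((k : ℤ) - v) + (l - i₁) * α.2

/-- The sign exponent in front of
`Sb_k(x; y_1, …, S⁻¹M_il(Sy_(i_1), …, Sy_(i_1 + l - 1)), …, y_n)`, where `l + k - 1 = n`, for
`y_v` of bidegree `β v` in `S⁻¹V`. -/
def jSignInner {n : ℕ} (i : ℕ) (p : InsertionData 1 n) (β : ℕ → ℤ × ℤ) : ℤ :=
  let i₁ := p.start 1
  let l := p.len 1
  let k : ℤ := n - l + 1
  ∑ v ∈ Finset.Ico 1 i₁, (k - v) * (β v).2 +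
    ∑ v ∈ Finset.Ico 1 i₁, pairing (β v) ((i : ℤ), 2 - ((i : ℤ) + l)) +
    ∑ v ∈ Finset.Ico i₁ (i₁ + l), (k - i₁) * (β v).2 +
    ∑ v ∈ Finset.Icc i₁ (n - l), (k - v - 1) * (β (v + l)).2

/-- The sign exponent in front of
`M_il(Sy_1, …, Sb_(k_1)(x_1; y_(i_1), …), …, Sb_(k_j)(x_j; y_(i_j), …), …, Sy_n)`, where
`l + k_1 + ⋯ + k_j - j = n`, for `x_t` of bidegree `α t` and `y_v` of bidegree `β v` in `S⁻¹V`.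
Here `q l` is the bidegree of `S ^ (1 - k_l) x_l`. -/
def jSign {j n : ℕ} (p : InsertionData j n) (α β : ℕ → ℤ × ℤ) : ℤ :=
  let i := p.start
  let k := p.len
  let q : ℕ → ℤ × ℤ := fun l => ((α l).1, (α l).2 + 1 - k l)
  ∑ t ∈ Finset.Icc 1 j, ∑ v ∈ Finset.Icc 1 (k t), (β (i t + v - 1)).2 * ((k t : ℤ) - v) +
    ∑ l ∈ Finset.Icc 1 j, ∑ v ∈ Finset.Ico 1 l, (k v : ℤ) * (q l).2 +
    ∑ l ∈ Finset.Icc 1 j, ∑ t ∈ Finset.range l, ∑ v ∈ Finset.Ico (i t) (i (t + 1)),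
      pairing ((β v).1, (β v).2 + 1) (q l) +
    ∑ l ∈ Finset.Icc 1 j, ∑ v ∈ Finset.range l, p.gap v * (q l).2 +
    ∑ l ∈ Finset.Icc 1 j, ∑ v ∈ Finset.Icc 1 l, (α v).2 * p.gap l

/-- The bigraded module `V` is a derived `J`-algebra with structure maps `M i j` and with braces
`b n` on `S⁻¹V`. In the relations `x`, `x_t`, `y_v` are homogeneous elements of `S⁻¹V`; since the
shift map is the identity of the underlying module, it is not visible in the formulas. -/
structure IsDerivedJAlgebra (𝒱 : ℤ × ℤ → Submodule R V)
    (M : ℕ → ∀ j : ℕ, MultilinearMap R (fun _ : Fin j => V) V)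
    (b : ∀ n : ℕ, MultilinearMap R (fun _ : Fin (n + 1) => V) V) : Prop where
  derivedAInfinity : IsDerivedAInfinityAlgebra 𝒱 M
  brace : IsBraceAlgebra (vshift 𝒱 (-1)) b
  relation_one : ∀ (i n : ℕ) (α : ℤ × ℤ) (x : V) (β : ℕ → ℤ × ℤ) (y : ℕ → V),
    x ∈ vshift 𝒱 (-1) α → (∀ v, y v ∈ vshift 𝒱 (-1) (β v)) →
    sgn (∑ v ∈ Finset.Icc 1 n, ((n : ℤ) - v) * (β v).2) •
        braceEval b (evalList (M i) [x]) (seg y 1 (n + 1)) =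
      ∑ p ∈ insertions 1 n, sgn (jSignOuter p α β) •
          evalList (M i) (weave p (fun t => braceEval b x (block p y t)) y) -
        sgn (pairing α ((i : ℤ), 1 - (i : ℤ))) •
          ∑ p ∈ insertions 1 n with 1 ≤ p.len 1, sgn (jSignInner i p β) •
            braceEval b x (weave p (fun t => evalList (M i) (block p y t)) y)
  relation_many : ∀ (i j n : ℕ), 1 < j →
    ∀ (α : ℕ → ℤ × ℤ) (x : ℕ → V) (β : ℕ → ℤ × ℤ) (y : ℕ → V),
    (∀ t, x t ∈ vshift 𝒱 (-1) (α t)) → (∀ v, y v ∈ vshift 𝒱 (-1) (β v)) →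
    sgn (∑ v ∈ Finset.Icc 1 n, ((n : ℤ) - v) * (β v).2) •
        braceEval b (evalList (M i) (seg x 1 (j + 1))) (seg y 1 (n + 1)) =
      ∑ p ∈ insertions j n, sgn (jSign p α β) •
        evalList (M i) (weave p (fun t => braceEval b (x t) (block p y t)) y)

end Algebras

/-! ### Linearity and homogeneity of the evaluation on woven lists -/

section Aux

variable {R V W : Type*} [CommRing R] [AddCommGroup V] [Module R V] [AddCommGroup W] [Module R W]

/-- The list depends on `w` through exactly one entry, and linearly. -/
def OneLin (R : Type*) [CommRing R] {V W : Type*} [AddCommGroup V] [Module R V]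
    [AddCommGroup W] [Module R W] (F : W → List V) : Prop :=
  ∃ (L₁ L₂ : List V) (g : W →ₗ[R] V), ∀ w, F w = L₁ ++ g w :: L₂

theorem OneLin.append_left {F : W → List V} (h : OneLin R F) (L : List V) :
    OneLin R (fun w => L ++ F w) := by
  obtain ⟨L₁, L₂, g, hg⟩ := h
  exact ⟨L ++ L₁, L₂, g, fun w => by simp [hg]⟩

theorem OneLin.append_right {F : W → List V} (h : OneLin R F) (L : List V) :
    OneLin R (fun w => F w ++ L) := by
  obtain ⟨L₁, L₂, g, hg⟩ := h
  exact ⟨L₁, L₂ ++ L, g, fun w => by simp [hg]⟩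

theorem OneLin.single (g : W →ₗ[R] V) (L₁ L₂ : List V) : OneLin R (fun w => L₁ ++ g w :: L₂) :=
  ⟨L₁, L₂, g, fun _ => rfl⟩

theorem evalList_congr (f : ∀ n : ℕ, MultilinearMap R (fun _ : Fin n => V) V) (L : List V)
    (n : ℕ) (h : L.length = n) : evalList f L = f n (fun s => L.get (s.cast h.symm)) := by
  subst h; rfl

theorem get_eq_update (L₁ L₂ : List V) (w : V) :
    (fun s : Fin (L₁ ++ (0 : V) :: L₂).length =>
        (L₁ ++ w :: L₂).get (s.cast (by simp))) =
      Function.update (L₁ ++ (0 : V) :: L₂).get ⟨L₁.length, by simp⟩ w := by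
  funext s
  obtain ⟨s, hs⟩ := s
  by_cases h : s = L₁.length
  · subst h; simp
  · rw [Function.update_of_ne (by simpa [Fin.ext_iff] using h)]
    simp only [List.get_eq_getElem, Fin.val_cast]
    rcases lt_or_gt_of_ne h with h | h
    · simp [List.getElem_append_left, h]
    · rw [List.getElem_append_right (by omega), List.getElem_append_right (by omega)]
      obtain ⟨d, hd⟩ : ∃ d, s - L₁.length = d + 1 := ⟨s - L₁.length - 1, by omega⟩
      simp [hd]

theorem OneLin.exists_linear {F : W → List V} (h : OneLin R F)
    (f : ∀ n : ℕ, MultilinearMap R (fun _ : Fin n => V) V) :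
    ∃ g : W →ₗ[R] V, ∀ w, evalList f (F w) = g w := by
  obtain ⟨L₁, L₂, g, hg⟩ := h
  refine ⟨((f _).toLinearMap (L₁ ++ (0 : V) :: L₂).get ⟨L₁.length, by simp⟩) ∘ₗ g, fun w => ?_⟩
  rw [hg, evalList_congr f _ (L₁ ++ (0 : V) :: L₂).length (by simp), get_eq_update]
  rfl

theorem seg_congr {X : Type*} {y y' : ℕ → X} {a e : ℕ} (h : ∀ v, a ≤ v → v < e → y v = y' v) :
    seg y a e = seg y' a e := by
  unfold seg
  refine List.map_congr_left fun v hv => ?_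
  rw [List.mem_range'_1] at hv
  exact h v hv.1 (by omega)

theorem seg_split {X : Type*} (y : ℕ → X) {a v e : ℕ} (h₁ : a ≤ v) (h₂ : v < e) :
    seg y a e = seg y a v ++ y v :: seg y (v + 1) e := by
  unfold seg
  have : e - a = (v - a) + ((e - (v + 1)) + 1) := by omega
  rw [this, ← List.range'_append_1, List.map_append, List.range'_succ,
    Nat.add_sub_cancel' h₁, List.map_cons]

/-- A segment of a sequence of which only the entry at `v` varies, and linearly. -/
theorem seg_oneLin {y : W → ℕ → V} {v : ℕ} (g : W →ₗ[R] V) (hv : ∀ w, y w v = g w)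
    (hne : ∀ w u, u ≠ v → y w u = y 0 u) {a e : ℕ} (h₁ : a ≤ v) (h₂ : v < e) :
    OneLin R (fun w => seg (y w) a e) := by
  have : (fun w => seg (y w) a e) = fun w => seg (y 0) a v ++ g w :: seg (y 0) (v + 1) e := by
    funext w
    rw [seg_split (y w) h₁ h₂, hv]
    rw [seg_congr (y := y w) (y' := y 0) (a := a) (fun u _ h => hne w u (by omega)),
      seg_congr (y := y w) (y' := y 0) (a := v + 1) (fun u h _ => hne w u (by omega))]
  rw [this]
  exact OneLin.single g _ _

theorem index_mono {i k : ℕ → ℕ} {T : ℕ} (hmono : ∀ t ≤ T, i t + k t ≤ i (t + 1)) {t : ℕ}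
    (ht : t ≤ T) : i t + k t ≤ i (T + 1) := by
  induction T, ht using Nat.le_induction with
  | base => exact hmono t le_rfl
  | succ T ht ih =>
    have := hmono (T + 1) le_rfl
    have := ih fun s hs => hmono s (by omega)
    omega

theorem weaveUpTo_congr {X : Type*} {i k : ℕ → ℕ} {z y z' y' : ℕ → X} {T : ℕ}
    (hmono : ∀ t ≤ T, i t + k t ≤ i (t + 1))
    (hz : ∀ t, 1 ≤ t → t ≤ T → z t = z' t)
    (hy : ∀ v, v < i (T + 1) → y v = y' v) :
    weaveUpTo i k z y T = weaveUpTo i k z' y' T := by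
  induction T with
  | zero => exact seg_congr fun v _ h => hy v h
  | succ T ih =>
    have h1 := hmono (T + 1) le_rfl
    unfold weaveUpTo
    rw [ih (fun t ht => hmono t (by omega)) (fun t h h' => hz t h (by omega))
      (fun v hv => hy v (by omega)), hz (T + 1) (by omega) le_rfl,
      seg_congr fun v _ h => hy v h]

/-- Linearity of a woven list in one of the entries of the underlying sequence. -/
theorem weaveUpTo_oneLin {i k : ℕ → ℕ} {z y : W → ℕ → V} {v : ℕ} (g : W →ₗ[R] V)
    (hv : ∀ w, y w v = g w) (hne : ∀ w u, u ≠ v → y w u = y 0 u) (T : ℕ)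
    (hmono : ∀ t ≤ T, i t + k t ≤ i (t + 1))
    (hz : ∀ t, 1 ≤ t → t ≤ T → i t ≤ v → v < i t + k t →
      ∃ g' : W →ₗ[R] V, ∀ w, z w t = g' w)
    (hz' : ∀ t, 1 ≤ t → t ≤ T → ¬ (i t ≤ v ∧ v < i t + k t) → ∀ w, z w t = z 0 t)
    (h0 : i 0 + k 0 ≤ v) (hvT : v < i (T + 1)) :
    OneLin R (fun w => weaveUpTo i k (z w) (y w) T) := by
  induction T with
  | zero => exact seg_oneLin g hv hne h0 hvT
  | succ T ih =>
    have h1 := hmono (T + 1) le_rfl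
    have hm : ∀ t ≤ T, i t + k t ≤ i (t + 1) := fun t ht => hmono t (by omega)
    by_cases hlt : v < i (T + 1)
    · have := (ih hm (fun t a b => hz t a (by omega)) (fun t a b => hz' t a (by omega))
        hlt).append_right (z 0 (T + 1) ::
          seg (y 0) (i (T + 1) + k (T + 1)) (i (T + 2)))
      convert this using 2 with w
      rw [weaveUpTo, hz' (T + 1) (by omega) le_rfl (by omega) w,
        seg_congr fun u h _ => hne w u (by omega)]
    · have hpre : ∀ w, weaveUpTo i k (z w) (y w) T = weaveUpTo i k (z 0) (y 0) T := by
        intro w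
        refine weaveUpTo_congr hm (fun t a b => hz' t a (by omega) ?_ w)
          (fun u hu => hne w u (by omega))
        rintro ⟨_, h⟩
        have := index_mono hm b
        omega
      by_cases hblk : v < i (T + 1) + k (T + 1)
      · obtain ⟨g', hg'⟩ := hz (T + 1) (by omega) le_rfl (by omega) hblk
        have := OneLin.single (R := R) g' (weaveUpTo i k (z 0) (y 0) T)
          (seg (y 0) (i (T + 1) + k (T + 1)) (i (T + 2)))
        convert this using 2 with w
        rw [weaveUpTo, hpre, hg', seg_congr fun u h _ => hne w u (by omega)]
      · have := (seg_oneLin (R := R) g hv hne (a := i (T + 1) + k (T + 1)) (e := i (T + 2))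
          (by omega) hvT).append_left (weaveUpTo i k (z 0) (y 0) T ++ [z 0 (T + 1)])
        convert this using 2 with w
        rw [weaveUpTo, hpre, hz' (T + 1) (by omega) le_rfl (by omega) w]
        simp

/-- Linearity of a woven list in one of the inserted entries. -/
theorem weaveUpTo_oneLin_inserted {i k : ℕ → ℕ} {z : W → ℕ → V} (y : ℕ → V) {s : ℕ}
    (g : W →ₗ[R] V) (hs : ∀ w, z w s = g w) (hne : ∀ w t, t ≠ s → z w t = z 0 t) (T : ℕ)
    (hs1 : 1 ≤ s) (hsT : s ≤ T) :
    OneLin R (fun w => weaveUpTo i k (z w) y T) := by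
  have hconst : ∀ T < s, ∀ w, weaveUpTo i k (z w) y T = weaveUpTo i k (z 0) y T := by
    intro T
    induction T with
    | zero => intro _ w; rfl
    | succ T ih =>
      intro hT w
      rw [weaveUpTo, weaveUpTo, ih (by omega), hne w (T + 1) (by omega)]
  induction T with
  | zero => omega
  | succ T ih =>
    rcases Nat.lt_or_ge T s with h | h
    · obtain rfl : s = T + 1 := by omega
      have := OneLin.single (R := R) g (weaveUpTo i k (z 0) y T)
          (seg y (i (T + 1) + k (T + 1)) (i (T + 2)))
      convert this using 2 with w
      rw [weaveUpTo, hconst T h, hs]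
    · have := (ih h).append_right (z 0 (T + 1) :: seg y (i (T + 1) + k (T + 1)) (i (T + 2)))
      convert this using 2 with w
      rw [weaveUpTo, hne w (T + 1) (by omega)]

/-- The entries of `L` are homogeneous of the bidegrees listed in `D`. -/
def HomList (𝒱 : ℤ × ℤ → Submodule R V) (L : List V) (D : List (ℤ × ℤ)) : Prop :=
  List.Forall₂ (fun x d => x ∈ 𝒱 d) L D

theorem HomList.eval {𝒱 : ℤ × ℤ → Submodule R V}
    {f : ∀ n : ℕ, MultilinearMap R (fun _ : Fin n => V) V} {L : List V} {D : List (ℤ × ℤ)}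
    (h : HomList 𝒱 L D) {d : ℤ × ℤ} (hf : IsHomogeneousMap 𝒱 (f L.length) d) :
    evalList f L ∈ 𝒱 (d + D.sum) := by
  have hlen : L.length = D.length := List.Forall₂.length_eq h
  have := hf (fun s => D.get (s.cast hlen)) L.get (fun s => by
    exact (List.forall₂_iff_get.mp h).2 s s.2 (hlen ▸ s.2))
  suffices hs : D.sum = ∑ s, D.get (Fin.cast hlen s) by rw [hs]; exact this
  have hD : D.sum = ∑ s : Fin D.length, D.get s := by
    conv_lhs => rw [← List.ofFn_get D, List.sum_ofFn]
  rw [hD]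
  exact (Fintype.sum_equiv (finCongr hlen) _ _ fun s => rfl).symm

theorem HomList.seg {𝒱 : ℤ × ℤ → Submodule R V} {y : ℕ → V} {β : ℕ → ℤ × ℤ} {a e : ℕ}
    (h : ∀ v, a ≤ v → v < e → y v ∈ 𝒱 (β v)) :
    HomList 𝒱 (seg y a e) (DerivedDeligne.seg β a e) := by
  unfold HomList DerivedDeligne.seg
  rw [List.forall₂_map_left_iff, List.forall₂_map_right_iff, List.forall₂_same]
  intro v hv
  rw [List.mem_range'_1] at hv
  exact h v hv.1 (by omega)

theorem HomList.weaveUpTo {𝒱 : ℤ × ℤ → Submodule R V} {i k : ℕ → ℕ} {z y : ℕ → V}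
    {δ β : ℕ → ℤ × ℤ} {T : ℕ} (hmono : ∀ t ≤ T, i t + k t ≤ i (t + 1))
    (hz : ∀ t, 1 ≤ t → t ≤ T → z t ∈ 𝒱 (δ t))
    (hy : ∀ v, i 0 + k 0 ≤ v → v < i (T + 1) → y v ∈ 𝒱 (β v)) :
    HomList 𝒱 (weaveUpTo i k z y T) (DerivedDeligne.weaveUpTo i k δ β T) := by
  induction T with
  | zero => exact HomList.seg hy
  | succ T ih =>
    have h1 := hmono (T + 1) le_rfl
    have h0 : i 0 + k 0 ≤ i (T + 1) := index_mono (fun t ht => hmono t (by omega)) (by omega)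
    refine List.rel_append (ih (fun t ht => hmono t (by omega)) (fun t a b => hz t a (by omega))
      (fun v a b => hy v a (by omega))) ?_
    exact List.Forall₂.cons (hz (T + 1) (by omega) le_rfl)
      (HomList.seg fun v a b => hy v (by omega) b)

theorem seg_sum (β : ℕ → ℤ × ℤ) (a e : ℕ) : (seg β a e).sum = ∑ v ∈ Finset.Ico a e, β v := by
  unfold seg
  rw [Finset.sum_eq_multiset_sum]
  simp [Finset.Ico, LocallyFiniteOrder.finsetIco, Multiset.map_coe, Multiset.sum_coe]

theorem weaveUpTo_sum {i k : ℕ → ℕ} (δ β : ℕ → ℤ × ℤ) (T : ℕ)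
    (hmono : ∀ t ≤ T, i t + k t ≤ i (t + 1)) :
    (weaveUpTo i k (fun t => δ t + ∑ v ∈ Finset.Ico (i t) (i t + k t), β v) β T).sum =
      ∑ t ∈ Finset.Icc 1 T, δ t + ∑ v ∈ Finset.Ico (i 0 + k 0) (i (T + 1)), β v := by
  induction T with
  | zero => simp [weaveUpTo, seg_sum]
  | succ T ih =>
    have h1 := hmono (T + 1) le_rfl
    have h0 : i 0 + k 0 ≤ i (T + 1) := index_mono (fun t ht => hmono t (by omega)) (by omega)
    rw [weaveUpTo, List.sum_append, List.sum_cons, ih fun t ht => hmono t (by omega), seg_sum,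
      Finset.sum_Icc_succ_top (by omega),
      ← Finset.sum_Ico_consecutive β h0 (show i (T + 1) ≤ i (T + 1 + 1) by omega),
      ← Finset.sum_Ico_consecutive β (show i (T + 1) ≤ i (T + 1) + k (T + 1) by omega) h1]
    abel

theorem weaveUpTo_length {X : Type*} {i k : ℕ → ℕ} (z y : ℕ → X) (T : ℕ)
    (hmono : ∀ t ≤ T, i t + k t ≤ i (t + 1)) :
    ((weaveUpTo i k z y T).length : ℤ) + ∑ t ∈ Finset.Icc 1 T, (k t : ℤ) + i 0 + k 0 =
      T + i (T + 1) := by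
  induction T with
  | zero =>
    have := hmono 0 le_rfl
    simp only [zero_add] at this ⊢
    simp [weaveUpTo, seg]; omega
  | succ T ih =>
    have h1 := hmono (T + 1) le_rfl
    have := ih fun t ht => hmono t (by omega)
    rw [weaveUpTo, List.length_append, List.length_cons, Finset.sum_Icc_succ_top (by omega)]
    simp only [seg, List.length_map, List.length_range']
    have e1 : T + 1 + 1 = T + 2 := rfl
    rw [e1] at h1 ⊢
    push_cast
    omega

end Aux

/-! ### The Hochschild complex `S 𝔰 End_A` of a bigraded module `A` -/

section Hochschild

variable {R A : Type*} [CommRing R] [AddCommGroup A] [Module R A]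

/-- Families of multilinear maps `A ^ n → A`, one for each arity `n ≥ 0`. -/
abbrev Cochains (R A : Type*) [CommRing R] [AddCommGroup A] [Module R A] : Type _ :=
  ∀ n : ℕ, MultilinearMap R (fun _ : Fin n => A) A

/-- The component of natural bidegree `d` of `𝔰 End_A = ∏_n 𝔰 End_A(n)`: the arity `n` part of an
element has internal bidegree `(d.1, d.2 + 1 - n)` as a map `A ^ n → A`. -/
def cochainGrading (𝒜 : ℤ × ℤ → Submodule R A) (d : ℤ × ℤ) : Submodule R (Cochains R A) where
  carrier := {f | ∀ n, IsHomogeneousMap 𝒜 (f n) (d.1, d.2 + 1 - n)}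
  add_mem' hf hg n β a ha := Submodule.add_mem _ (hf n β a ha) (hg n β a ha)
  zero_mem' _ _ _ _ := Submodule.zero_mem _
  smul_mem' c _ hf n β a ha := Submodule.smul_mem _ c (hf n β a ha)

/-- The sequence `a_1, …, a_K` given by the function `a` on `Fin K`. -/
def tuple {X : Type*} [Zero X] {K : ℕ} (a : Fin K → X) (v : ℕ) : X :=
  if h : 1 ≤ v ∧ v ≤ K then a ⟨v - 1, by omega⟩ else 0

/-- The sign exponent `η` in the brace
`b_n(x; x_1, …, x_n) = ∑ (-1) ^ η x(1 ^ (h_0) ⊗ x_1 ⊗ 1 ^ (h_1) ⊗ ⋯ ⊗ x_n ⊗ 1 ^ (h_n))`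
of `𝔰 End_A`, where `x_t` has natural bidegree `β t`, arity `k_t` and internal vertical degree
`q t`. -/
def braceSign {n K : ℕ} (p : InsertionData n K) (β : ℕ → ℤ × ℤ) : ℤ :=
  let h := p.gap
  let k := p.len
  let q : ℕ → ℤ := fun t => (β t).2 + 1 - k t
  ∑ l ∈ Finset.Icc 1 n, ∑ j ∈ Finset.range l, h j * q l +
    ∑ l ∈ Finset.Icc 1 n, ∑ j ∈ Finset.Ico 1 l, (k j : ℤ) * q l +
    ∑ j ∈ Finset.Icc 1 n, ((k j : ℤ) + q j - 1) * ((n : ℤ) - j) +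
    ∑ l ∈ Finset.Icc 1 n, ∑ j ∈ Finset.Icc 1 l, ((k j : ℤ) + q j - 1) * h l

/-- The entries `a_v` with the Koszul signs that arise when
`1 ^ (h_0) ⊗ x_1 ⊗ 1 ^ (h_1) ⊗ ⋯ ⊗ x_n ⊗ 1 ^ (h_n)` is applied to `a_1 ⊗ ⋯ ⊗ a_K`: the map `x_t`, of
internal bidegree `((β t).1, (β t).2 + 1 - k_t)`, moves past `a_v` for all `v < i_t`. -/
noncomputable def koszulEntries (𝒜 : ℤ × ℤ → Submodule R A) [DirectSum.Decomposition 𝒜] {n K : ℕ}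
    (p : InsertionData n K) (β : ℕ → ℤ × ℤ) (a : ℕ → A) (v : ℕ) : A :=
  twist 𝒜 (∑ t ∈ Finset.Icc 1 n with v < p.start t, ((β t).1, (β t).2 + 1 - (p.len t : ℤ))) (a v)

/-- The value at `(a_1, …, a_K)` of the brace `b_n(x; x_1, …, x_n)` of `𝔰 End_A`, for `x_t` of natural
bidegree `β t`. The sum runs over all order preserving insertions of `x_1, …, x_n` into `x`. -/
noncomputable def braceValue (𝒜 : ℤ × ℤ → Submodule R A) [DirectSum.Decomposition 𝒜] (n : ℕ)
    (β : ℕ → ℤ × ℤ) (x₀ : Cochains R A) (x : ℕ → Cochains R A) (K : ℕ) (a : ℕ → A) : A :=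
  ∑ p ∈ insertions n K, sgn (braceSign p β) •
    evalList x₀ (weave p (fun t => evalList (x t) (block p (koszulEntries 𝒜 p β a) t))
      (koszulEntries 𝒜 p β a))

theorem mem_insertions {j n : ℕ} {p : InsertionData j n} (hp : p ∈ insertions j n) :
    ∀ t ≤ j, p.start t + p.len t ≤ p.start (t + 1) := by
  simpa [insertions] using hp

theorem start_zero {j n : ℕ} (p : InsertionData j n) : p.start 0 = 1 := by
  simp [InsertionData.start]

theorem len_zero {j n : ℕ} (p : InsertionData j n) : p.len 0 = 0 := by
  simp [InsertionData.len]

theorem start_last {j n : ℕ} (p : InsertionData j n) : p.start (j + 1) = n + 1 := by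
  simp [InsertionData.start]

theorem tuple_update_self {X : Type*} [Zero X] {K : ℕ} (a : Fin K → X) (s : Fin K) (w : X) :
    tuple (Function.update a s w) (s + 1) = w := by
  have : (1 : ℕ) ≤ s + 1 ∧ (s : ℕ) + 1 ≤ K := ⟨by omega, s.2⟩
  simp [tuple]

theorem tuple_update_of_ne {X : Type*} [Zero X] {K : ℕ} (a : Fin K → X) (s : Fin K) (w w' : X)
    {u : ℕ} (hu : u ≠ s + 1) :
    tuple (Function.update a s w) u = tuple (Function.update a s w') u := by
  unfold tuple
  split_ifs with h
  · rw [Function.update_of_ne, Function.update_of_ne] <;>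
    · intro h'
      have := congrArg Fin.val h'
      simp only at this
      omega
  · rfl

theorem exists_linear_sum {W ι : Type*} [AddCommGroup W] [Module R W] (s : Finset ι)
    (c : ι → ℤ) (F : ι → W → A) (h : ∀ p ∈ s, ∃ g : W →ₗ[R] A, ∀ w, F p w = g w) :
    ∃ g : W →ₗ[R] A, ∀ w, ∑ p ∈ s, c p • F p w = g w := by
  classical
  choose! g hg using h
  refine ⟨∑ p ∈ s, c p • g p, fun w => ?_⟩
  rw [LinearMap.sum_apply]
  exact Finset.sum_congr rfl fun p hp => by rw [hg p hp w]; rfl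

theorem braceValue_linear_arg (𝒜 : ℤ × ℤ → Submodule R A) [DirectSum.Decomposition 𝒜] (n : ℕ)
    (β : ℕ → ℤ × ℤ) (x₀ : Cochains R A) (x : ℕ → Cochains R A) (K : ℕ) (a : Fin K → A)
    (s : Fin K) :
    ∃ g : A →ₗ[R] A, ∀ w, braceValue 𝒜 n β x₀ x K (tuple (Function.update a s w)) = g w := by
  refine exists_linear_sum _ _ _ fun p hp => ?_
  have hmono := mem_insertions hp
  refine OneLin.exists_linear ?_ x₀
  have hv : ∀ w, koszulEntries 𝒜 p β (tuple (Function.update a s w)) (s + 1) =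
      twist 𝒜 (∑ t ∈ Finset.Icc 1 n with (s : ℕ) + 1 < p.start t,
        ((β t).1, (β t).2 + 1 - (p.len t : ℤ))) w := fun w => by
    rw [koszulEntries, tuple_update_self]
  have hne : ∀ w u, u ≠ (s : ℕ) + 1 → koszulEntries 𝒜 p β (tuple (Function.update a s w)) u =
      koszulEntries 𝒜 p β (tuple (Function.update a s 0)) u := fun w u hu => by
    rw [koszulEntries, koszulEntries, tuple_update_of_ne a s w 0 hu]
  refine weaveUpTo_oneLin _ hv hne n hmono (fun t _ _ h1 h2 => ?_) (fun t _ _ h w => ?_) ?_ ?_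
  · exact (seg_oneLin _ hv hne h1 h2).exists_linear (x t)
  · exact congrArg _ (seg_congr fun u h1 h2 => hne w u fun hu => h ⟨by omega, by omega⟩)
  · rw [start_zero, len_zero]; omega
  · rw [start_last]; omega

theorem braceValue_linear_zero (𝒜 : ℤ × ℤ → Submodule R A) [DirectSum.Decomposition 𝒜] (n : ℕ)
    (β : ℕ → ℤ × ℤ) (x : ℕ → Cochains R A) (K : ℕ) (a : ℕ → A) :
    ∃ g : Cochains R A →ₗ[R] A, ∀ w, braceValue 𝒜 n β w x K a = g w :=
  exists_linear_sum _ _ _ fun _ _ =>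
    ⟨{ toFun := fun w => evalList w _, map_add' := fun _ _ => rfl, map_smul' := fun _ _ => rfl },
      fun _ => rfl⟩

theorem braceValue_linear_inserted (𝒜 : ℤ × ℤ → Submodule R A) [DirectSum.Decomposition 𝒜]
    (n : ℕ) (β : ℕ → ℤ × ℤ) (x₀ : Cochains R A) (x : ℕ → Cochains R A) (K : ℕ) (a : ℕ → A)
    {s : ℕ} (hs : 1 ≤ s) (hsn : s ≤ n) :
    ∃ g : Cochains R A →ₗ[R] A,
      ∀ w, braceValue 𝒜 n β x₀ (Function.update x s w) K a = g w := by
  refine exists_linear_sum _ _ _ fun p _ => OneLin.exists_linear ?_ x₀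
  refine weaveUpTo_oneLin_inserted _
    { toFun := fun w : Cochains R A => evalList w (block p (koszulEntries 𝒜 p β a) s),
      map_add' := fun _ _ => rfl, map_smul' := fun _ _ => rfl } (fun w => ?_) (fun w t ht => ?_)
    n hs hsn
  · rw [Function.update_self]; rfl
  · simp [Function.update_of_ne ht]

theorem twist_mem (𝒜 : ℤ × ℤ → Submodule R A) [DirectSum.Decomposition 𝒜] (d : ℤ × ℤ) {e : ℤ × ℤ}
    {a : A} (ha : a ∈ 𝒜 e) : twist 𝒜 d a ∈ 𝒜 e := by
  simp only [twist, LinearMap.comp_apply, LinearEquiv.coe_coe,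
    DirectSum.decomposeLinearEquiv_apply]
  rw [DirectSum.decompose_of_mem 𝒜 ha, ← DirectSum.lof_eq_of R, DirectSum.toModule_lof]
  exact (𝒜 e).toAddSubgroup.zsmul_mem ha _

theorem braceValue_mem (𝒜 : ℤ × ℤ → Submodule R A) [DirectSum.Decomposition 𝒜] (n : ℕ)
    (β : ℕ → ℤ × ℤ) (x₀ : Cochains R A) (d₀ : ℤ × ℤ) (h₀ : x₀ ∈ cochainGrading 𝒜 d₀)
    (x : ℕ → Cochains R A) (hx : ∀ t, 1 ≤ t → t ≤ n → x t ∈ cochainGrading 𝒜 (β t)) (K : ℕ)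
    (a : ℕ → A) (γ : ℕ → ℤ × ℤ) (ha : ∀ v, 1 ≤ v → v ≤ K → a v ∈ 𝒜 (γ v)) :
    braceValue 𝒜 n β x₀ x K a ∈ 𝒜 ((d₀ + ∑ t ∈ Finset.Icc 1 n, β t) + (0, 1 - (K : ℤ)) +
      ∑ v ∈ Finset.Ico 1 (K + 1), γ v) := by
  refine Submodule.sum_mem _ fun p hp => (𝒜 _).toAddSubgroup.zsmul_mem ?_ _
  have hmono := mem_insertions hp
  have hlow : ∀ t ≤ n, 1 ≤ p.start t := by
    intro t ht
    rcases t with _ | t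
    · exact (start_zero p).ge
    · have := index_mono (i := p.start) (k := p.len) (T := t) (fun s hs => hmono s (by omega))
        (Nat.zero_le t)
      rw [start_zero, len_zero] at this
      exact this
  have hhigh : ∀ t ≤ n, p.start t + p.len t ≤ K + 1 := by
    intro t ht
    have := index_mono hmono ht
    rwa [start_last] at this
  have hy : ∀ v, 1 ≤ v → v ≤ K → koszulEntries 𝒜 p β a v ∈ 𝒜 (γ v) :=
    fun v h1 h2 => twist_mem 𝒜 _ (ha v h1 h2)
  have hz : ∀ t, 1 ≤ t → t ≤ n →
      evalList (x t) (block p (koszulEntries 𝒜 p β a) t) ∈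
        𝒜 ((β t + (0, 1 - (p.len t : ℤ))) +
          ∑ v ∈ Finset.Ico (p.start t) (p.start t + p.len t), γ v) := by
    intro t h1 h2
    have hl : HomList 𝒜 (block p (koszulEntries 𝒜 p β a) t)
        (seg γ (p.start t) (p.start t + p.len t)) :=
      HomList.seg fun v hv1 hv2 => hy v (by have := hlow t h2; omega)
        (by have := hhigh t h2; omega)
    have := hl.eval (hx t h1 h2 _)
    rw [seg_sum] at this
    convert this using 3
    have hlen : (block p (koszulEntries 𝒜 p β a) t).length = p.len t := by simp [block, seg]
    rw [hlen]
    refine Prod.ext ?_ ?_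
    · simp
    · simp only [Prod.snd_add]; ring
  have hw := HomList.weaveUpTo (𝒱 := 𝒜) hmono hz (y := koszulEntries 𝒜 p β a) (β := γ)
    (fun v h1 h2 => hy v (by rw [start_zero] at h1; omega) (by rw [start_last] at h2; omega))
  have := hw.eval (h₀ _)
  rw [weaveUpTo_sum _ _ _ hmono, start_zero, len_zero, start_last] at this
  have hlen := weaveUpTo_length (fun t => evalList (x t) (block p (koszulEntries 𝒜 p β a) t))
    (koszulEntries 𝒜 p β a) n hmono
  rw [start_zero, len_zero, start_last] at hlen
  have hs : ∑ t ∈ Finset.Icc 1 n, ((0 : ℤ), 1 - (p.len t : ℤ)) =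
      (0, (n : ℤ) - ∑ t ∈ Finset.Icc 1 n, (p.len t : ℤ)) := by
    ext
    · simp [Prod.fst_sum]
    · simp [Prod.snd_sum]
  rw [Finset.sum_add_distrib, hs, add_zero] at this
  have hd : (d₀ + ∑ t ∈ Finset.Icc 1 n, β t) + (0, 1 - (K : ℤ)) + ∑ v ∈ Finset.Ico 1 (K + 1), γ v =
      (d₀.1, d₀.2 + 1 - ((weaveUpTo p.start p.len
        (fun t => evalList (x t) (block p (koszulEntries 𝒜 p β a) t))
        (koszulEntries 𝒜 p β a) n).length : ℤ)) +
      (∑ t ∈ Finset.Icc 1 n, β t + (0, (n : ℤ) - ∑ t ∈ Finset.Icc 1 n, (p.len t : ℤ)) +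
        ∑ v ∈ Finset.Ico 1 (K + 1), γ v) := by
    refine Prod.ext ?_ ?_
    · simp only [Prod.fst_add]; ring
    · simp only [Prod.snd_add]
      zify at hlen
      linarith
  rw [hd]
  exact this

/-- The brace `b_n(x_0; x_1, …, x_n)` of `𝔰 End_A` on elements `x_t` of natural bidegree `β t`. -/
noncomputable def braceCochain (𝒜 : ℤ × ℤ → Submodule R A) [DirectSum.Decomposition 𝒜] {n : ℕ}
    (β : Fin (n + 1) → ℤ × ℤ) (x : Fin (n + 1) → Cochains R A) : Cochains R A := fun K =>
  { toFun := fun a => braceValue 𝒜 n (tuple (Fin.tail β)) (x 0) (tuple (Fin.tail x)) K (tuple a)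
    map_update_add' := fun {inst} a s w w' => by
      have : inst = instDecidableEqFin K := Subsingleton.elim _ _
      subst this
      obtain ⟨g, hg⟩ := braceValue_linear_arg 𝒜 n (tuple (Fin.tail β)) (x 0)
        (tuple (Fin.tail x)) K a s
      rw [hg, hg, hg, map_add]
    map_update_smul' := fun {inst} a s c w => by
      have : inst = instDecidableEqFin K := Subsingleton.elim _ _
      subst this
      obtain ⟨g, hg⟩ := braceValue_linear_arg 𝒜 n (tuple (Fin.tail β)) (x 0)
        (tuple (Fin.tail x)) K a s
      rw [hg, hg, map_smul] }

theorem tuple_succ {X : Type*} [Zero X] {K : ℕ} (a : Fin K → X) (s : Fin K) :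
    tuple a (s + 1) = a s := by
  have : (s : ℕ) + 1 ≤ K := s.2
  simp [tuple]

theorem tuple_sum {K : ℕ} (β : Fin K → ℤ × ℤ) :
    ∑ v ∈ Finset.Ico 1 (K + 1), tuple β v = ∑ s, β s := by
  rw [Finset.sum_Ico_eq_sum_range, ← Fin.sum_univ_eq_sum_range (fun v => tuple β (1 + v))]
  exact Finset.sum_congr rfl fun s _ => by rw [add_comm]; exact tuple_succ β s

theorem tuple_prop {X Y : Type*} [Zero X] [Zero Y] {P : X → Y → Prop} {K : ℕ} {a : Fin K → X}
    {β : Fin K → Y} (h : ∀ s, P (a s) (β s)) (v : ℕ) (h1 : 1 ≤ v) (h2 : v ≤ K) :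
    P (tuple a v) (tuple β v) := by
  have := h ⟨v - 1, by omega⟩
  simpa [tuple, h1, h2] using this

theorem braceCochain_mem (𝒜 : ℤ × ℤ → Submodule R A) [DirectSum.Decomposition 𝒜] {n : ℕ}
    (β : Fin (n + 1) → ℤ × ℤ) (x : Fin (n + 1) → Cochains R A)
    (hx : ∀ t, x t ∈ cochainGrading 𝒜 (β t)) :
    braceCochain 𝒜 β x ∈ cochainGrading 𝒜 (∑ t, β t) := by
  intro K γ a ha
  have := braceValue_mem 𝒜 n (tuple (Fin.tail β)) (x 0) (β 0) (hx 0) (tuple (Fin.tail x))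
    (tuple_prop (P := fun y d => y ∈ cochainGrading 𝒜 d) (a := Fin.tail x) (β := Fin.tail β)
      fun s => hx s.succ) K (tuple a) (tuple γ)
    (tuple_prop (P := fun y d => y ∈ 𝒜 d) ha)
  rw [tuple_sum] at this
  have h2 : ∑ t ∈ Finset.Icc 1 n, tuple (Fin.tail β) t = ∑ s, Fin.tail β s := by
    rw [← tuple_sum]; rfl
  rw [h2] at this
  rw [Fin.sum_univ_succ]
  have hd : ((β 0 + ∑ s : Fin n, β s.succ).1, (β 0 + ∑ s : Fin n, β s.succ).2 + 1 - (K : ℤ)) +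
      ∑ s, γ s = β 0 + ∑ s, Fin.tail β s + (0, 1 - (K : ℤ)) + ∑ s, γ s := by
    refine Prod.ext ?_ ?_
    · simp [Fin.tail]
    · simp only [Prod.snd_add, Fin.tail]; ring
  rw [hd]
  exact this

theorem braceCochain_linear (𝒜 : ℤ × ℤ → Submodule R A) [DirectSum.Decomposition 𝒜] {n : ℕ}
    (β : Fin (n + 1) → ℤ × ℤ) (x : Fin (n + 1) → Cochains R A) (s : Fin (n + 1)) (K : ℕ)
    (a : Fin K → A) :
    ∃ g : Cochains R A →ₗ[R] A, ∀ w, braceCochain 𝒜 β (Function.update x s w) K a = g w := by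
  refine Fin.cases ?_ (fun s => ?_) s
  · obtain ⟨g, hg⟩ := braceValue_linear_zero 𝒜 n (tuple (Fin.tail β)) (tuple (Fin.tail x)) K
      (tuple a)
    refine ⟨g, fun w => ?_⟩
    rw [← hg]
    change braceValue _ _ _ _ _ _ _ = _
    rw [Fin.tail_update_zero, Function.update_self]
  · obtain ⟨g, hg⟩ := braceValue_linear_inserted 𝒜 n (tuple (Fin.tail β)) (x 0)
      (tuple (Fin.tail x)) K (tuple a) (s := s + 1) (by omega) s.2
    refine ⟨g, fun w => ?_⟩
    rw [← hg]
    change braceValue _ _ _ _ _ _ _ = _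
    rw [Fin.tail_update_succ, Function.update_of_ne (Fin.succ_ne_zero s).symm]
    congr 1
    funext u
    by_cases hu : u = s + 1
    · subst hu; rw [tuple_update_self, Function.update_self]
    · rw [Function.update_of_ne hu, tuple_update_of_ne _ s w (Fin.tail x s) hu,
        Function.update_eq_self]

/-- The underlying module of the bigraded module `𝔰 End_A`, the direct sum of its components
`(𝔰 End_A)_d`. It is also the underlying module of the Hochschild complex `S 𝔰 End_A`. -/
def SuspEnd (𝒜 : ℤ × ℤ → Submodule R A) : Type _ := ⨁ d : ℤ × ℤ, cochainGrading 𝒜 d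

noncomputable instance suspEndAddCommGroup (𝒜 : ℤ × ℤ → Submodule R A) :
    AddCommGroup (SuspEnd 𝒜) :=
  inferInstanceAs (AddCommGroup (⨁ d : ℤ × ℤ, cochainGrading 𝒜 d))

noncomputable instance suspEndModule (𝒜 : ℤ × ℤ → Submodule R A) : Module R (SuspEnd 𝒜) :=
  inferInstanceAs (Module R (⨁ d : ℤ × ℤ, cochainGrading 𝒜 d))

/-- The inclusion of the component of natural bidegree `d`. -/
noncomputable def SuspEnd.lof (𝒜 : ℤ × ℤ → Submodule R A) (d : ℤ × ℤ) :
    cochainGrading 𝒜 d →ₗ[R] SuspEnd 𝒜 :=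
  DirectSum.lof R (ℤ × ℤ) (fun d => cochainGrading 𝒜 d) d

/-- The grading of `𝔰 End_A` by the natural bidegree. -/
noncomputable def suspEndGrading (𝒜 : ℤ × ℤ → Submodule R A) (d : ℤ × ℤ) :
    Submodule R (SuspEnd 𝒜) :=
  LinearMap.range (SuspEnd.lof 𝒜 d)

theorem SuspEnd.hom_ext {𝒜 : ℤ × ℤ → Submodule R A} {W : Type*} [AddCommGroup W] [Module R W]
    {f g : SuspEnd 𝒜 →ₗ[R] W} (h : ∀ d x, f (SuspEnd.lof 𝒜 d x) = g (SuspEnd.lof 𝒜 d x)) : f = g :=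
  DirectSum.linearMap_ext R fun d => LinearMap.ext fun x => h d x

/-- The decomposition of the elements of `𝔰 End_A` into their homogeneous components. -/
noncomputable def SuspEnd.components (𝒜 : ℤ × ℤ → Submodule R A) :
    SuspEnd 𝒜 →ₗ[R] ⨁ d : ℤ × ℤ, suspEndGrading 𝒜 d :=
  DirectSum.toModule R (ℤ × ℤ) _ fun d =>
    DirectSum.lof R (ℤ × ℤ) (fun d => suspEndGrading 𝒜 d) d ∘ₗ
      (SuspEnd.lof 𝒜 d).codRestrict (suspEndGrading 𝒜 d) fun x => ⟨x, rfl⟩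

theorem SuspEnd.components_lof (𝒜 : ℤ × ℤ → Submodule R A) (d : ℤ × ℤ) (x : cochainGrading 𝒜 d) :
    SuspEnd.components 𝒜 (SuspEnd.lof 𝒜 d x) =
      DirectSum.lof R (ℤ × ℤ) (fun d => suspEndGrading 𝒜 d) d ⟨SuspEnd.lof 𝒜 d x, ⟨x, rfl⟩⟩ := by
  unfold SuspEnd.components
  exact DirectSum.toModule_lof R (M := fun d => cochainGrading 𝒜 d) (φ := fun d =>
    DirectSum.lof R (ℤ × ℤ) (fun d => suspEndGrading 𝒜 d) d ∘ₗ
      (SuspEnd.lof 𝒜 d).codRestrict (suspEndGrading 𝒜 d) fun x => ⟨x, rfl⟩) d x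

noncomputable instance suspEndDecomposition (𝒜 : ℤ × ℤ → Submodule R A) :
    DirectSum.Decomposition (suspEndGrading 𝒜) :=
  DirectSum.Decomposition.ofLinearMap (suspEndGrading 𝒜) (SuspEnd.components 𝒜)
    (SuspEnd.hom_ext fun d x => by
      rw [LinearMap.comp_apply, SuspEnd.components_lof, DirectSum.coeLinearMap_lof]
      rfl)
    (DirectSum.linearMap_ext R fun d => LinearMap.ext fun f => by
      obtain ⟨_, x, rfl⟩ := f
      rw [LinearMap.comp_apply, LinearMap.comp_apply, DirectSum.coeLinearMap_lof,
        SuspEnd.components_lof]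
      rfl)

/-- The braces `b_n(x; x_1, …, x_n)` of `𝔰 End_A`. -/
noncomputable def suspEndBrace (𝒜 : ℤ × ℤ → Submodule R A) [DirectSum.Decomposition 𝒜] (n : ℕ) :
    MultilinearMap R (fun _ : Fin (n + 1) => SuspEnd 𝒜) (SuspEnd 𝒜) :=
  MultilinearMap.fromDFinsuppEquiv (fun _ : Fin (n + 1) => ℤ × ℤ) R fun β =>
    { toFun := fun x => SuspEnd.lof 𝒜 (∑ t, β t)
        ⟨braceCochain 𝒜 β fun t => x t, braceCochain_mem 𝒜 β _ fun t => (x t).2⟩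
      map_update_add' := fun {inst} x s w w' => by
        have : inst = instDecidableEqFin (n + 1) := Subsingleton.elim _ _
        subst this
        rw [← map_add]
        congr 1
        refine Subtype.ext (funext fun K => MultilinearMap.ext fun a => ?_)
        obtain ⟨g, hg⟩ := braceCochain_linear 𝒜 β (fun t => (x t : Cochains R A)) s K a
        have hu : ∀ u : cochainGrading 𝒜 (β s),
            (fun t => (Function.update x s u t : Cochains R A)) =
              Function.update (fun t => (x t : Cochains R A)) s u := fun u => by
          funext t
          rcases eq_or_ne t s with rfl | ht
          · simp
          · simp [Function.update_of_ne ht]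
        change braceCochain 𝒜 β _ K a = braceCochain 𝒜 β _ K a + braceCochain 𝒜 β _ K a
        rw [hu, hu, hu, hg, hg, hg, Submodule.coe_add, map_add]
      map_update_smul' := fun {inst} x s c w => by
        have : inst = instDecidableEqFin (n + 1) := Subsingleton.elim _ _
        subst this
        rw [← map_smul]
        congr 1
        refine Subtype.ext (funext fun K => MultilinearMap.ext fun a => ?_)
        obtain ⟨g, hg⟩ := braceCochain_linear 𝒜 β (fun t => (x t : Cochains R A)) s K a
        have hu : ∀ u : cochainGrading 𝒜 (β s),
            (fun t => (Function.update x s u t : Cochains R A)) =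
              Function.update (fun t => (x t : Cochains R A)) s u := fun u => by
          funext t
          rcases eq_or_ne t s with rfl | ht
          · simp
          · simp [Function.update_of_ne ht]
        change braceCochain 𝒜 β _ K a = c • braceCochain 𝒜 β _ K a
        rw [hu, hu, hg, hg, Submodule.coe_smul, map_smul] }

/-- The component `m_i•` of natural bidegree `(i, 1 - i)` of a derived `A_∞`-algebra structure, as an
element of `𝔰 End_A`: the sequence of the maps `m_ij : A ^ j → A` for `j ≥ 1`. -/
noncomputable def hochMul (𝒜 : ℤ × ℤ → Submodule R A)
    (m : ℕ → ∀ j : ℕ, MultilinearMap R (fun _ : Fin j => A) A)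
    (hm : IsDerivedAInfinityAlgebra 𝒜 m) (i : ℕ) : SuspEnd 𝒜 :=
  SuspEnd.lof 𝒜 ((i : ℤ), 1 - (i : ℤ)) ⟨fun j => m i j, fun j => by
    rcases Nat.eq_zero_or_pos j with rfl | hj
    · intro β a _
      change m i 0 a ∈ _
      rw [hm.arity_zero]
      exact Submodule.zero_mem _
    · have h := hm.homogeneous i j hj
      have hd : (((i : ℤ), (1 - (i : ℤ)) + 1 - (j : ℤ)) : ℤ × ℤ) = ((i : ℤ), 2 - ((i : ℤ) + j)) :=
        Prod.ext rfl (by ring)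
      intro β a ha
      rw [hd]
      exact h β a ha⟩

/-- The structure maps `M_ij` on the Hochschild complex `S 𝔰 End_A` of a derived `A_∞`-algebra:
`M_i1 (Sx) = S b_1(m_i•; x) - (-1) ^ ⟨x, m_i•⟩ S b_1(x; m_i•)`, and for `j ≥ 2`
`M_ij (Sx_1, …, Sx_j) = (-1) ^ (∑ v, (j - v) * vdeg x_v) S b_j(m_i•; x_1, …, x_j)`, where `vdeg` is
the vertical natural degree and `⟨x, m_i•⟩` is the pairing of natural bidegrees. -/
noncomputable def hochM (𝒜 : ℤ × ℤ → Submodule R A) [DirectSum.Decomposition 𝒜]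
    (m : ℕ → ∀ j : ℕ, MultilinearMap R (fun _ : Fin j => A) A)
    (hm : IsDerivedAInfinityAlgebra 𝒜 m) (i : ℕ) :
    ∀ j : ℕ, MultilinearMap R (fun _ : Fin j => SuspEnd 𝒜) (SuspEnd 𝒜)
  | 0 => 0
  | 1 => (suspEndBrace 𝒜 1).curryLeft (hochMul 𝒜 m hm i) -
      ((LinearMap.applyₗ (hochMul 𝒜 m hm i)).compMultilinearMap
        (suspEndBrace 𝒜 1).curryRight).compLinearMap
          fun _ => twist (V := SuspEnd 𝒜) (suspEndGrading 𝒜) ((i : ℤ), 1 - (i : ℤ))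
  | j + 2 => ((suspEndBrace 𝒜 (j + 2)).curryLeft (hochMul 𝒜 m hm i)).compLinearMap
      fun v => twist (V := SuspEnd 𝒜) (suspEndGrading 𝒜) (0, ((j + 2 : ℕ) : ℤ) - ((v : ℤ) + 1))

end Hochschild

end DerivedDeligne

namespace DerivedDeligne

/-! ### Signs -/

section Signs

/-! The mechanism is conjugation with the shift. Regard the entries of cochains as elements of
$S^{-1}A$. A cochain of natural bidegree $d$ then has bidegree $d$ in every arity
(`evalList_mem_vshift`). Multiply its value on $a_1,\dots,a_K$ by the sign in which each vertical
degree is weighted by the number of entries behind it (`shiftEval`). All the sign sums in $\eta$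
then collapse, and $b_n(x;x_1,\dots,x_n)$ becomes the plain sum over all insertions of
$x_1,\dots,x_n$ into $x$ with Koszul signs only (`braceValue_eq_insertSum`,
`HomElt.opEval_braceEval`). No information is lost, since `opEval` is injective on $\mathfrak
s\mathrm{End}_A$ (`opEval_injective`).

With pure Koszul signs the brace relation is combinatorics of lists. Inserting $Y$ into the result
of inserting $X$ distributes $Y$ over the blocks of $X$ and the gaps between them. This is
`insertSum_insertSum`, proved from the recursive description `insertSum` of sums over insertions.
Pulled back along `opEval`, it gives `HomElt.braceEval_braceEval`.

In the same normalization the derived $A_\infty$-relations of $A$ become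
$\sum_{i+p=u}(-1)^p\,b_1(m_{i\bullet};m_{p\bullet})=0$ (`sum_brace_hochMul`), and the maps $M_{ij}$
become $P_i(L)=b(m_{i\bullet};L)-c_i(L)$ (`hochP`). The correction $c_i$ (`hochCorr`) is
$m_{i\bullet}$ on the empty list, $\pm b_1(x;m_{i\bullet})$ on a single entry and $0$ on longer
lists. Both nonzero cases are the two ways in which one further element $m_{i\bullet}$ can meet a
list: between two entries, or inside one. Hence the brace relation gives
$b_1(b(x;X);m_{i\bullet})=\pm\sum b(x;A,c_i(C),D)$, summed over $X=A\,C\,D$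
(`braceEval_twist_braceEval`).

This identity drives the remaining relations. In $\sum(-1)^pP_i(\dots,P_p(\dots),\dots)$ the double
braces vanish by `sum_brace_hochMul`, the terms $b(m_{i\bullet};\dots,c_p(\dots),\dots)$ cancel in
pairs under $i\leftrightarrow p$ because $(-1)^{p+\langle
m_{i\bullet},m_{p\bullet}\rangle}=-(-1)^i$, and the terms with two corrections cancel separately
(`sum_hochP_hochP`). The relations of a derived $J$-algebra are the brace relation applied to
$m_{i\bullet}$, where for $j=1$ the corrections on both sides agree (`hochM_brace_one`). What
remains is to match the stated exponents modulo 2 (`sgn_jSign`, `sgn_jSignOuter`, `sgn_jSignInner`).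
-/

theorem sgn_add (a b : ℤ) : sgn (a + b) = sgn a * sgn b := by
  simp [sgn, Int.negOnePow_add]

theorem sgn_zero : sgn 0 = 1 := by simp [sgn]

theorem sgn_mul_self (a : ℤ) : sgn a * sgn a = 1 := by
  rw [sgn, ← Units.val_mul, Int.units_mul_self, Units.val_one]

/-- Half of the difference is an explicit argument: a comparison of signs is thereby reduced to an
identity of integers that `ring` can check. -/
theorem sgn_congr {a b : ℤ} (c : ℤ) (h : a = b + 2 * c) : sgn a = sgn b := by
  rw [h, sgn, sgn, Int.negOnePow_add, Int.negOnePow_two_mul, mul_one]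

variable {M : Type*} [AddCommGroup M]

theorem sgn_smul_smul (a b : ℤ) (x : M) : sgn a • sgn b • x = sgn (a + b) • x := by
  rw [smul_smul, sgn_add]

theorem sgn_smul_self (a : ℤ) (x : M) : sgn a • sgn a • x = x := by
  rw [smul_smul, sgn_mul_self, one_smul]

theorem sgn_smul_injective (a : ℤ) {x y : M} (h : sgn a • x = sgn a • y) : x = y := by
  rw [← sgn_smul_self a x, h, sgn_smul_self]

theorem pairing_add_left (a b c : ℤ × ℤ) : pairing (a + b) c = pairing a c + pairing b c := by
  simp only [pairing, Prod.fst_add, Prod.snd_add]; ring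

theorem pairing_add_right (a b c : ℤ × ℤ) : pairing a (b + c) = pairing a b + pairing a c := by
  simp only [pairing, Prod.fst_add, Prod.snd_add]; ring

theorem pairing_comm (a b : ℤ × ℤ) : pairing a b = pairing b a := by
  simp only [pairing]; ring

theorem pairing_zero_left (a : ℤ × ℤ) : pairing 0 a = 0 := by simp [pairing]

theorem pairing_zero_right (a : ℤ × ℤ) : pairing a 0 = 0 := by simp [pairing]

theorem pairing_sum_left {ι : Type*} (s : Finset ι) (f : ι → ℤ × ℤ) (a : ℤ × ℤ) :
    pairing (∑ t ∈ s, f t) a = ∑ t ∈ s, pairing (f t) a := by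
  simp only [pairing, Prod.fst_sum, Prod.snd_sum, Finset.sum_mul, Finset.sum_add_distrib]

end Signs

/-! ### Sums over the decompositions of a list -/

section Splits

variable {V W M N : Type*} [AddCommMonoid M] [AddCommMonoid N]

/-- The sum of `f A B` over all decompositions `L = A ++ B`. -/
def splitSum (f : List V → List V → M) : List V → M
  | [] => f [] []
  | a :: L => f [] (a :: L) + splitSum (fun A B => f (a :: A) B) L

/-- The sum of `f A C D` over all decompositions `L = A ++ C ++ D`. -/
def splitSum₃ (f : List V → List V → List V → M) (L : List V) : M :=
  splitSum (fun A B => splitSum (f A) B) L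

theorem splitSum_congr {f g : List V → List V → M} {L : List V}
    (h : ∀ A B, A ++ B = L → f A B = g A B) : splitSum f L = splitSum g L := by
  induction L generalizing f g with
  | nil => exact h [] [] rfl
  | cons a L ih =>
    rw [splitSum, splitSum, h [] (a :: L) rfl,
      ih fun A B hAB => h (a :: A) B (by rw [List.cons_append, hAB])]

theorem splitSum₃_congr {f g : List V → List V → List V → M} {L : List V}
    (h : ∀ A C D, A ++ (C ++ D) = L → f A C D = g A C D) : splitSum₃ f L = splitSum₃ g L :=
  splitSum_congr fun A B hAB => splitSum_congr fun C D hCD => h A C D (by rw [hCD, hAB])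

theorem map_splitSum (g : M →+ N) (f : List V → List V → M) (L : List V) :
    g (splitSum f L) = splitSum (fun A B => g (f A B)) L := by
  induction L generalizing f with
  | nil => rfl
  | cons a L ih => rw [splitSum, splitSum, map_add, ih]

theorem map_splitSum₃ (g : M →+ N) (f : List V → List V → List V → M) (L : List V) :
    g (splitSum₃ f L) = splitSum₃ (fun A C D => g (f A C D)) L := by
  rw [splitSum₃, map_splitSum]
  simp only [map_splitSum]
  rfl

theorem splitSum_add (f g : List V → List V → M) (L : List V) :
    splitSum (fun A B => f A B + g A B) L = splitSum f L + splitSum g L := by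
  induction L generalizing f g with
  | nil => rfl
  | cons a L ih => rw [splitSum, splitSum, splitSum, ih]; abel

theorem splitSum_zero (L : List V) : splitSum (fun _ _ => (0 : M)) L = 0 := by
  induction L with
  | nil => rfl
  | cons a L ih => rw [splitSum, ih, add_zero]

theorem splitSum₃_add (f g : List V → List V → List V → M) (L : List V) :
    splitSum₃ (fun A C D => f A C D + g A C D) L = splitSum₃ f L + splitSum₃ g L := by
  simp only [splitSum₃, splitSum_add]

theorem splitSum_comm (f : List V → List V → List W → List W → M) (L : List V) (L' : List W) :
    splitSum (fun A B => splitSum (f A B) L') L =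
      splitSum (fun A' B' => splitSum (fun A B => f A B A' B') L) L' := by
  induction L generalizing f with
  | nil => rfl
  | cons a L ih => simp only [splitSum, splitSum_add, ih]

theorem splitSum_map (h : V → W) (f : List W → List W → M) (L : List V) :
    splitSum f (L.map h) = splitSum (fun A B => f (A.map h) (B.map h)) L := by
  induction L generalizing f with
  | nil => rfl
  | cons a L ih => rw [List.map_cons, splitSum, splitSum, ih]; rfl

theorem splitSum₃_map (h : V → W) (f : List W → List W → List W → M) (L : List V) :
    splitSum₃ f (L.map h) = splitSum₃ (fun A C D => f (A.map h) (C.map h) (D.map h)) L := by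
  simp only [splitSum₃, splitSum_map]

/-- A cut of the list falls either in front of `z` or behind it. -/
theorem splitSum_append_cons (f : List V → List V → M) (A : List V) (z : V) (U : List V) :
    splitSum f (A ++ z :: U) = splitSum (fun A' A'' => f A' (A'' ++ z :: U)) A +
      splitSum (fun U' U'' => f (A ++ z :: U') U'') U := by
  induction A generalizing f with
  | nil => rfl
  | cons a A ih => rw [List.cons_append, splitSum, splitSum, ih]; simp only [List.cons_append, add_assoc]

/-- Cutting the left piece once more or the right piece once more enumerates the same decompositions
into three pieces. -/
theorem splitSum_coassoc (f : List V → List V → List V → M) (L : List V) :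
    splitSum (fun A B => splitSum (fun C D => f C D B) A) L = splitSum₃ f L := by
  induction L generalizing f with
  | nil => rfl
  | cons a L ih =>
    rw [splitSum₃, splitSum, splitSum, splitSum, splitSum]
    simp only [splitSum, splitSum_add]
    rw [ih]
    simp only [splitSum₃, add_assoc]

/-- Both sides run over the decompositions of `L` into five consecutive pieces. On the left the last
piece is cut again, on the right the first one. -/
theorem splitSum₃_coassoc (f : List V → List V → List V → List V → List V → M) (L : List V) :
    splitSum₃ (fun A C D => splitSum₃ (f A C) D) L =
      splitSum₃ (fun X C₁ D₁ => splitSum₃ (fun A C D => f A C D C₁ D₁) X) L := by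
  have h2 : splitSum₃ (fun X C₁ D₁ => splitSum₃ (fun A C D => f A C D C₁ D₁) X) L =
      splitSum (fun X r => splitSum (fun A Y => splitSum (fun C₁ D₁ =>
        splitSum (fun C D => f A C D C₁ D₁) Y) r) X) L :=
    splitSum_congr fun X r _ => splitSum_comm _ _ _
  rw [h2, splitSum_coassoc (fun A Y r => splitSum (fun C₁ D₁ =>
        splitSum (fun C D => f A C D C₁ D₁) Y) r)]
  refine splitSum_congr fun A q _ => ?_
  have h3 : splitSum (fun Y r => splitSum (fun C₁ D₁ =>
      splitSum (fun C D => f A C D C₁ D₁) Y) r) q =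
      splitSum (fun Y r => splitSum (fun C D => splitSum (fun C₁ D₁ => f A C D C₁ D₁) r) Y) q :=
    splitSum_congr fun Y r _ => splitSum_comm _ _ _
  rw [h3, splitSum_coassoc (fun C D r => splitSum (fun C₁ D₁ => f A C D C₁ D₁) r)]
  rfl

theorem splitSum₃_comm (f : List V → List V → List V → List W → List W → M) (L : List V)
    (L' : List W) :
    splitSum₃ (fun A C D => splitSum (f A C D) L') L =
      splitSum (fun A' B' => splitSum₃ (fun A C D => f A C D A' B') L) L' := by
  simp only [splitSum₃]
  rw [← splitSum_comm]
  exact splitSum_congr fun A B _ => splitSum_comm _ _ _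

end Splits

/-! ### Functions on lists which are additive in each entry -/

section ListAdditive

variable {V M N : Type*} [AddCommGroup V] [AddCommGroup M] [AddCommGroup N]

/-- The function `F` on lists is additive in each entry of the list. -/
def ListAdditive (F : List V → M) : Prop :=
  ∀ L₁ L₂ : List V, ∃ g : V →+ M, ∀ w, F (L₁ ++ w :: L₂) = g w

/-- The entries of the list `L'` differ from those of `L` by signs with product `(-1) ^ e`. -/
inductive Rescaled : List V → List V → ℤ → Prop
  | nil : Rescaled [] [] 0
  | cons {a' a : V} {d : ℤ} {L' L : List V} {e : ℤ} (h : a' = sgn d • a) (hL : Rescaled L' L e) :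
      Rescaled (a' :: L') (a :: L) (d + e)

theorem Rescaled.append {L' L K' K : List V} {d e : ℤ} (h : Rescaled L' L d)
    (h' : Rescaled K' K e) : Rescaled (L' ++ K') (L ++ K) (d + e) := by
  induction h with
  | nil => rw [zero_add]; exact h'
  | cons ha _ ih => rw [add_assoc]; exact Rescaled.cons ha ih

theorem Rescaled.refl (L : List V) : Rescaled L L 0 := by
  induction L with
  | nil => exact Rescaled.nil
  | cons a L ih =>
    rw [← add_zero (0 : ℤ)]
    exact Rescaled.cons (by rw [sgn_zero, one_smul]) ih

theorem ListAdditive.append_left {F : List V → M} (hF : ListAdditive F) (L : List V) :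
    ListAdditive fun U => F (L ++ U) := fun L₁ L₂ => by
  obtain ⟨g, hg⟩ := hF (L ++ L₁) L₂
  exact ⟨g, fun w => by rw [← hg, List.append_assoc]⟩

theorem ListAdditive.append_right {F : List V → M} (hF : ListAdditive F) (L : List V) :
    ListAdditive fun U => F (U ++ L) := fun L₁ L₂ => by
  obtain ⟨g, hg⟩ := hF L₁ (L₂ ++ L)
  exact ⟨g, fun w => by simp only [← hg, List.append_assoc, List.cons_append]⟩

theorem ListAdditive.rescale {F : List V → M} (hF : ListAdditive F) {L' L : List V} {e : ℤ}
    (h : Rescaled L' L e) : F L' = sgn e • F L := by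
  -- The induction needs an arbitrary prefix: passing to the tail moves the head of the list into
  -- it.
  suffices ∀ K, F (K ++ L') = sgn e • F (K ++ L) from this []
  induction h with
  | nil => intro K; rw [sgn_zero, one_smul]
  | @cons a' a d L' L e ha _ ih =>
    intro K
    have h1 := ih (K ++ [a'])
    rw [List.append_assoc, List.append_assoc, List.singleton_append, List.singleton_append] at h1
    obtain ⟨g, hg⟩ := hF K L
    rw [h1, hg, hg, ha, map_zsmul, smul_smul, ← sgn_add, add_comm]

theorem ListAdditive.comp {F : List V → M} (hF : ListAdditive F) (g : M →+ N) :
    ListAdditive fun L => g (F L) := fun L₁ L₂ => by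
  obtain ⟨k, hk⟩ := hF L₁ L₂
  exact ⟨g.comp k, fun w => by simp only [hk]; rfl⟩

end ListAdditive

end DerivedDeligne

namespace DerivedDeligne

/-! ### Sums over the insertions of a list of operations into a list of elements -/

section InsertSum

/-- An operation on lists together with its bidegree. -/
abbrev Op (V : Type*) : Type _ := (ℤ × ℤ) × (List V → V)

variable {V W M N : Type*} [AddCommMonoid M] [AddCommMonoid N]

/-- The sum of the bidegrees of the operations of a list. -/
def opsDeg (X : List (Op V)) : ℤ × ℤ := (X.map Prod.fst).sum

theorem opsDeg_cons (x : Op V) (X : List (Op V)) : opsDeg (x :: X) = x.1 + opsDeg X := by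
  simp [opsDeg]

theorem opsDeg_append (X Y : List (Op V)) : opsDeg (X ++ Y) = opsDeg X + opsDeg Y := by
  simp [opsDeg]

theorem opsDeg_nil : opsDeg ([] : List (Op V)) = 0 := rfl

/-- The sum of the values of `F` over all lists which are obtained from `L` by applying the
operations `X`, in this order, to pairwise disjoint (possibly empty) blocks of `L`. The Koszul signs
are encoded in `τ`: an entry is hit by `τ d` when an operation of bidegree `d` moves past it. -/
def insertSum (τ : ℤ × ℤ → V → V) : List (Op V) → (List V → M) → List V → M
  | [], F, L => F L
  | x :: X, F, L => splitSum₃ (fun A C D => insertSum τ X (fun U =>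
      F (A.map (τ (x.1 + opsDeg X)) ++ x.2 (C.map (τ (opsDeg X))) :: U)) D) L

theorem insertSum_cons (τ : ℤ × ℤ → V → V) (x : Op V) (X : List (Op V)) (F : List V → M)
    (L : List V) : insertSum τ (x :: X) F L = splitSum₃ (fun A C D => insertSum τ X (fun U =>
      F (A.map (τ (x.1 + opsDeg X)) ++ x.2 (C.map (τ (opsDeg X))) :: U)) D) L := rfl

theorem map_insertSum (τ : ℤ × ℤ → V → V) (g : M →+ N) (X : List (Op V)) (F : List V → M)
    (L : List V) : g (insertSum τ X F L) = insertSum τ X (fun U => g (F U)) L := by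
  induction X generalizing F L with
  | nil => rfl
  | cons x X ih => simp only [insertSum_cons, map_splitSum₃, ih]

theorem insertSum_splitSum (τ : ℤ × ℤ → V → V) (X : List (Op V))
    (f : List V → List W → List W → M) (L : List W) (A : List V) :
    insertSum τ X (fun U => splitSum (f U) L) A =
      splitSum (fun A' B' => insertSum τ X (fun U => f U A' B') A) L := by
  induction X generalizing f A with
  | nil => rfl
  | cons x X ih => simp only [insertSum_cons, ih, splitSum₃_comm]

theorem insertSum_splitSum₃ (τ : ℤ × ℤ → V → V) (X : List (Op V))
    (f : List V → List W → List W → List W → M) (L : List W) (A : List V) :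
    insertSum τ X (fun U => splitSum₃ (f U) L) A =
      splitSum₃ (fun A' C' D' => insertSum τ X (fun U => f U A' C' D') A) L := by
  simp only [splitSum₃, insertSum_splitSum]

theorem insertSum_add (τ : ℤ × ℤ → V → V) (X : List (Op V)) (F G : List V → M) (L : List V) :
    insertSum τ X (fun U => F U + G U) L = insertSum τ X F L + insertSum τ X G L := by
  induction X generalizing F G L with
  | nil => rfl
  | cons x X ih => simp only [insertSum_cons, ih, splitSum₃_add]

theorem insertSum_comm (τ : ℤ × ℤ → V → V) (τ' : ℤ × ℤ → W → W) (Y : List (Op V))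
    (X : List (Op W)) (F : List V → List W → M) (L : List V) (A : List W) :
    insertSum τ Y (fun C => insertSum τ' X (F C) A) L =
      insertSum τ' X (fun U => insertSum τ Y (fun C => F C U) L) A := by
  induction Y generalizing F L with
  | nil => rfl
  | cons y Y ih => simp only [insertSum_cons, ih, insertSum_splitSum₃]

/-- Naturality of `insertSum` in the elements. -/
theorem insertSum_map {τ : ℤ × ℤ → V → V} {τ' : ℤ × ℤ → W → W} {θ : V → W}
    (hθ : ∀ d v, θ (τ d v) = τ' d (θ v)) {X : List (Op V)} {X' : List (Op W)}
    (h : List.Forall₂ (fun x x' => x.1 = x'.1 ∧ ∀ L, θ (x.2 L) = x'.2 (L.map θ)) X X')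
    (F : List W → M) (L : List V) :
    insertSum τ' X' F (L.map θ) = insertSum τ X (fun U => F (U.map θ)) L := by
  induction h generalizing F L with
  | nil => rfl
  | @cons x x' X X' hx hX ih =>
    have hdeg : opsDeg X = opsDeg X' := by
      unfold opsDeg
      congr 1
      clear ih
      induction hX with
      | nil => rfl
      | cons hx _ ih => rw [List.map_cons, List.map_cons, hx.1, ih]
    have hcomm : ∀ d, θ ∘ τ d = τ' d ∘ θ := fun d => funext fun v => hθ d v
    simp only [insertSum_cons, splitSum₃_map, ih, List.map_append, List.map_cons, hx.2,
      List.map_map, hcomm, hdeg, hx.1]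

variable {τ : ℤ × ℤ → V → V}

theorem map_act_add (hτ : ∀ d e v, τ (d + e) v = τ d (τ e v)) (d e : ℤ × ℤ) (L : List V) :
    (L.map (τ e)).map (τ d) = L.map (τ (d + e)) := by
  rw [List.map_map]
  exact List.map_congr_left fun v _ => (hτ d e v).symm

theorem map_act_zero (hτ₀ : ∀ v, τ 0 v = v) (L : List V) : L.map (τ 0) = L := by
  conv_rhs => rw [← List.map_id L]
  exact List.map_congr_left fun v _ => hτ₀ v

/-- The block `C` of `z` separates the list. The operations `Z` act in front of it, on entries that
`z` and `Y` have to pass, and the operations `Y` act behind it. -/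
theorem insertSum_append_cons (hτ : ∀ d e v, τ (d + e) v = τ d (τ e v)) (Z : List (Op V))
    (z : Op V) (Y : List (Op V)) (F : List V → M) (L : List V) :
    insertSum τ (Z ++ z :: Y) F L = splitSum₃ (fun A C D => insertSum τ Z (fun U =>
      insertSum τ Y (fun T => F (U ++ z.2 (C.map (τ (opsDeg Y))) :: T)) D)
        (A.map (τ (z.1 + opsDeg Y)))) L := by
  induction Z generalizing F L with
  | nil => rfl
  | cons x Z ih =>
    simp only [List.cons_append, insertSum_cons, ih, splitSum₃_coassoc, splitSum₃_map,
      map_act_add hτ, List.append_assoc, opsDeg_append, opsDeg_cons, add_assoc]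

/-- Nothing passes the entries behind the last block, nor those of the block itself. This makes the
last operation, rather than the first, the convenient one to split off in inductions. -/
theorem insertSum_snoc (hτ₀ : ∀ v, τ 0 v = v) (hτ : ∀ d e v, τ (d + e) v = τ d (τ e v))
    (Z : List (Op V)) (z : Op V) (F : List V → M) (L : List V) :
    insertSum τ (Z ++ [z]) F L = splitSum₃ (fun A C D => insertSum τ Z (fun U =>
      F (U ++ z.2 C :: D)) (A.map (τ z.1))) L := by
  rw [insertSum_append_cons hτ]
  simp only [opsDeg_nil, map_act_zero hτ₀, add_zero]
  rfl

/-- Compatibility of insertions with decompositions. -/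
theorem insertSum_split (hτ₀ : ∀ v, τ 0 v = v) (hτ : ∀ d e v, τ (d + e) v = τ d (τ e v))
    (H : List V → List V → M) (Y : List (Op V)) (L : List V) :
    insertSum τ Y (splitSum H) L =
      splitSum (fun Y' Y'' => splitSum (fun A B => insertSum τ Y' (fun U =>
        insertSum τ Y'' (H U) B) (A.map (τ (opsDeg Y'')))) L) Y := by
  induction Y generalizing H L with
  | nil =>
    simp only [splitSum, opsDeg_nil, map_act_zero hτ₀]
    rfl
  | cons y Y ih =>
    rw [splitSum, insertSum_cons]
    -- The cut of the resulting list falls in front of the value of `y`, so that no operation lies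
    -- on its left, or behind it, where induction applies to the remaining operations.
    simp only [splitSum_append_cons]
    simp only [insertSum_add, splitSum₃_add]
    congr 1
    · have h₀ : ∀ f : List V → List V → List V → M, ∀ L, insertSum τ Y (fun U => splitSum (f U) L) =
          fun A => splitSum (fun A' B' => insertSum τ Y (fun U => f U A' B') A) L :=
        fun f L => funext fun A => insertSum_splitSum τ Y f L A
      simp only [splitSum_map, h₀]
      have h := splitSum_coassoc (fun A A' r : List V => splitSum (fun C D : List V => insertSum τ Y (fun U =>
        H (A.map (τ (y.1 + opsDeg Y))) (A'.map (τ (y.1 + opsDeg Y)) ++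
          y.2 (C.map (τ (opsDeg Y))) :: U)) D) r) L
      have h2 : ∀ A B : List V, splitSum (fun C D : List V => splitSum (fun A' A'' : List V => insertSum τ Y (fun U =>
          H (A'.map (τ (y.1 + opsDeg Y))) (A''.map (τ (y.1 + opsDeg Y)) ++
            y.2 (C.map (τ (opsDeg Y))) :: U)) D) A) B = splitSum (fun A' A'' : List V =>
            splitSum (fun C D : List V => insertSum τ Y (fun U =>
          H (A'.map (τ (y.1 + opsDeg Y))) (A''.map (τ (y.1 + opsDeg Y)) ++
            y.2 (C.map (τ (opsDeg Y))) :: U)) D) B) A := fun A B => splitSum_comm _ _ _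
      rw [splitSum₃]
      simp only [h2]
      rw [h]
      simp only [opsDeg_cons]
      rfl
    · have h1 : ∀ A C : List V, (insertSum τ Y (fun U => splitSum (fun U' U'' =>
          H (A.map (τ (y.1 + opsDeg Y)) ++ y.2 (C.map (τ (opsDeg Y))) :: U') U'') U)) =
          fun D => splitSum (fun Y' Y'' => splitSum (fun A' B => insertSum τ Y' (fun U =>
          insertSum τ Y'' (H (A.map (τ (y.1 + opsDeg Y)) ++ y.2 (C.map (τ (opsDeg Y))) :: U)) B)
            (A'.map (τ (opsDeg Y'')))) D) Y := fun A C => funext fun D => ih (fun U' U'' =>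
          H (A.map (τ (y.1 + opsDeg Y)) ++ y.2 (C.map (τ (opsDeg Y))) :: U') U'') D
      simp only [h1, splitSum₃_comm]
      refine splitSum_congr fun Y' Y'' hY => ?_
      have hdeg : opsDeg Y = opsDeg Y' + opsDeg Y'' := by rw [← hY, opsDeg_append]
      simp only [insertSum_cons, splitSum₃_map, map_act_add hτ, hdeg, add_assoc]
      refine Eq.trans ?_ (splitSum_coassoc (fun A r B : List V => splitSum (fun C A' : List V =>
        insertSum τ Y' (fun U => insertSum τ Y'' (H (A.map (τ (y.1 + (opsDeg Y' + opsDeg Y''))) ++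
          y.2 (C.map (τ (opsDeg Y' + opsDeg Y''))) :: U)) B) (A'.map (τ (opsDeg Y'')))) r) L).symm
      refine splitSum_congr fun A q _ => ?_
      exact (splitSum_coassoc _ _).symm

/-- Two successive cuts; entries of the first piece are passed by the operations of both later
pieces. -/
theorem insertSum_split₃ (hτ₀ : ∀ v, τ 0 v = v) (hτ : ∀ d e v, τ (d + e) v = τ d (τ e v))
    (H : List V → List V → List V → M) (Y : List (Op V)) (L : List V) :
    insertSum τ Y (splitSum₃ H) L =
      splitSum₃ (fun Y₁ Y₂ Y₃ => splitSum₃ (fun A C D => insertSum τ Y₁ (fun U =>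
        insertSum τ Y₂ (fun S => insertSum τ Y₃ (H U S) D) (C.map (τ (opsDeg Y₃))))
          (A.map (τ (opsDeg Y₂ + opsDeg Y₃)))) L) Y := by
  have h := insertSum_split hτ₀ hτ (fun A B => splitSum (H A) B) Y L
  rw [show splitSum₃ H = splitSum (fun A B => splitSum (H A) B) from rfl, h]
  refine splitSum_congr fun Y₁ Q _ => ?_
  have h2 : ∀ U B, insertSum τ Q (splitSum (H U)) B = _ := fun U B =>
    insertSum_split hτ₀ hτ (H U) Q B
  simp only [h2, insertSum_splitSum]
  have h3 : splitSum (fun A B => splitSum (fun Y₂ Y₃ => splitSum (fun C D =>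
      insertSum τ Y₁ (fun U => insertSum τ Y₂ (fun S => insertSum τ Y₃ (H U S) D)
        (C.map (τ (opsDeg Y₃)))) (A.map (τ (opsDeg Q)))) B) Q) L =
      splitSum (fun A B => splitSum (fun Y₂ Y₃ => splitSum (fun C D =>
      insertSum τ Y₁ (fun U => insertSum τ Y₂ (fun S => insertSum τ Y₃ (H U S) D)
        (C.map (τ (opsDeg Y₃)))) (A.map (τ (opsDeg Y₂ + opsDeg Y₃)))) B) Q) L :=
    splitSum_congr fun A B _ => splitSum_congr fun Y₂ Y₃ hY => by rw [← hY, opsDeg_append]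
  rw [h3, splitSum_comm]
  rfl

end InsertSum

/-! ### Composition of insertions -/

section Assoc

variable {V M : Type*} [AddCommGroup V] [AddCommGroup M] {τ : ℤ × ℤ → V → V}

/-- The operation `x` commutes with `τ` up to the Koszul sign. -/
def Op.Equivariant (τ : ℤ × ℤ → V → V) (x : Op V) : Prop :=
  ∀ d L, sgn (pairing d x.1) • x.2 (L.map (τ d)) = τ d (x.2 L)

/-- The Koszul sign for moving past an operation. -/
def Op.twist (d : ℤ × ℤ) (x : Op V) : Op V := (x.1, fun L => sgn (pairing d x.1) • x.2 L)

/-- The operation `x`, as an operation on lists of operations: it sends `y_1, …, y_n` to the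
operation `x{y_1, …, y_n}`. -/
def Op.lift (τ : ℤ × ℤ → V → V) (x : Op V) : Op (Op V) :=
  (x.1, fun Y => (x.1 + opsDeg Y, insertSum τ Y x.2))

theorem ListAdditive.insertSum {F : List V → List V → M} (hF : ∀ U, ListAdditive fun P => F P U)
    (Y : List (Op V)) (D : List V) : ListAdditive fun P => insertSum τ Y (F P) D := by
  intro L₁ L₂
  choose g hg using fun U => hF U L₁ L₂
  refine ⟨AddMonoidHom.mk' (fun w => DerivedDeligne.insertSum τ Y (fun U => g U w) D) fun a b => ?_,
    fun w => ?_⟩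
  · simp only [map_add, insertSum_add]
  · change DerivedDeligne.insertSum τ Y (F (L₁ ++ w :: L₂)) D = _
    rw [show F (L₁ ++ w :: L₂) = fun U => g U w from funext fun U => hg U w]
    rfl

/-- By equivariance, letting `τ d` act on the entries before the twisted operations are applied is
the same as letting it act on all entries of the resulting list. So something of bidegree `d` may be
moved past a whole insertion. -/
theorem insertSum_twist (hτ : ∀ d e v, τ (d + e) v = τ d (τ e v)) {X : List (Op V)}
    (hX : ∀ x ∈ X, x.Equivariant τ) (d : ℤ × ℤ) (F : List V → M) (L : List V) :
    insertSum τ (X.map (Op.twist d)) F (L.map (τ d)) =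
      insertSum τ X (fun U => F (U.map (τ d))) L := by
  refine insertSum_map (fun e v => ?_) ?_ F L
  · rw [← hτ, add_comm, hτ]
  · rw [List.forall₂_map_right_iff, List.forall₂_same]
    exact fun x hx => ⟨rfl, fun L => (hX x hx d L).symm⟩

theorem Op.Equivariant.twist {x : Op V} (hx : x.Equivariant τ) (d : ℤ × ℤ)
    (hneg : ∀ e (n : ℤ) v, τ e (n • v) = n • τ e v) : (x.twist d).Equivariant τ := by
  intro e L
  change sgn (pairing e x.1) • sgn (pairing d x.1) • x.2 (L.map (τ e)) =
    τ e (sgn (pairing d x.1) • x.2 L)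
  rw [hneg, ← hx, smul_comm]

/-- The brace relation, in terms of `insertSum`. -/
theorem insertSum_insertSum (hτ₀ : ∀ v, τ 0 v = v) (hτ : ∀ d e v, τ (d + e) v = τ d (τ e v))
    (hτz : ∀ e (n : ℤ) v, τ e (n • v) = n • τ e v) (X : List (Op V)) {Y : List (Op V)}
    (hY : ∀ y ∈ Y, y.Equivariant τ) {F : List V → M} (hF : ListAdditive F) (L : List V) :
    insertSum τ Y (insertSum τ X F) L =
      insertSum Op.twist (X.map (Op.lift τ)) (fun Z => insertSum τ Z F L) Y := by
  induction X using List.reverseRecOn generalizing Y F L with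
  | nil => rfl
  | append_singleton X x ih =>
    -- The last operation `x` of the list is split off. The three pieces in front of, inside and
    -- behind its block receive consecutive parts `Y₁`, `Y₂`, `Y₃` of `Y`, and `Y₂` becomes the
    -- argument list of the lifted operation of `x`.
    have h1 : insertSum τ (X ++ [x]) F = splitSum₃ (fun A C D => insertSum τ X (fun U =>
      F (U ++ x.2 C :: D)) (A.map (τ x.1))) := funext fun L => insertSum_snoc hτ₀ hτ X x F L
    have ht₀ : ∀ v : Op V, Op.twist 0 v = v := fun v => by
      simp [Op.twist, pairing_zero_left, sgn_zero]
    have ht : ∀ d e (v : Op V), Op.twist (d + e) v = Op.twist d (Op.twist e v) := fun d e v => by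
      simp [Op.twist, pairing_add_left, sgn_add, smul_smul]
    rw [h1, insertSum_split₃ hτ₀ hτ, List.map_append, List.map_singleton,
      insertSum_snoc ht₀ ht]
    refine splitSum₃_congr fun Y₁ Y₂ Y₃ hYs => ?_
    simp only [insertSum_append_cons hτ, insertSum_splitSum₃]
    refine splitSum₃_congr fun A C D _ => ?_
    have hY₁ : ∀ y ∈ Y₁.map (Op.twist x.1), y.Equivariant τ := by
      intro y hy
      obtain ⟨y', hy', rfl⟩ := List.mem_map.mp hy
      exact (hY y' (by rw [← hYs]; exact List.mem_append_left _ hy')).twist _ hτz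
    have hF' : ListAdditive fun P => insertSum τ Y₃ (fun T =>
        F (P ++ insertSum τ Y₂ x.2 (C.map (τ (opsDeg Y₃))) :: T)) D :=
      ListAdditive.insertSum (F := fun P T =>
        F (P ++ insertSum τ Y₂ x.2 (C.map (τ (opsDeg Y₃))) :: T)) (fun T => hF.append_right _) Y₃ D
    -- The operation `x` has to move past everything that `Y₁` produces from `A`. This is accounted
    -- for by twisting the operations in `Y₁` and acting on the entries of `A`, in accordance with
    -- `insertSum_twist`.
    have h2 := ih hY₁ hF' ((A.map (τ (opsDeg Y₂ + opsDeg Y₃))).map (τ x.1))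
    rw [insertSum_twist hτ (fun y hy => hY y (by rw [← hYs]; exact List.mem_append_left _ hy)),
      map_act_add hτ] at h2
    change _ = insertSum Op.twist (X.map (Op.lift τ)) (fun Z => insertSum τ Z _
      (A.map (τ (x.1 + opsDeg Y₂ + opsDeg Y₃)))) _
    rw [add_assoc]
    refine Eq.trans ?_ h2
    congr 1
    funext U
    simp only [insertSum_comm (τ' := τ) (X := X)]
    congr 1
    funext P
    -- The value of `x` on the outcome of `Y₂` enters through a single slot. Additivity in this slot
    -- pulls the sum over the insertions of `Y₂` out of `F`.
    have hg' : ListAdditive fun Q => insertSum τ Y₃ (fun T => F (P ++ (Q ++ T))) D :=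
      ListAdditive.insertSum (F := fun Q T => F (P ++ (Q ++ T)))
        (fun T => (hF.append_left P).append_right T) Y₃ D
    obtain ⟨k, hk⟩ := hg' [] []
    simp only [List.nil_append, List.singleton_append] at hk
    simp only [hk]
    rw [map_insertSum]

end Assoc

end DerivedDeligne

namespace DerivedDeligne

/-! ### Segments and woven lists -/

section Segments

variable {X Y : Type*}

theorem seg_self (y : ℕ → X) (a : ℕ) : seg y a a = [] := by simp [seg]

theorem seg_cons (y : ℕ → X) {a e : ℕ} (h : a < e) : seg y a e = y a :: seg y (a + 1) e := by
  rw [seg_split y le_rfl h, seg_self, List.nil_append]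

theorem seg_append (y : ℕ → X) {a b e : ℕ} (h₁ : a ≤ b) (h₂ : b ≤ e) :
    seg y a b ++ seg y b e = seg y a e := by
  unfold seg
  rw [← List.map_append]
  congr 1
  have h : e - a = (b - a) + (e - b) := by omega
  rw [h, ← List.range'_append_1, Nat.add_sub_cancel' h₁]

theorem seg_snoc (y : ℕ → X) {a e : ℕ} (h : a ≤ e) : seg y a (e + 1) = seg y a e ++ [y e] := by
  rw [← seg_append y h (Nat.le_succ e), seg_cons y (Nat.lt_succ_self e), seg_self]

theorem seg_map (h : X → Y) (y : ℕ → X) (a e : ℕ) :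
    (seg y a e).map h = seg (fun v => h (y v)) a e := by
  simp [seg]

theorem length_seg (y : ℕ → X) (a e : ℕ) : (seg y a e).length = e - a := by simp [seg]

theorem weaveUpTo_congr_index {i k i' k' : ℕ → ℕ} (z y : ℕ → X) {T : ℕ}
    (hi : ∀ t ≤ T + 1, i t = i' t) (hk : ∀ t ≤ T, k t = k' t) :
    weaveUpTo i k z y T = weaveUpTo i' k' z y T := by
  induction T with
  | zero => rw [weaveUpTo, weaveUpTo, hi 0 (by omega), hi 1 (by omega), hk 0 le_rfl]
  | succ T ih =>
    rw [weaveUpTo, weaveUpTo, ih (fun t ht => hi t (by omega)) (fun t ht => hk t (by omega)),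
      hi (T + 1) (by omega), hi (T + 2) (by omega), hk (T + 1) (by omega)]

theorem weaveUpTo_map (h : X → Y) (i k : ℕ → ℕ) (z y : ℕ → X) (T : ℕ) :
    (weaveUpTo i k z y T).map h = weaveUpTo i k (fun t => h (z t)) (fun v => h (y v)) T := by
  induction T with
  | zero => exact seg_map h y _ _
  | succ T ih => rw [weaveUpTo, weaveUpTo, List.map_append, List.map_cons, ih, seg_map]

variable {M : Type*} [AddCommMonoid M]

theorem splitSum_seg (f : List X → List X → M) (y : ℕ → X) (a l : ℕ) :
    splitSum f (seg y a (a + l)) =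
      ∑ r ∈ Finset.range (l + 1), f (seg y a (a + r)) (seg y (a + r) (a + l)) := by
  induction l generalizing f a with
  | zero => simp [seg_self, splitSum]
  | succ l ih =>
    rw [seg_cons y (by omega), splitSum, show a + (l + 1) = (a + 1) + l by omega, ih,
      Finset.sum_range_succ' _ (l + 1), add_comm (f [] _), add_zero, seg_self,
      seg_cons y (show a < a + 1 + l by omega)]
    refine congrArg₂ _ (Finset.sum_congr rfl fun r hr => ?_) rfl
    rw [seg_cons y (show a < a + (r + 1) by omega), show a + (r + 1) = a + 1 + r by omega]

theorem splitSum₃_seg (f : List X → List X → List X → M) (y : ℕ → X) (m : ℕ) :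
    splitSum₃ f (seg y 1 (m + 1)) =
      ∑ r ∈ Finset.range (m + 1), ∑ q ∈ Finset.range (m - r + 1),
        f (seg y 1 (r + 1)) (seg y (r + 1) (r + q + 1)) (seg y (r + q + 1) (m + 1)) := by
  rw [splitSum₃, add_comm m 1, splitSum_seg, add_comm 1 m]
  refine Finset.sum_congr rfl fun r hr => ?_
  have hr' := Finset.mem_range.mp hr
  obtain ⟨l, rfl⟩ : ∃ l, m = r + l := ⟨m - r, by omega⟩
  have h := splitSum_seg (f (seg y 1 (1 + r))) y (1 + r) l
  rw [show 1 + r + l = r + l + 1 by omega] at h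
  rw [h, show r + l - r + 1 = l + 1 by omega]
  refine Finset.sum_congr rfl fun q _ => ?_
  rw [add_comm 1 r, show r + 1 + q = r + q + 1 by omega]

end Segments

/-! ### Peeling off the last block of an insertion -/

section Peel

/-- The insertion with one more block, of length `c.2` and starting at `c.1`, at the end. -/
def InsertionData.snoc {j n : ℕ} (c : Fin (n + 2) × Fin (n + 1))
    (p : InsertionData j ((c.1 : ℕ) - 1)) : InsertionData (j + 1) n := fun t =>
  if h : (t : ℕ) < j then
    (⟨(p ⟨t, h⟩).1, by have := (p ⟨t, h⟩).1.2; have := c.1.2; omega⟩,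
      ⟨(p ⟨t, h⟩).2, by have := (p ⟨t, h⟩).2.2; have := c.1.2; omega⟩)
  else c

/-- The case `t = j + 1` is included: for `p`, an insertion into `c.1 - 1` entries, the convention
for the index after the last block gives `(c.1 - 1) + 1`, which is the start of the new block. The
hypothesis `hc` excludes the truncated subtraction. -/
theorem InsertionData.snoc_start {j n : ℕ} (c : Fin (n + 2) × Fin (n + 1))
    (p : InsertionData j ((c.1 : ℕ) - 1)) (hc : 1 ≤ (c.1 : ℕ)) {t : ℕ} (ht : t ≤ j + 1) :
    (p.snoc c).start t = p.start t := by
  rcases t with _ | t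
  · rw [start_zero, start_zero]
  · unfold InsertionData.start
    rw [if_neg (by omega), if_neg (by omega), dif_pos (show t + 1 - 1 < j + 1 by omega)]
    by_cases h : t < j
    · rw [dif_pos (show t + 1 - 1 < j from h)]
      simp [InsertionData.snoc, h]
    · rw [dif_neg (show ¬ t + 1 - 1 < j from h)]
      simp only [InsertionData.snoc, Nat.add_sub_cancel, dif_neg h]
      omega

theorem InsertionData.snoc_start_last {j n : ℕ} (c : Fin (n + 2) × Fin (n + 1))
    (p : InsertionData j ((c.1 : ℕ) - 1)) : (p.snoc c).start (j + 1) = c.1 := by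
  simp [InsertionData.start, InsertionData.snoc]

theorem InsertionData.snoc_len {j n : ℕ} (c : Fin (n + 2) × Fin (n + 1))
    (p : InsertionData j ((c.1 : ℕ) - 1)) {t : ℕ} (ht : t ≤ j) :
    (p.snoc c).len t = p.len t := by
  rcases t with _ | t
  · rw [len_zero, len_zero]
  · unfold InsertionData.len
    rw [if_neg (by omega), if_neg (by omega), dif_pos (show t + 1 - 1 < j + 1 by omega),
      dif_pos (show t + 1 - 1 < j by omega)]
    simp [InsertionData.snoc, show t < j by omega]

theorem InsertionData.snoc_len_last {j n : ℕ} (c : Fin (n + 2) × Fin (n + 1))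
    (p : InsertionData j ((c.1 : ℕ) - 1)) : (p.snoc c).len (j + 1) = c.2 := by
  simp [InsertionData.len, InsertionData.snoc]

theorem insertion_bounds {j n : ℕ} {p : InsertionData j n} (hp : p ∈ insertions j n) {t : ℕ}
    (ht : t ≤ j) : 1 ≤ p.start t ∧ p.start t + p.len t ≤ n + 1 := by
  have hmono := mem_insertions hp
  refine ⟨?_, ?_⟩
  · rcases t with _ | t
    · exact (start_zero p).ge
    · have := index_mono (i := p.start) (k := p.len) (T := t) (fun s hs => hmono s (by omega))
        (Nat.zero_le t)
      rwa [start_zero, len_zero] at this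
  · have := index_mono hmono ht
    rwa [start_last] at this

/-- The insertions are fibred over the position of the last block. The fibre over `c` consists of
the insertions of the other blocks into the `c.1 - 1` entries in front of it. -/
theorem sum_insertions_succ {M : Type*} [AddCommMonoid M] {j n : ℕ}
    (f : InsertionData (j + 1) n → M) :
    ∑ p ∈ insertions (j + 1) n, f p =
      ∑ c : Fin (n + 2) × Fin (n + 1) with 1 ≤ (c.1 : ℕ) ∧ (c.1 : ℕ) + c.2 ≤ n + 1,
        ∑ p ∈ insertions j ((c.1 : ℕ) - 1), f (p.snoc c) := by
  classical
  have hlast : ∀ p ∈ insertions (j + 1) n, p (Fin.last j) ∈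
      (Finset.univ.filter fun c : Fin (n + 2) × Fin (n + 1) =>
        1 ≤ (c.1 : ℕ) ∧ (c.1 : ℕ) + c.2 ≤ n + 1) := by
    intro p hp
    have h := insertion_bounds hp le_rfl
    have h1 : p.start (j + 1) = (p (Fin.last j)).1 := by
      simp [InsertionData.start, Fin.last]
    have h2 : p.len (j + 1) = (p (Fin.last j)).2 := by
      simp [InsertionData.len, Fin.last]
    rw [h1, h2] at h
    simpa using h
  rw [← Finset.sum_fiberwise_of_maps_to hlast]
  refine Finset.sum_congr rfl fun c hc => ?_
  have hc' : 1 ≤ (c.1 : ℕ) ∧ (c.1 : ℕ) + c.2 ≤ n + 1 := by simpa using hc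
  symm
  refine Finset.sum_bij (fun p _ => p.snoc c) ?_ ?_ ?_ (fun _ _ => rfl)
  · intro p hp
    have hmono := mem_insertions hp
    refine Finset.mem_filter.mpr ⟨?_, ?_⟩
    · refine Finset.mem_filter.mpr ⟨Finset.mem_univ _, fun t ht => ?_⟩
      rcases Nat.lt_or_ge j t with h | h
      · obtain rfl : t = j + 1 := by omega
        rw [InsertionData.snoc_start_last, InsertionData.snoc_len_last, start_last]
        exact hc'.2
      · rw [InsertionData.snoc_start c p hc'.1 ht, InsertionData.snoc_len c p h,
          InsertionData.snoc_start c p hc'.1 (by omega)]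
        exact hmono t h
    · simp [InsertionData.snoc]
  · intro p _ p' _ h
    funext t
    have := congrFun h ⟨t, by omega⟩
    simp only [InsertionData.snoc, t.2, dite_true, Prod.mk.injEq, Fin.mk.injEq] at this
    exact Prod.ext (Fin.ext this.1) (Fin.ext this.2)
  · intro p hp
    obtain ⟨hp, hpc⟩ := Finset.mem_filter.mp hp
    have hmono := mem_insertions hp
    have hlastst : p.start (j + 1) = c.1 := by
      rw [← hpc]; simp [InsertionData.start, Fin.last]
    have hbd : ∀ t : Fin j, ((p t.castSucc).1 : ℕ) + (p t.castSucc).2 ≤ c.1 ∧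
        1 ≤ ((p t.castSucc).1 : ℕ) := by
      intro t
      have h1 := index_mono (i := p.start) (k := p.len) (T := j) (fun s hs => hmono s (by omega))
        (t := t + 1) t.2
      have h3 := (insertion_bounds hp (show (t : ℕ) + 1 ≤ j + 1 by omega)).1
      have ht : (t : ℕ) < j + 1 := by omega
      have h4 : p.start (t + 1) = (p t.castSucc).1 := by
        simp [InsertionData.start, ht, Fin.castSucc, Fin.castAdd, Fin.castLE]
      have h5 : p.len (t + 1) = (p t.castSucc).2 := by
        simp [InsertionData.len, ht, Fin.castSucc, Fin.castAdd, Fin.castLE]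
      rw [hlastst, h4, h5] at h1
      rw [h4] at h3
      exact ⟨h1, h3⟩
    let p' : InsertionData j ((c.1 : ℕ) - 1) := fun t =>
      (⟨(p t.castSucc).1, by have := hbd t; omega⟩, ⟨(p t.castSucc).2, by have := hbd t; omega⟩)
    have hsnoc : p'.snoc c = p := by
      funext t
      by_cases h : (t : ℕ) < j
      · simp only [InsertionData.snoc, h, dite_true, p']
        rfl
      · simp only [InsertionData.snoc, h, dite_false]
        rw [← hpc]
        congr 1
        exact Fin.ext (by simp only [Fin.val_last]; omega)
    refine ⟨p', ?_, hsnoc⟩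
    refine Finset.mem_filter.mpr ⟨Finset.mem_univ _, fun t ht => ?_⟩
    have := hmono t (by omega)
    rw [← hsnoc, InsertionData.snoc_start c p' hc'.1 (by omega), InsertionData.snoc_len c p' ht,
      InsertionData.snoc_start c p' hc'.1 (by omega)] at this
    exact this

theorem sum_blocks {M : Type*} [AddCommMonoid M] (n : ℕ) (g : ℕ → ℕ → M) :
    ∑ c : Fin (n + 2) × Fin (n + 1) with 1 ≤ (c.1 : ℕ) ∧ (c.1 : ℕ) + c.2 ≤ n + 1, g c.1 c.2 =
      ∑ r ∈ Finset.range (n + 1), ∑ q ∈ Finset.range (n - r + 1), g (r + 1) q := by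
  rw [Finset.sum_sigma']
  refine Finset.sum_bij (fun c _ => ⟨(c.1 : ℕ) - 1, c.2⟩) ?_ ?_ ?_ ?_
  · intro c hc
    have hc' : 1 ≤ (c.1 : ℕ) ∧ (c.1 : ℕ) + c.2 ≤ n + 1 := by simpa using hc
    simp only [Finset.mem_sigma, Finset.mem_range]
    omega
  · intro c hc d hd h
    have hc' : 1 ≤ (c.1 : ℕ) ∧ (c.1 : ℕ) + c.2 ≤ n + 1 := by simpa using hc
    have hd' : 1 ≤ (d.1 : ℕ) ∧ (d.1 : ℕ) + d.2 ≤ n + 1 := by simpa using hd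
    have h1 := congrArg Sigma.fst h
    have h2 : (c.2 : ℕ) = d.2 := by simpa using (Sigma.mk.inj_iff.mp h).2
    exact Prod.ext (Fin.ext (by simp only at h1; omega)) (Fin.ext h2)
  · rintro ⟨r, q⟩ h
    simp only [Finset.mem_sigma, Finset.mem_range] at h
    refine ⟨(⟨r + 1, by omega⟩, ⟨q, by omega⟩), ?_, ?_⟩
    · simp only [Finset.mem_filter, Finset.mem_univ, true_and]
      omega
    · simp
  · intro c hc
    have hc' : 1 ≤ (c.1 : ℕ) ∧ (c.1 : ℕ) + c.2 ≤ n + 1 := by simpa using hc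
    simp only
    rw [Nat.sub_add_cancel hc'.1]

end Peel

/-! ### Sums over insertions are insertion sums -/

section InsertSumSeg

variable {V M : Type*} [AddCommMonoid M] {τ : ℤ × ℤ → V → V}

/-- The entry `y_v`, after the operations of bidegree `d t` which start behind it have moved past
it. -/
def passed (τ : ℤ × ℤ → V → V) {j n : ℕ} (p : InsertionData j n) (d : ℕ → ℤ × ℤ) (y : ℕ → V)
    (v : ℕ) : V :=
  τ (∑ t ∈ Finset.Icc 1 j with v < p.start t, d t) (y v)

/-- The bridge between the indexed sums of the definitions and the recursive `insertSum`. In the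
induction on the number of operations both sides peel off the last block. -/
theorem insertSum_seg (hτ₀ : ∀ v, τ 0 v = v) (hτ : ∀ d e v, τ (d + e) v = τ d (τ e v)) (n m : ℕ)
    (x : ℕ → Op V) (F : List V → M) (y : ℕ → V) :
    insertSum τ (seg x 1 (n + 1)) F (seg y 1 (m + 1)) =
      ∑ p ∈ insertions n m, F (weave p (fun t => (x t).2
        (block p (passed τ p (fun t => (x t).1) y) t)) (passed τ p (fun t => (x t).1) y)) := by
  induction n generalizing m F y with
  | zero =>
    have h : insertions 0 m = Finset.univ := by
      refine Finset.filter_true_of_mem ?_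
      intro p _ t ht
      obtain rfl : t = 0 := by omega
      rw [start_zero, len_zero, zero_add, start_last]
      omega
    rw [h, Finset.univ_unique, Finset.sum_singleton, seg_self, insertSum]
    congr 1
    change _ = seg _ (InsertionData.start _ 0 + InsertionData.len _ 0) (InsertionData.start _ 1)
    rw [start_zero, len_zero, start_last]
    refine seg_congr fun v _ _ => ?_
    rw [passed, Finset.Icc_eq_empty (by omega), Finset.filter_empty, Finset.sum_empty, hτ₀]
  | succ n ih =>
    rw [seg_snoc x (by omega), insertSum_snoc hτ₀ hτ, splitSum₃_seg, sum_insertions_succ]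
    have hsum := sum_blocks m fun i q => insertSum τ (seg x 1 (n + 1)) (fun U =>
      F (U ++ (x (n + 1)).2 (seg y i (i - 1 + q + 1)) :: seg y (i - 1 + q + 1) (m + 1)))
        ((seg y 1 i).map (τ (x (n + 1)).1))
    simp only [Nat.add_sub_cancel] at hsum
    rw [← hsum]
    refine Finset.sum_congr rfl fun c hc => ?_
    have hc' : 1 ≤ (c.1 : ℕ) ∧ (c.1 : ℕ) + c.2 ≤ m + 1 := by simpa using hc
    have h1 : (c.1 : ℕ) - 1 + 1 = c.1 := by omega
    have hih := ih ((c.1 : ℕ) - 1) (fun U => F (U ++ (x (n + 1)).2 (seg y c.1 (c.1 - 1 + c.2 + 1)) ::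
      seg y (c.1 - 1 + c.2 + 1) (m + 1))) (fun v => τ (x (n + 1)).1 (y v))
    rw [h1] at hih
    rw [seg_map, hih]
    refine Finset.sum_congr rfl fun p hp => ?_
    have hmono := mem_insertions hp
    set y₁ := passed τ p (fun t => (x t).1) (fun v => τ (x (n + 1)).1 (y v)) with hy₁
    set y₂ := passed τ (p.snoc c) (fun t => (x t).1) y with hy₂
    -- Entries in front of the last block are passed by the last operation in addition to those that
    -- already pass them under `p`; entries from its start on are passed by nothing.
    have hlow : ∀ v : ℕ, v < (c.1 : ℕ) → y₂ v = y₁ v := by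
      intro v hv
      rw [hy₁, hy₂, passed, passed, ← hτ]
      congr 1
      rw [Finset.sum_filter, Finset.sum_filter, Finset.sum_Icc_succ_top (by omega),
        InsertionData.snoc_start_last, if_pos hv]
      congr 1
      refine Finset.sum_congr rfl fun t ht => ?_
      rw [InsertionData.snoc_start c p hc'.1 (by have := (Finset.mem_Icc.mp ht).2; omega)]
    have hhigh : ∀ v, (c.1 : ℕ) ≤ v → y₂ v = y v := by
      intro v hv
      rw [hy₂, passed, Finset.filter_eq_empty_iff.mpr, Finset.sum_empty, hτ₀]
      intro t ht
      have ht' := (Finset.mem_Icc.mp ht).2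
      rcases Nat.lt_or_ge n t with h | h
      · obtain rfl : t = n + 1 := by omega
        rw [InsertionData.snoc_start_last]; omega
      · rw [InsertionData.snoc_start c p hc'.1 (by omega)]
        have := (insertion_bounds hp h).2
        omega
    congr 1
    change _ = weaveUpTo _ _ _ _ (n + 1)
    rw [weaveUpTo, InsertionData.snoc_start_last, InsertionData.snoc_len_last, start_last]
    have h2 : (c.1 : ℕ) - 1 + c.2 + 1 = c.1 + c.2 := by omega
    rw [h2]
    congr 1
    · rw [weaveUpTo_congr_index (i := (p.snoc c).start) (i' := p.start) (k := (p.snoc c).len)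
        (k' := p.len) _ _ (fun t ht => InsertionData.snoc_start c p hc'.1 ht)
        (fun t ht => InsertionData.snoc_len c p ht)]
      refine weaveUpTo_congr hmono (fun t ht1 ht2 => ?_) fun v hv => ?_
      · rw [block, block, InsertionData.snoc_start c p hc'.1 (by omega),
          InsertionData.snoc_len c p ht2]
        refine congrArg _ (seg_congr fun v _ hv => (hlow v ?_).symm)
        have := (insertion_bounds hp ht2).2
        omega
      · rw [start_last] at hv
        exact (hlow v (by omega)).symm
    · congr 1
      · rw [block, InsertionData.snoc_start_last, InsertionData.snoc_len_last]
        exact congrArg _ (seg_congr fun v hv _ => (hhigh v hv).symm)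
      · exact seg_congr fun v hv _ => (hhigh v (by omega)).symm

end InsertSumSeg

end DerivedDeligne

namespace DerivedDeligne

/-! ### The sign of the conjugation with the shift -/

section AfterSum

/-- The sum of the entries, each multiplied with the number of entries behind it. -/
def afterSum : List ℤ → ℤ
  | [] => 0
  | u :: L => L.length * u + afterSum L

theorem afterSum_append (A B : List ℤ) :
    afterSum (A ++ B) = afterSum A + B.length * A.sum + afterSum B := by
  induction A with
  | nil => simp [afterSum]
  | cons a A ih =>
    simp only [List.cons_append, afterSum, ih, List.length_append, List.sum_cons]
    push_cast; ring

variable {X : Type*} [AddCommGroup X]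

theorem sum_seg (β : ℕ → X) (a e : ℕ) : (seg β a e).sum = ∑ v ∈ Finset.Ico a e, β v := by
  unfold seg
  rw [Finset.sum_eq_multiset_sum]
  simp [Finset.Ico, LocallyFiniteOrder.finsetIco, Multiset.map_coe, Multiset.sum_coe]

theorem sum_weaveUpTo {i k : ℕ → ℕ} (δ β : ℕ → X) (T : ℕ)
    (hmono : ∀ t ≤ T, i t + k t ≤ i (t + 1)) :
    (weaveUpTo i k (fun t => δ t + ∑ v ∈ Finset.Ico (i t) (i t + k t), β v) β T).sum =
      ∑ t ∈ Finset.Icc 1 T, δ t + ∑ v ∈ Finset.Ico (i 0 + k 0) (i (T + 1)), β v := by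
  induction T with
  | zero => simp [weaveUpTo, sum_seg]
  | succ T ih =>
    have h1 := hmono (T + 1) le_rfl
    have h0 : i 0 + k 0 ≤ i (T + 1) := index_mono (fun t ht => hmono t (by omega)) (by omega)
    rw [weaveUpTo, List.sum_append, List.sum_cons, ih fun t ht => hmono t (by omega), sum_seg,
      Finset.sum_Icc_succ_top (by omega),
      ← Finset.sum_Ico_consecutive β h0 (show i (T + 1) ≤ i (T + 1 + 1) by omega),
      ← Finset.sum_Ico_consecutive β (show i (T + 1) ≤ i (T + 1) + k (T + 1) by omega) h1]
    abel

/-- How `afterSum` changes when blocks are replaced by single entries. -/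
theorem afterSum_weaveUpTo {i k : ℕ → ℕ} (u c : ℕ → ℤ) (T : ℕ)
    (hmono : ∀ t ≤ T, i t + k t ≤ i (t + 1)) :
    afterSum (seg u (i 0 + k 0) (i (T + 1))) =
      afterSum (weaveUpTo i k (fun t => c t + ∑ v ∈ Finset.Ico (i t) (i t + k t), u v) u T) +
      ∑ t ∈ Finset.Icc 1 T, (afterSum (seg u (i t) (i t + k t)) +
        ((k t : ℤ) - 1) * ∑ v ∈ Finset.Ico (i 0 + k 0) (i t), u v -
        c t * ((T : ℤ) - t + ∑ l ∈ Finset.Icc t T, ((i (l + 1) : ℤ) - i l - k l))) := by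
  induction T with
  | zero => simp [weaveUpTo]
  | succ T ih =>
    have hm : ∀ t ≤ T, i t + k t ≤ i (t + 1) := fun t ht => hmono t (by omega)
    have h1 := hmono (T + 1) le_rfl
    have h0 : i 0 + k 0 ≤ i (T + 1) := index_mono hm (by omega)
    rw [← seg_append u h0 (show i (T + 1) ≤ i (T + 1 + 1) by omega),
      ← seg_append u (show i (T + 1) ≤ i (T + 1) + k (T + 1) by omega) h1, weaveUpTo,
      afterSum_append, afterSum_append, afterSum_append, ih hm, sum_weaveUpTo _ _ _ hm, afterSum,
      Finset.sum_Icc_succ_top (by omega)]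
    -- When one more block is added, each earlier inserted entry gains `1 + gap` entries behind it:
    -- the new inserted entry and those following its block.
    have hs : ∑ t ∈ Finset.Icc 1 T, (afterSum (seg u (i t) (i t + k t)) +
        ((k t : ℤ) - 1) * ∑ v ∈ Finset.Ico (i 0 + k 0) (i t), u v -
        c t * (((T + 1 : ℕ) : ℤ) - t + ∑ l ∈ Finset.Icc t (T + 1),
          ((i (l + 1) : ℤ) - i l - k l))) =
        ∑ t ∈ Finset.Icc 1 T, (afterSum (seg u (i t) (i t + k t)) +
        ((k t : ℤ) - 1) * ∑ v ∈ Finset.Ico (i 0 + k 0) (i t), u v -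
        c t * ((T : ℤ) - t + ∑ l ∈ Finset.Icc t T, ((i (l + 1) : ℤ) - i l - k l))) -
        (1 + ((i (T + 1 + 1) : ℤ) - i (T + 1) - k (T + 1))) * ∑ t ∈ Finset.Icc 1 T, c t := by
      rw [Finset.mul_sum, ← Finset.sum_sub_distrib]
      refine Finset.sum_congr rfl fun t ht => ?_
      rw [Finset.sum_Icc_succ_top (by have := (Finset.mem_Icc.mp ht).2; omega)]
      push_cast; ring
    rw [hs, Finset.Icc_self, Finset.sum_singleton]
    simp only [List.length_append, List.length_cons, length_seg, sum_seg]
    rw [show i (T + 1) + k (T + 1) - i (T + 1) = k (T + 1) by omega]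
    rw [show T + 1 + 1 = T + 2 from rfl] at h1 ⊢
    push_cast [Nat.cast_sub h1]
    ring

end AfterSum

section Rescale

variable {V M : Type*} [AddCommGroup V] [AddCommGroup M]

theorem Rescaled.seg {y' y : ℕ → V} {e : ℕ → ℤ} {a b : ℕ}
    (h : ∀ v, a ≤ v → v < b → y' v = sgn (e v) • y v) :
    Rescaled (seg y' a b) (seg y a b) (seg e a b).sum := by
  obtain hab | hab := Nat.lt_or_ge b a
  · simp only [DerivedDeligne.seg, Nat.sub_eq_zero_of_le hab.le]
    exact Rescaled.nil
  induction b, hab using Nat.le_induction with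
  | base => simp only [seg_self]; exact Rescaled.nil
  | succ b hb ih =>
    rw [seg_snoc _ hb, seg_snoc _ hb, seg_snoc _ hb, List.sum_append, List.sum_singleton]
    refine (ih fun v h1 h2 => h v h1 (by omega)).append ?_
    rw [← add_zero (e b)]
    exact Rescaled.cons (h b hb (by omega)) Rescaled.nil

theorem Rescaled.weaveUpTo {i k : ℕ → ℕ} {z' z y' y : ℕ → V} {f e : ℕ → ℤ} {T : ℕ}
    (hmono : ∀ t ≤ T, i t + k t ≤ i (t + 1))
    (hz : ∀ t, 1 ≤ t → t ≤ T → z' t = sgn (f t) • z t)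
    (hy : ∀ v, i 0 + k 0 ≤ v → v < i (T + 1) → y' v = sgn (e v) • y v) :
    Rescaled (weaveUpTo i k z' y' T) (weaveUpTo i k z y T) (weaveUpTo i k f e T).sum := by
  induction T with
  | zero => exact Rescaled.seg hy
  | succ T ih =>
    have h1 := hmono (T + 1) le_rfl
    have h0 : i 0 + k 0 ≤ i (T + 1) := index_mono (fun t ht => hmono t (by omega)) (by omega)
    simp only [DerivedDeligne.weaveUpTo, List.sum_append, List.sum_cons]
    refine (ih (fun t ht => hmono t (by omega)) (fun t a b => hz t a (by omega))
      (fun v a b => hy v a (by omega))).append ?_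
    exact Rescaled.cons (hz (T + 1) (by omega) le_rfl)
      (Rescaled.seg fun v a b => hy v (by omega) b)

end Rescale

/-! ### Koszul actions -/

section Koszul

variable {R V M : Type*} [CommRing R] [AddCommGroup V] [Module R V] [AddCommGroup M]

/-- `V` is spanned by homogeneous elements, and on these `τ d` is the Koszul sign for moving past
something of bidegree `d`. -/
structure IsKoszulAction (𝒢 : ℤ × ℤ → Submodule R V) (τ : ℤ × ℤ → V →ₗ[R] V) : Prop where
  span : ⨆ e, 𝒢 e = ⊤
  apply : ∀ d e a, a ∈ 𝒢 e → τ d a = sgn (pairing d e) • a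

variable {𝒢 : ℤ × ℤ → Submodule R V} {τ : ℤ × ℤ → V →ₗ[R] V}

theorem IsKoszulAction.hom_ext (h : IsKoszulAction 𝒢 τ) {f g : V →+ M}
    (hfg : ∀ e, ∀ a ∈ 𝒢 e, f a = g a) : f = g := by
  ext a
  -- Homogeneous elements span `V`, so induction over the supremum suffices.
  have ha : a ∈ ⨆ e, 𝒢 e := by rw [h.span]; trivial
  induction ha using Submodule.iSup_induction' with
  | mem e a ha => exact hfg e a ha
  | zero => rw [map_zero, map_zero]
  | add a b _ _ iha ihb => rw [map_add, map_add, iha, ihb]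

theorem IsKoszulAction.zero_act (h : IsKoszulAction 𝒢 τ) (v : V) : τ 0 v = v := by
  refine DFunLike.congr_fun (h.hom_ext (f := (τ 0).toAddMonoidHom) (g := AddMonoidHom.id V)
    fun e a ha => ?_) v
  change τ 0 a = a
  rw [h.apply _ _ _ ha, pairing_zero_left, sgn_zero, one_smul]

theorem IsKoszulAction.add_act (h : IsKoszulAction 𝒢 τ) (d e : ℤ × ℤ) (v : V) :
    τ (d + e) v = τ d (τ e v) := by
  refine DFunLike.congr_fun (h.hom_ext (f := (τ (d + e)).toAddMonoidHom)
    (g := (τ d ∘ₗ τ e).toAddMonoidHom) fun b a ha => ?_) v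
  change τ (d + e) a = τ d (τ e a)
  rw [h.apply _ _ _ ha, h.apply _ _ _ ha, map_zsmul, h.apply _ _ _ ha, smul_smul,
    pairing_add_left, sgn_add, mul_comm]

/-- Entries are replaced by homogeneous ones from the left, one slot at a time; `K` is the part of
the list that is homogeneous already. -/
theorem IsKoszulAction.listAdditive_ext (h : IsKoszulAction 𝒢 τ) {F F' : List V → M}
    (hF : ListAdditive F) (hF' : ListAdditive F')
    (heq : ∀ L D, HomList 𝒢 L D → F L = F' L) (L : List V) : F L = F' L := by
  suffices ∀ K D, HomList 𝒢 K D → F (K ++ L) = F' (K ++ L) from this [] [] List.Forall₂.nil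
  induction L with
  | nil => intro K D hK; rw [List.append_nil]; exact heq K D hK
  | cons a L ih =>
    intro K D hK
    obtain ⟨g, hg⟩ := hF K L
    obtain ⟨g', hg'⟩ := hF' K L
    rw [hg, hg']
    refine DFunLike.congr_fun (h.hom_ext fun e b hb => ?_) a
    rw [← hg, ← hg']
    have := ih (K ++ [b]) (D ++ [e]) (List.rel_append hK (List.Forall₂.cons hb List.Forall₂.nil))
    simpa using this

theorem evalList_listAdditive (f : Cochains R V) : ListAdditive (evalList f) := fun L₁ L₂ => by
  obtain ⟨g, hg⟩ := (OneLin.single (R := R) (LinearMap.id (M := V)) L₁ L₂).exists_linear f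
  exact ⟨g.toAddMonoidHom, fun w => hg w⟩

/-- Each entry `a` of the list is replaced by `τ (0, n) a`, where `n` is the number of entries
behind it. -/
def shiftSigns (τ : ℤ × ℤ → V →ₗ[R] V) : List V → List V
  | [] => []
  | a :: L => τ (0, (L.length : ℤ)) a :: shiftSigns τ L

theorem length_shiftSigns (L : List V) : (shiftSigns τ L).length = L.length := by
  induction L with
  | nil => rfl
  | cons a L ih => rw [shiftSigns, List.length_cons, List.length_cons, ih]

theorem shiftSigns_append_cons (L₁ L₂ : List V) :
    ∃ L, ∀ w, shiftSigns τ (L₁ ++ w :: L₂) =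
      L ++ τ (0, (L₂.length : ℤ)) w :: shiftSigns τ L₂ := by
  induction L₁ with
  | nil => exact ⟨[], fun w => rfl⟩
  | cons a L₁ ih =>
    obtain ⟨L, hL⟩ := ih
    refine ⟨τ (0, ((L₁ ++ (0 : V) :: L₂).length : ℤ)) a :: L, fun w => ?_⟩
    rw [List.cons_append, shiftSigns, hL]
    simp

/-- The values of `f` with the signs that come from the conjugation with the shift. -/
def shiftEval (τ : ℤ × ℤ → V →ₗ[R] V) (f : Cochains R V) (L : List V) : V :=
  evalList f (shiftSigns τ L)

theorem shiftEval_listAdditive (f : Cochains R V) : ListAdditive (shiftEval τ f) :=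
  fun L₁ L₂ => by
  obtain ⟨L, hL⟩ := shiftSigns_append_cons (τ := τ) L₁ L₂
  obtain ⟨g, hg⟩ := evalList_listAdditive f L (shiftSigns τ L₂)
  exact ⟨g.comp (τ (0, (L₂.length : ℤ))).toAddMonoidHom, fun w => by
    rw [shiftEval, hL, hg]; rfl⟩

theorem IsKoszulAction.rescaled_shiftSigns (h : IsKoszulAction 𝒢 τ) {L : List V}
    {D : List (ℤ × ℤ)} (hL : HomList 𝒢 L D) :
    Rescaled (shiftSigns τ L) L (afterSum (D.map Prod.snd)) := by
  unfold HomList at hL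
  induction hL with
  | nil => exact Rescaled.nil
  | @cons a d L D ha hL ih =>
    refine Rescaled.cons ?_ ih
    rw [h.apply _ _ _ ha, List.length_map, hL.length_eq]
    simp [pairing]

theorem IsKoszulAction.shiftEval_eq (h : IsKoszulAction 𝒢 τ) (f : Cochains R V) {L : List V}
    {D : List (ℤ × ℤ)} (hL : HomList 𝒢 L D) :
    shiftEval τ f L = sgn (afterSum (D.map Prod.snd)) • evalList f L :=
  (evalList_listAdditive f).rescale (h.rescaled_shiftSigns hL)

/-- The sign that arises when all operations move past the entries in front of their blocks. -/
theorem IsKoszulAction.eval_weave_passed (h : IsKoszulAction 𝒢 τ) {F : List V → M}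
    (hF : ListAdditive F) {act : ℕ → List V → V} (hact : ∀ t, ListAdditive (act t)) {n m : ℕ}
    {p : InsertionData n m} (hp : p ∈ insertions n m) (d : ℕ → ℤ × ℤ) {y : ℕ → V}
    {γ : ℕ → ℤ × ℤ} (hy : ∀ v, 1 ≤ v → v ≤ m → y v ∈ 𝒢 (γ v)) :
    F (weave p (fun t => act t (block p (passed (fun d => τ d) p d y) t))
        (passed (fun d => τ d) p d y)) =
      sgn (∑ t ∈ Finset.Icc 1 n, ∑ v ∈ Finset.Ico 1 (p.start t), pairing (d t) (γ v)) •
        F (weave p (fun t => act t (block p y t)) y) := by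
  have hmono := mem_insertions hp
  set e : ℕ → ℤ := fun v => ∑ t ∈ Finset.Icc 1 n with v < p.start t, pairing (d t) (γ v) with he
  have hy' : ∀ v, 1 ≤ v → v ≤ m → passed (fun d => τ d) p d y v = sgn (e v) • y v := by
    intro v h1 h2
    rw [passed, h.apply _ _ _ (hy v h1 h2), pairing_sum_left]
  have hz : ∀ t, 1 ≤ t → t ≤ n → act t (block p (passed (fun d => τ d) p d y) t) =
      sgn (0 + ∑ v ∈ Finset.Ico (p.start t) (p.start t + p.len t), e v) • act t (block p y t) := by
    intro t h1 h2
    have hb := insertion_bounds hp h2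
    have := (hact t).rescale (Rescaled.seg (y' := passed (fun d => τ d) p d y) (y := y) (e := e)
      (a := p.start t) (b := p.start t + p.len t)
      fun v h3 h4 => hy' v (by omega) (by omega))
    rw [sum_seg] at this
    rw [zero_add]
    exact this
  have hw := hF.rescale (Rescaled.weaveUpTo hmono hz (e := e) fun v h1 h2 => hy' v
    (by rw [start_zero] at h1; omega) (by rw [start_last] at h2; omega))
  rw [sum_weaveUpTo (fun _ => (0 : ℤ)) e n hmono, Finset.sum_const_zero, zero_add, start_zero,
    len_zero, start_last] at hw
  -- Interchange of summation: counting for each entry the operations that pass it, or for each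
  -- operation the entries that it passes.
  have hs : ∑ v ∈ Finset.Ico (1 + 0) (m + 1), e v =
      ∑ t ∈ Finset.Icc 1 n, ∑ v ∈ Finset.Ico 1 (p.start t), pairing (d t) (γ v) := by
    refine Finset.sum_comm' fun v t => ?_
    simp only [Finset.mem_Ico, Finset.mem_filter, Finset.mem_Icc]
    refine ⟨fun H => ⟨⟨by omega, by omega⟩, by omega⟩, fun H => ⟨⟨by omega, ?_⟩, by omega⟩⟩
    have := (insertion_bounds hp H.2.2).2
    omega
  rw [hs] at hw
  exact hw

end Koszul

end DerivedDeligne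

namespace DerivedDeligne

/-! ### Shift signs of woven lists -/

section ShiftWeave

variable {R V : Type*} [CommRing R] [AddCommGroup V] [Module R V]
  {𝒢 : ℤ × ℤ → Submodule R V} {τ : ℤ × ℤ → V →ₗ[R] V}

/-- The one sign computation behind both the braces of `𝔰 End_A` and the relations of a derived
`J`-algebra. The shift sign of the full sequence and that of the woven list differ by local
contributions of the blocks (`afterSum_weaveUpTo`), to which `IsKoszulAction.eval_weave_passed` adds
the Koszul sign. -/
theorem IsKoszulAction.shiftEval_weave (h : IsKoszulAction 𝒢 τ) (f : Cochains R V)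
    {act : ℕ → List V → V} (hact : ∀ t, ListAdditive (act t)) {n m : ℕ} {p : InsertionData n m}
    (hp : p ∈ insertions n m) (d : ℕ → ℤ × ℤ) {y : ℕ → V} {γ : ℕ → ℤ × ℤ}
    (hy : ∀ v, 1 ≤ v → v ≤ m → y v ∈ 𝒢 (γ v))
    (hdeg : ∀ t, 1 ≤ t → t ≤ n → act t (block p y t) ∈
      𝒢 (d t + ∑ v ∈ Finset.Ico (p.start t) (p.start t + p.len t), γ v)) :
    sgn (afterSum (seg (fun v => (γ v).2) 1 (m + 1))) •
      shiftEval τ f (weave p (fun t => act t (block p (passed (fun d => τ d) p d y) t))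
        (passed (fun d => τ d) p d y)) =
      sgn (∑ t ∈ Finset.Icc 1 n, (∑ v ∈ Finset.Ico 1 (p.start t), pairing (d t) (γ v) +
        (afterSum (seg (fun v => (γ v).2) (p.start t) (p.start t + p.len t)) +
          ((p.len t : ℤ) - 1) * ∑ v ∈ Finset.Ico 1 (p.start t), (γ v).2 -
          (d t).2 * ((n : ℤ) - t + ∑ l ∈ Finset.Icc t n, p.gap l)))) •
        evalList f (weave p (fun t => act t (block p y t)) y) := by
  have hmono := mem_insertions hp
  have hw : HomList 𝒢 (weave p (fun t => act t (block p y t)) y)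
      (weaveUpTo p.start p.len
        (fun t => d t + ∑ v ∈ Finset.Ico (p.start t) (p.start t + p.len t), γ v) γ n) :=
    HomList.weaveUpTo hmono hdeg fun v h1 h2 => hy v
      (by rw [start_zero] at h1; omega) (by rw [start_last] at h2; omega)
  have hk := afterSum_weaveUpTo (i := p.start) (k := p.len) (fun v => (γ v).2)
    (fun t => (d t).2) n hmono
  rw [h.eval_weave_passed (shiftEval_listAdditive f) hact hp d hy, h.shiftEval_eq f hw,
    sgn_smul_smul, sgn_smul_smul, weaveUpTo_map]
  rw [start_zero, len_zero, start_last] at hk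
  simp only [Prod.snd_add, Prod.snd_sum]
  congr 1
  rw [Finset.sum_add_distrib]
  -- The shift sign of the woven list occurs twice, once from `shiftEval_eq` and once inside the
  -- shift sign of the whole sequence, and so drops out modulo 2.
  refine sgn_congr (afterSum (weaveUpTo p.start p.len (fun t => (d t).2 +
    ∑ v ∈ Finset.Ico (p.start t) (p.start t + p.len t), (γ v).2) (fun v => (γ v).2) n)) ?_
  rw [hk]
  simp only [add_zero, InsertionData.gap]
  ring

end ShiftWeave

/-! ### The braces of cochains after conjugation with the shift -/

section Twist

variable {R A : Type*} [CommRing R] [AddCommGroup A] [Module R A]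

theorem twist_of_mem (𝒜 : ℤ × ℤ → Submodule R A) [DirectSum.Decomposition 𝒜] (d e : ℤ × ℤ)
    {a : A} (ha : a ∈ 𝒜 e) : twist 𝒜 d a = sgn (pairing d e) • a := by
  simp only [twist, LinearMap.comp_apply, LinearEquiv.coe_coe,
    DirectSum.decomposeLinearEquiv_apply]
  rw [DirectSum.decompose_of_mem 𝒜 ha, ← DirectSum.lof_eq_of R, DirectSum.toModule_lof]
  rfl

theorem iSup_eq_top_of_decomposition (𝒜 : ℤ × ℤ → Submodule R A) [DirectSum.Decomposition 𝒜] :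
    ⨆ e, 𝒜 e = ⊤ :=
  (DirectSum.Decomposition.isInternal 𝒜).submodule_iSup_eq_top

theorem isKoszulAction_twist (𝒜 : ℤ × ℤ → Submodule R A) [DirectSum.Decomposition 𝒜] :
    IsKoszulAction 𝒜 (twist 𝒜) where
  span := iSup_eq_top_of_decomposition 𝒜
  apply d e _ ha := twist_of_mem 𝒜 d e ha

/-- The Koszul signs with respect to the grading which is shifted down by one. -/
noncomputable def shiftedTwist (𝒜 : ℤ × ℤ → Submodule R A) [DirectSum.Decomposition 𝒜]
    (d : ℤ × ℤ) : A →ₗ[R] A :=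
  sgn d.2 • twist 𝒜 d

theorem mem_of_mem_vshift {𝒜 : ℤ × ℤ → Submodule R A} {e : ℤ × ℤ} {a : A}
    (ha : a ∈ vshift 𝒜 (-1) e) : a ∈ 𝒜 (e + (0, 1)) := by
  have h : e + (0, 1) = (e.1, e.2 - -1) := Prod.ext (by simp) (by simp)
  rw [h]; exact ha

theorem mem_vshift_of_mem {𝒜 : ℤ × ℤ → Submodule R A} {e : ℤ × ℤ} {a : A}
    (ha : a ∈ 𝒜 (e + (0, 1))) : a ∈ vshift 𝒜 (-1) e := by
  have h : e + (0, 1) = (e.1, e.2 - -1) := Prod.ext (by simp) (by simp)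
  rw [h] at ha; exact ha

/-- Raising the vertical degree of the element by one changes the pairing with `d` by `d.2`, and the
factor `sgn d.2` of `shiftedTwist` compensates this. -/
theorem isKoszulAction_shiftedTwist (𝒜 : ℤ × ℤ → Submodule R A) [DirectSum.Decomposition 𝒜] :
    IsKoszulAction (vshift 𝒜 (-1)) (shiftedTwist 𝒜) where
  span := by
    rw [← top_le_iff, ← iSup_eq_top_of_decomposition 𝒜]
    refine iSup_le fun e => le_trans (le_of_eq ?_) (le_iSup (vshift 𝒜 (-1)) (e + (0, -1)))
    simp [vshift]
  apply d e a ha := by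
    rw [shiftedTwist, LinearMap.smul_apply, twist_of_mem 𝒜 d _ (mem_of_mem_vshift ha), smul_smul,
      ← sgn_add, pairing_add_right]
    congr 1
    refine sgn_congr d.2 ?_
    simp only [pairing]; ring

/-- In terms of the shifted grading, the bidegrees of a cochain do not depend on its arity. -/
theorem evalList_mem_vshift {𝒜 : ℤ × ℤ → Submodule R A} {x : Cochains R A} {d : ℤ × ℤ}
    (hx : x ∈ cochainGrading 𝒜 d) {L : List A} {D : List (ℤ × ℤ)}
    (hL : HomList (vshift 𝒜 (-1)) L D) : evalList x L ∈ vshift 𝒜 (-1) (d + D.sum) := by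
  have hL' : HomList 𝒜 L (D.map fun e => e + (0, 1)) := by
    unfold HomList
    rw [List.forall₂_map_right_iff]
    exact List.Forall₂.imp (fun a e ha => mem_of_mem_vshift ha) hL
  have hs : ∀ D : List (ℤ × ℤ), (D.map fun e => e + (0, 1)).sum = D.sum + (0, (D.length : ℤ)) := by
    intro D
    induction D with
    | nil => rfl
    | cons d D ih =>
      rw [List.map_cons, List.sum_cons, ih, List.sum_cons, List.length_cons]
      push_cast
      refine Prod.ext ?_ ?_ <;> simp <;> ring
  have := hL'.eval (hx _)
  rw [hs, hL.length_eq] at this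
  refine mem_vshift_of_mem ?_
  convert this using 2
  refine Prod.ext ?_ ?_ <;> simp <;> ring

/-- Telescoping: gaps and blocks in front of the `l`-th block exhaust the entries `1, …, i_l - 1`.
-/
theorem sum_gap_add_sum_len {j n : ℕ} (p : InsertionData j n) {l : ℕ} (hl : 1 ≤ l) :
    ∑ t ∈ Finset.range l, p.gap t + ∑ t ∈ Finset.Ico 1 l, (p.len t : ℤ) = (p.start l : ℤ) - 1 := by
  induction l, hl using Nat.le_induction with
  | base => simp [InsertionData.gap, start_zero, len_zero]
  | succ l hl ih =>
    rw [Finset.sum_range_succ, Finset.sum_Ico_succ_top hl, InsertionData.gap]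
    linarith

theorem sum_Icc_sum_Icc (n : ℕ) (c h : ℕ → ℤ) :
    ∑ l ∈ Finset.Icc 1 n, ∑ j ∈ Finset.Icc 1 l, c j * h l =
      ∑ t ∈ Finset.Icc 1 n, c t * ∑ l ∈ Finset.Icc t n, h l := by
  simp only [Finset.mul_sum]
  refine Finset.sum_comm' fun l t => ?_
  simp only [Finset.mem_Icc]
  omega

/-- The combination $k_j+q_j-1$ is the natural vertical degree $c_j$, and the first two sums of
$\eta$ merge to $q_t(i_t-1)$ by `sum_gap_add_sum_len`. This isolates the contribution of each
inserted cochain. -/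
theorem braceSign_eq {n K : ℕ} (p : InsertionData n K) (β : ℕ → ℤ × ℤ) :
    braceSign p β = ∑ t ∈ Finset.Icc 1 n, (((β t).2 + 1 - p.len t) * ((p.start t : ℤ) - 1) +
      (β t).2 * ((n : ℤ) - t + ∑ l ∈ Finset.Icc t n, p.gap l)) := by
  have h1 : ∀ j, (p.len j : ℤ) + ((β j).2 + 1 - p.len j) - 1 = (β j).2 := fun j => by ring
  simp only [braceSign, h1]
  rw [sum_Icc_sum_Icc n (fun t => (β t).2), ← Finset.sum_add_distrib, ← Finset.sum_add_distrib,
    ← Finset.sum_add_distrib]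
  refine Finset.sum_congr rfl fun t ht => ?_
  rw [← sum_gap_add_sum_len p (Finset.mem_Icc.mp ht).1, ← Finset.sum_mul, ← Finset.sum_mul]
  ring

/-- Compares the two Koszul signs for moving a cochain past the entries in front of it: with its
internal bidegree in arity `k` and degrees in `A`, or with its natural bidegree and degrees in the
shifted grading. -/
theorem sum_pairing_shift (b : ℤ × ℤ) (γ : ℕ → ℤ × ℤ) (k : ℤ) {i : ℕ} (hi : 1 ≤ i) :
    ∑ v ∈ Finset.Ico 1 i, pairing (b.1, b.2 + 1 - k) (γ v + (0, 1)) =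
      ∑ v ∈ Finset.Ico 1 i, pairing b (γ v) + (1 - k) * ∑ v ∈ Finset.Ico 1 i, (γ v).2 +
        ((i : ℤ) - 1) * (b.2 + 1 - k) := by
  have hc : ((i : ℤ) - 1) * (b.2 + 1 - k) = ∑ v ∈ Finset.Ico 1 i, (b.2 + 1 - k) := by
    rw [Finset.sum_const, Nat.card_Ico, nsmul_eq_mul, Nat.cast_sub hi, Nat.cast_one]
  rw [hc, Finset.mul_sum, ← Finset.sum_add_distrib, ← Finset.sum_add_distrib]
  refine Finset.sum_congr rfl fun v _ => ?_
  simp only [pairing, Prod.fst_add, Prod.snd_add]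
  ring

/-- With the signs from the conjugation with the shift, the brace on `𝔰 End_A` is the sum over all
insertions with mere Koszul signs. -/
theorem braceValue_eq_insertSum (𝒜 : ℤ × ℤ → Submodule R A) [DirectSum.Decomposition 𝒜]
    (n K : ℕ) (β : ℕ → ℤ × ℤ) (x₀ : Cochains R A) (x : ℕ → Cochains R A)
    (hx : ∀ t, x t ∈ cochainGrading 𝒜 (β t)) (a : ℕ → A) (γ : ℕ → ℤ × ℤ)
    (ha : ∀ v, 1 ≤ v → v ≤ K → a v ∈ vshift 𝒜 (-1) (γ v)) :
    sgn (afterSum (seg (fun v => (γ v).2) 1 (K + 1))) • braceValue 𝒜 n β x₀ x K a =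
      insertSum (fun d => shiftedTwist 𝒜 d)
        (seg (fun t => (β t, shiftEval (shiftedTwist 𝒜) (x t))) 1 (n + 1))
        (shiftEval (shiftedTwist 𝒜) x₀) (seg a 1 (K + 1)) := by
  have hK := isKoszulAction_shiftedTwist 𝒜
  rw [insertSum_seg hK.zero_act hK.add_act, braceValue, Finset.smul_sum]
  refine Finset.sum_congr rfl fun p hp => ?_
  have hmono := mem_insertions hp
  have hblock : ∀ t, 1 ≤ t → t ≤ n → HomList (vshift 𝒜 (-1)) (block p a t)
      (seg γ (p.start t) (p.start t + p.len t)) := fun t h1 h2 => by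
    have := insertion_bounds hp h2
    exact HomList.seg fun v h3 h4 => ha v (by omega) (by omega)
  have hz : ∀ t, 1 ≤ t → t ≤ n → shiftEval (shiftedTwist 𝒜) (x t) (block p a t) =
      sgn (afterSum (seg (fun v => (γ v).2) (p.start t) (p.start t + p.len t))) •
        evalList (x t) (block p a t) := fun t h1 h2 => by
    rw [hK.shiftEval_eq (x t) (hblock t h1 h2), seg_map]
  have hdeg : ∀ t, 1 ≤ t → t ≤ n → shiftEval (shiftedTwist 𝒜) (x t) (block p a t) ∈
      vshift 𝒜 (-1) (β t + ∑ v ∈ Finset.Ico (p.start t) (p.start t + p.len t), γ v) :=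
    fun t h1 h2 => by
    rw [hz t h1 h2, ← sum_seg]
    exact (vshift 𝒜 (-1) _).toAddSubgroup.zsmul_mem
      (evalList_mem_vshift (hx t) (hblock t h1 h2)) _
  -- Multiplication with the shift sign of the arguments clears it on the left and creates on the
  -- right the left-hand side of `shiftEval_weave`.
  refine sgn_smul_injective (afterSum (seg (fun v => (γ v).2) 1 (K + 1))) ?_
  rw [sgn_smul_self]
  have h1 := hK.shiftEval_weave x₀ (act := fun t => shiftEval (shiftedTwist 𝒜) (x t))
    (fun t => shiftEval_listAdditive (x t)) hp β ha hdeg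
  rw [h1]
  have h2 := (evalList_listAdditive x₀).rescale (Rescaled.weaveUpTo (e := fun _ => 0) hmono hz
    (y' := a) (y := a) fun v _ _ => by rw [sgn_zero, one_smul])
  have h3 : (weaveUpTo p.start p.len (fun t => afterSum (seg (fun v => (γ v).2) (p.start t)
      (p.start t + p.len t))) (fun _ => 0) n).sum = ∑ t ∈ Finset.Icc 1 n,
        afterSum (seg (fun v => (γ v).2) (p.start t) (p.start t + p.len t)) := by
    have := sum_weaveUpTo (i := p.start) (k := p.len) (fun t => afterSum (seg (fun v => (γ v).2)
      (p.start t) (p.start t + p.len t))) (fun _ => (0 : ℤ)) n hmono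
    simpa using this
  rw [h3] at h2
  have h4 := (isKoszulAction_twist 𝒜).eval_weave_passed (evalList_listAdditive x₀)
    (act := fun t => evalList (x t)) (fun t => evalList_listAdditive (x t)) hp
    (fun t => ((β t).1, (β t).2 + 1 - (p.len t : ℤ))) (y := a) (γ := fun v => γ v + (0, 1))
    fun v h5 h6 => mem_of_mem_vshift (ha v h5 h6)
  -- The entries `koszulEntries` are by definition `passed` entries, for the unshifted action and
  -- the internal bidegrees.
  change sgn (braceSign p β) • evalList x₀ (weave p (fun t => evalList (x t) (block p (passed
    (fun d => twist 𝒜 d) p (fun t => ((β t).1, (β t).2 + 1 - (p.len t : ℤ))) a) t)) (passed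
    (fun d => twist 𝒜 d) p (fun t => ((β t).1, (β t).2 + 1 - (p.len t : ℤ))) a)) =
    _ • evalList x₀ (weaveUpTo _ _ _ _ _)
  rw [h4, h2, sgn_smul_smul, sgn_smul_smul]
  change _ = _ • evalList x₀ (weave _ _ _)
  congr 1
  -- The witness collects, for each block, the terms that occur on both sides with equal or opposite
  -- coefficients; after `braceSign_eq` and `sum_pairing_shift` the identity holds block by block.
  refine sgn_congr (∑ t ∈ Finset.Icc 1 n, (((β t).2 + 1 - p.len t) * ((p.start t : ℤ) - 1) +
    (β t).2 * ((n : ℤ) - t + ∑ l ∈ Finset.Icc t n, p.gap l) +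
    (1 - (p.len t : ℤ)) * ∑ v ∈ Finset.Ico 1 (p.start t), (γ v).2 -
    afterSum (seg (fun v => (γ v).2) (p.start t) (p.start t + p.len t)))) ?_
  rw [braceSign_eq, ← Finset.sum_add_distrib, ← Finset.sum_add_distrib, Finset.mul_sum,
    ← Finset.sum_add_distrib]
  refine Finset.sum_congr rfl fun t ht => ?_
  have hst := (insertion_bounds hp (Finset.mem_Icc.mp ht).2).1
  rw [sum_pairing_shift _ _ _ hst]
  ring

end Twist

end DerivedDeligne

namespace DerivedDeligne

/-! ### Additivity of insertion sums -/

section Additivity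

variable {V M : Type*} [AddCommGroup V] [AddCommGroup M]

theorem ListAdditive.splitSum {W : Type*} {F : List V → List W → List W → M}
    (hF : ∀ A B, ListAdditive fun P => F P A B) (L : List W) :
    ListAdditive fun P => splitSum (F P) L := by
  intro L₁ L₂
  choose g hg using fun A B => hF A B L₁ L₂
  refine ⟨AddMonoidHom.mk' (fun w => DerivedDeligne.splitSum (fun A B => g A B w) L)
    fun a b => ?_, fun w => ?_⟩
  · simp only [map_add, splitSum_add]
  · exact splitSum_congr fun A B _ => hg A B w

/-- For each cut a given entry lies in exactly one of the two pieces, and the function is additive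
in both. -/
theorem listAdditive_splitSum {F : List V → List V → M} (h₁ : ∀ B, ListAdditive fun A => F A B)
    (h₂ : ∀ A, ListAdditive (F A)) : ListAdditive (splitSum F) := by
  intro L₁ L₂
  choose g hg using fun A B => h₂ A B L₂
  choose k hk using fun U B => h₁ B L₁ U
  refine ⟨AddMonoidHom.mk' (fun w => splitSum (fun A B => g A B w) L₁ +
    splitSum (fun U B => k U B w) L₂) fun a b => ?_, fun w => ?_⟩
  · simp only [map_add, splitSum_add]; abel
  · rw [splitSum_append_cons]
    exact congrArg₂ _ (splitSum_congr fun A B _ => hg A B w) (splitSum_congr fun U B _ => hk U B w)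

theorem listAdditive_splitSum₃ {F : List V → List V → List V → M}
    (h₁ : ∀ C D, ListAdditive fun A => F A C D) (h₂ : ∀ A D, ListAdditive fun C => F A C D)
    (h₃ : ∀ A C, ListAdditive (F A C)) : ListAdditive (splitSum₃ F) :=
  listAdditive_splitSum (fun B => ListAdditive.splitSum (fun C D => h₁ C D) B)
    fun A => listAdditive_splitSum (fun D => h₂ A D) (fun C => h₃ A C)

theorem ListAdditive.comp_map {F : List V → M} (hF : ListAdditive F) (g : V →+ V) :
    ListAdditive fun L => F (L.map g) := fun L₁ L₂ => by
  obtain ⟨k, hk⟩ := hF (L₁.map g) (L₂.map g)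
  exact ⟨k.comp g, fun w => by simp only [List.map_append, List.map_cons, hk]; rfl⟩

theorem ListAdditive.comp_entry {F : List V → M} (hF : ListAdditive F) {f : List V → V}
    (hf : ListAdditive f) (A B : List V) : ListAdditive fun L => F (A ++ f L :: B) := by
  obtain ⟨k, hk⟩ := hF A B
  simp only [hk]
  exact hf.comp k

theorem listAdditive_insertSum (τ : ℤ × ℤ → V →+ V) {X : List (Op V)}
    (hX : ∀ x ∈ X, ListAdditive x.2) {F : List V → M} (hF : ListAdditive F) :
    ListAdditive (insertSum (fun d => τ d) X F) := by
  induction X generalizing F with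
  | nil => exact hF
  | cons x X ih =>
    refine listAdditive_splitSum₃ (fun C D => ?_) (fun A D => ?_) fun A C => ?_
    · exact ListAdditive.insertSum (F := fun A U => F (A.map (τ (x.1 + opsDeg X)) ++
        x.2 (C.map (τ (opsDeg X))) :: U)) (fun U => (hF.append_right _).comp_map _) X D
    · exact ListAdditive.insertSum (F := fun C U => F (A.map (τ (x.1 + opsDeg X)) ++
        x.2 (C.map (τ (opsDeg X))) :: U)) (fun U => hF.comp_entry
          ((hX x List.mem_cons_self).comp_map _) _ _) X D
    · refine ih (fun y hy => hX y (List.mem_cons_of_mem _ hy)) ?_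
      have := hF.append_left (A.map (τ (x.1 + opsDeg X)) ++ [x.2 (C.map (τ (opsDeg X)))])
      simpa using this

end Additivity

/-! ### The braces on `𝔰 End_A` -/

section Braces

variable {R V : Type*} [CommRing R] [AddCommGroup V] [Module R V]

theorem braceEval_eq_evalList (b : ∀ n : ℕ, MultilinearMap R (fun _ : Fin (n + 1) => V) V) (x : V)
    (L : List V) : braceEval b x L = evalList (fun n => (b n).curryLeft x) L := rfl

theorem braceEval_listAdditive (b : ∀ n : ℕ, MultilinearMap R (fun _ : Fin (n + 1) => V) V)
    (x : V) : ListAdditive (braceEval b x) :=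
  evalList_listAdditive fun n => (b n).curryLeft x

/-- The brace `b_n(x; x_1, …, x_n)`, as an additive function of `x`. -/
def braceHom (b : ∀ n : ℕ, MultilinearMap R (fun _ : Fin (n + 1) => V) V) (L : List V) : V →+ V where
  toFun x := braceEval b x L
  map_zero' := by
    rw [braceEval_eq_evalList]; simp only [map_zero]; rfl
  map_add' x y := by
    simp only [braceEval_eq_evalList, map_add]; rfl

theorem braceHom_apply (b : ∀ n : ℕ, MultilinearMap R (fun _ : Fin (n + 1) => V) V) (L : List V)
    (x : V) : braceHom b L x = braceEval b x L := rfl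

theorem evalList_seg (f : Cochains R V) (y : ℕ → V) (n : ℕ) :
    evalList f (seg y 1 (n + 1)) = f n fun s => y (s + 1) := by
  rw [evalList_congr f _ n (by rw [length_seg]; rfl)]
  congr 1
  funext s
  simp only [seg, List.get_eq_getElem, List.getElem_map, List.getElem_range']
  exact congrArg y (show 1 + 1 * (s : ℕ) = s + 1 by omega)

theorem braceEval_seg (b : ∀ n : ℕ, MultilinearMap R (fun _ : Fin (n + 1) => V) V) (x : V)
    (y : ℕ → V) (n : ℕ) :
    braceEval b x (seg y 1 (n + 1)) = b n (Fin.cons x fun s : Fin n => y (s + 1)) := by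
  rw [braceEval_eq_evalList, evalList_seg]
  rfl

theorem exists_eq_seg {X : Type*} (x₀ : X) (L : List X) :
    ∃ y : ℕ → X, L = seg y 1 (L.length + 1) := by
  refine ⟨fun v => L.getD (v - 1) x₀, ?_⟩
  refine List.ext_getElem (by rw [length_seg]; rfl) fun n h₁ h₂ => ?_
  simp [seg, h₁]

theorem tuple_eq {X : Type*} [Zero X] (y : ℕ → X) {K v : ℕ} (h₁ : 1 ≤ v) (h₂ : v ≤ K) :
    tuple (fun s : Fin K => y (s + 1)) v = y v := by
  simp only [tuple, h₁, h₂, and_self, dite_true]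
  congr 1
  omega

end Braces

/-! ### Cochains as operations on lists of elements of `A` -/

section SuspEnd

variable {R A : Type*} [CommRing R] [AddCommGroup A] [Module R A] (𝒜 : ℤ × ℤ → Submodule R A)

/-- The sum of the homogeneous components of an element of `𝔰 End_A`. -/
noncomputable def totalCochain : SuspEnd 𝒜 →ₗ[R] Cochains R A :=
  DirectSum.toModule R (ℤ × ℤ) _ fun d => (cochainGrading 𝒜 d).subtype

theorem totalCochain_lof (d : ℤ × ℤ) (f : cochainGrading 𝒜 d) :
    totalCochain 𝒜 (SuspEnd.lof 𝒜 d f) = f :=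
  DirectSum.toModule_lof R (M := fun d => cochainGrading 𝒜 d) (φ := fun d =>
    (cochainGrading 𝒜 d).subtype) d f

variable {𝒜} in
theorem totalCochain_mem {d : ℤ × ℤ} {x : SuspEnd 𝒜} (hx : x ∈ suspEndGrading 𝒜 d) :
    totalCochain 𝒜 x ∈ cochainGrading 𝒜 d := by
  obtain ⟨f, rfl⟩ := hx
  rw [totalCochain_lof]
  exact f.2

variable [DirectSum.Decomposition 𝒜]

/-- Multilinearity reduces the comparison to homogeneous arguments, and every tuple is the list of
its entries. -/
theorem cochain_ext {f g : Cochains R A}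
    (h : ∀ L D, HomList (vshift 𝒜 (-1)) L D → evalList f L = evalList g L) : f = g := by
  have h1 := (isKoszulAction_shiftedTwist 𝒜).listAdditive_ext (evalList_listAdditive f)
    (evalList_listAdditive g) h
  funext n
  ext a
  have h2 := h1 (List.ofFn a)
  rw [evalList_congr f _ n (List.length_ofFn), evalList_congr g _ n (List.length_ofFn)] at h2
  simpa using h2

/-- The components of an element can be recovered from their sum. On homogeneous arguments of fixed
arity, components of distinct natural bidegree take values in distinct bidegrees of `A`, so
projecting the value to the appropriate bidegree isolates one component. -/
theorem totalCochain_injective : Function.Injective (totalCochain 𝒜) := by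
  classical
  have key : ∀ (L : List A) (D : List (ℤ × ℤ)), HomList 𝒜 L D → ∀ (d : ℤ × ℤ) (w : SuspEnd 𝒜),
      ((DirectSum.decompose 𝒜 (evalList (totalCochain 𝒜 w) L)
        ((d.1, d.2 + 1 - (L.length : ℤ)) + D.sum) : 𝒜 _) : A) =
      evalList (DirectSum.component R (ℤ × ℤ) (fun d => cochainGrading 𝒜 d) d w : Cochains R A)
        L := by
    intro L D hL d w
    let F₁ : SuspEnd 𝒜 →ₗ[R] A := (𝒜 _).subtype ∘ₗ
      DirectSum.component R (ℤ × ℤ) (fun e => 𝒜 e) ((d.1, d.2 + 1 - (L.length : ℤ)) + D.sum) ∘ₗ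
      (DirectSum.decomposeLinearEquiv 𝒜).toLinearMap ∘ₗ
      ({ toFun := fun f => evalList f L, map_add' := fun _ _ => rfl, map_smul' := fun _ _ => rfl } :
        Cochains R A →ₗ[R] A) ∘ₗ totalCochain 𝒜
    let F₂ : SuspEnd 𝒜 →ₗ[R] A :=
      ({ toFun := fun f => evalList f L, map_add' := fun _ _ => rfl, map_smul' := fun _ _ => rfl } :
        Cochains R A →ₗ[R] A) ∘ₗ (cochainGrading 𝒜 d).subtype ∘ₗ
        DirectSum.component R (ℤ × ℤ) (fun d => cochainGrading 𝒜 d) d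
    suffices F₁ = F₂ from DFunLike.congr_fun this w
    refine SuspEnd.hom_ext fun e f => ?_
    change ((DirectSum.decompose 𝒜 (evalList (totalCochain 𝒜 (SuspEnd.lof 𝒜 e f)) L)
        ((d.1, d.2 + 1 - (L.length : ℤ)) + D.sum) : 𝒜 _) : A) =
      evalList (DirectSum.component R (ℤ × ℤ) (fun d => cochainGrading 𝒜 d) d
        (DirectSum.lof R (ℤ × ℤ) (fun d => cochainGrading 𝒜 d) e f) : Cochains R A) L
    rw [totalCochain_lof]
    have hmem := hL.eval (f.2 L.length)
    by_cases hde : e = d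
    · subst hde
      rw [DirectSum.component.lof_self, DirectSum.decompose_of_mem_same 𝒜 hmem]
    · rw [DirectSum.component.of, dif_neg hde, DirectSum.decompose_of_mem_ne 𝒜 hmem]
      · rfl
      · intro h
        apply hde
        have h' := add_right_cancel h
        rw [Prod.mk.injEq] at h'
        exact Prod.ext h'.1 (by linarith [h'.2])
  intro w w' h
  refine DFinsupp.ext fun d => Subtype.ext (cochain_ext 𝒜 fun L D hL => ?_)
  have hL' : HomList 𝒜 L (D.map fun e => e + (0, 1)) := by
    unfold HomList
    rw [List.forall₂_map_right_iff]
    exact List.Forall₂.imp (fun a e ha => mem_of_mem_vshift ha) hL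
  have h1 := key L _ hL' d w
  rw [h, key L _ hL' d w'] at h1
  exact h1.symm

/-- The function on lists given by an element of `𝔰 End_A`, with the signs from the conjugation with
the shift. -/
noncomputable def opEval (x : SuspEnd 𝒜) : List A → A :=
  shiftEval (shiftedTwist 𝒜) (totalCochain 𝒜 x)

/-- `opEval`, as an additive function of the cochain. -/
noncomputable def opEvalHom (L : List A) : SuspEnd 𝒜 →+ A where
  toFun x := opEval 𝒜 x L
  map_zero' := by simp only [opEval, map_zero]; rfl
  map_add' x y := by simp only [opEval, map_add]; rfl

theorem opEval_listAdditive (x : SuspEnd 𝒜) : ListAdditive (opEval 𝒜 x) :=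
  shiftEval_listAdditive _

/-- On homogeneous lists `opEval` differs from plain evaluation by an invertible sign. Hence
identities in `𝔰 End_A` may be checked after evaluation on lists. -/
theorem opEval_injective : Function.Injective (opEval 𝒜) := by
  intro x y h
  refine totalCochain_injective 𝒜 (cochain_ext 𝒜 fun L D hL => ?_)
  have h1 := congrFun h L
  unfold opEval at h1
  rw [(isKoszulAction_shiftedTwist 𝒜).shiftEval_eq _ hL,
    (isKoszulAction_shiftedTwist 𝒜).shiftEval_eq _ hL] at h1
  exact sgn_smul_injective _ h1

theorem suspEndBrace_lof {n : ℕ} (β : Fin (n + 1) → ℤ × ℤ) (x : ∀ t, cochainGrading 𝒜 (β t)) :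
    suspEndBrace 𝒜 n (fun t => SuspEnd.lof 𝒜 (β t) (x t)) = SuspEnd.lof 𝒜 (∑ t, β t)
      ⟨braceCochain 𝒜 β fun t => x t, braceCochain_mem 𝒜 β _ fun t => (x t).2⟩ :=
  MultilinearMap.fromDFinsuppEquiv_single (R := R) (κ := fun _ : Fin (n + 1) => ℤ × ℤ)
    (M := fun _ d => cochainGrading 𝒜 d) (N := SuspEnd 𝒜) _ β x

theorem suspEndBrace_homogeneous (n : ℕ) :
    IsHomogeneousMap (suspEndGrading 𝒜) (suspEndBrace 𝒜 n) (0, 0) := by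
  intro β x hx
  choose f hf using hx
  obtain rfl : x = fun t => SuspEnd.lof 𝒜 (β t) (f t) := funext fun t => (hf t).symm
  rw [suspEndBrace_lof, Prod.mk_zero_zero, zero_add]
  exact ⟨_, rfl⟩

theorem totalCochain_suspEndBrace {n : ℕ} (β : Fin (n + 1) → ℤ × ℤ) (x : Fin (n + 1) → SuspEnd 𝒜)
    (hx : ∀ t, x t ∈ suspEndGrading 𝒜 (β t)) :
    totalCochain 𝒜 (suspEndBrace 𝒜 n x) = braceCochain 𝒜 β fun t => totalCochain 𝒜 (x t) := by
  choose f hf using hx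
  obtain rfl : x = fun t => SuspEnd.lof 𝒜 (β t) (f t) := funext fun t => (hf t).symm
  rw [suspEndBrace_lof, totalCochain_lof]
  simp only [totalCochain_lof]

end SuspEnd

end DerivedDeligne

namespace DerivedDeligne

/-! ### Homogeneous operations commute with the Koszul action -/

section Equivariance

variable {R V : Type*} [CommRing R] [AddCommGroup V] [Module R V]
  {𝒢 : ℤ × ℤ → Submodule R V} {τ : ℤ × ℤ → V →ₗ[R] V}

theorem IsKoszulAction.rescaled_map (h : IsKoszulAction 𝒢 τ) (d : ℤ × ℤ) {L : List V}
    {D : List (ℤ × ℤ)} (hL : HomList 𝒢 L D) :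
    Rescaled (L.map (τ d)) L (pairing d D.sum) := by
  unfold HomList at hL
  induction hL with
  | nil => rw [List.sum_nil, pairing_zero_right]; exact Rescaled.nil
  | @cons a e L D ha _ ih =>
    rw [List.sum_cons, pairing_add_right]
    exact Rescaled.cons (h.apply _ _ _ ha) ih

/-- On homogeneous entries of total bidegree `e`, both sides carry the sign of `pairing d (x.1 +
e)`. -/
theorem IsKoszulAction.equivariant (h : IsKoszulAction 𝒢 τ) {x : Op V} (hx : ListAdditive x.2)
    (hdeg : ∀ L D, HomList 𝒢 L D → x.2 L ∈ 𝒢 (x.1 + D.sum)) :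
    x.Equivariant (fun d => τ d) := by
  intro d L
  refine h.listAdditive_ext (F := fun L => sgn (pairing d x.1) • x.2 (L.map (τ d)))
    ((hx.comp_map (τ d).toAddMonoidHom).comp (AddMonoidHom.mk' (fun w => sgn (pairing d x.1) • w)
      fun a b => smul_add _ a b)) (hx.comp (τ d).toAddMonoidHom) (fun L D hL => ?_) L
  change sgn (pairing d x.1) • x.2 (L.map (τ d)) = τ d (x.2 L)
  rw [hx.rescale (h.rescaled_map d hL), sgn_smul_smul, ← pairing_add_right,
    h.apply _ _ _ (hdeg L D hL)]

end Equivariance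

/-! ### The brace relation for homogeneous cochains -/

section BraceRelation

variable {R A : Type*} [CommRing R] [AddCommGroup A] [Module R A] (𝒜 : ℤ × ℤ → Submodule R A)

/-- Homogeneous elements of `𝔰 End_A` together with a bidegree. -/
abbrev HomElt : Type _ := {z : (ℤ × ℤ) × SuspEnd 𝒜 // z.2 ∈ suspEndGrading 𝒜 z.1}

variable {𝒜}

/-- The sum of the bidegrees of a list of homogeneous elements. -/
def HomElt.degSum (Z : List (HomElt 𝒜)) : ℤ × ℤ := (Z.map fun z => z.1.1).sum

/-- The underlying elements of a list of homogeneous elements. -/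
def HomElt.elts (Z : List (HomElt 𝒜)) : List (SuspEnd 𝒜) := Z.map fun z => z.1.2

theorem HomElt.homList (Z : List (HomElt 𝒜)) :
    HomList (suspEndGrading 𝒜) (HomElt.elts Z) (Z.map fun z => z.1.1) := by
  unfold HomList HomElt.elts
  rw [List.forall₂_map_left_iff, List.forall₂_map_right_iff, List.forall₂_same]
  exact fun z _ => z.2

theorem HomElt.exists_of_homList {L : List (SuspEnd 𝒜)} {D : List (ℤ × ℤ)}
    (h : HomList (suspEndGrading 𝒜) L D) :
    ∃ Z : List (HomElt 𝒜), HomElt.elts Z = L ∧ (Z.map fun z => z.1.1) = D := by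
  unfold HomList at h
  induction h with
  | nil => exact ⟨[], rfl, rfl⟩
  | @cons x d L D hx _ ih =>
    obtain ⟨Z, rfl, rfl⟩ := ih
    exact ⟨⟨(d, x), hx⟩ :: Z, rfl, rfl⟩

variable [DirectSum.Decomposition 𝒜]

/-- The operation on lists of elements of `A` given by a homogeneous cochain. -/
noncomputable def HomElt.op (z : HomElt 𝒜) : Op A := (z.1.1, opEval 𝒜 z.1.2)

/-- The operation on lists of cochains given by the braces with a homogeneous cochain. -/
noncomputable def HomElt.braceOp (z : HomElt 𝒜) : Op (SuspEnd 𝒜) :=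
  (z.1.1, braceEval (suspEndBrace 𝒜) z.1.2)

theorem HomElt.braceEval_mem (x₀ : HomElt 𝒜) (Z : List (HomElt 𝒜)) :
    braceEval (suspEndBrace 𝒜) x₀.1.2 (HomElt.elts Z) ∈
      suspEndGrading 𝒜 (x₀.1.1 + HomElt.degSum Z) := by
  obtain ⟨z, hz⟩ := exists_eq_seg (⟨((0, 0), 0), Submodule.zero_mem _⟩ : HomElt 𝒜) Z
  rw [hz, HomElt.elts, HomElt.degSum, seg_map, seg_map, braceEval_seg]
  have := suspEndBrace_homogeneous 𝒜 Z.length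
    (Fin.cons x₀.1.1 fun s : Fin Z.length => (z (s + 1)).1.1)
    (Fin.cons x₀.1.2 fun s : Fin Z.length => (z (s + 1)).1.2)
    (Fin.cases x₀.2 fun s => (z (s + 1)).2)
  rw [Fin.sum_univ_succ, Prod.mk_zero_zero, zero_add] at this
  simp only [Fin.cons_zero, Fin.cons_succ] at this
  rw [sum_seg, Finset.sum_Ico_eq_sum_range, Nat.add_sub_cancel, ← Fin.sum_univ_eq_sum_range]
  simpa [add_comm 1] using this

/-- The braces turn into insertion sums with Koszul signs. Both sides are additive in every entry of
the list, so homogeneous entries suffice, where `braceValue_eq_insertSum` applies. -/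
theorem HomElt.opEval_braceEval (x₀ : HomElt 𝒜) (Z : List (HomElt 𝒜)) :
    opEval 𝒜 (braceEval (suspEndBrace 𝒜) x₀.1.2 (HomElt.elts Z)) =
      insertSum (fun d => shiftedTwist 𝒜 d) (Z.map HomElt.op) (opEval 𝒜 x₀.1.2) := by
  obtain ⟨z, hz⟩ := exists_eq_seg (⟨((0, 0), 0), Submodule.zero_mem _⟩ : HomElt 𝒜) Z
  set n := Z.length
  have hK := isKoszulAction_shiftedTwist 𝒜
  have hR : ListAdditive (insertSum (fun d => shiftedTwist 𝒜 d) (Z.map HomElt.op)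
      (opEval 𝒜 x₀.1.2)) := by
    refine listAdditive_insertSum (fun d => (shiftedTwist 𝒜 d).toAddMonoidHom) ?_
      (shiftEval_listAdditive _)
    intro x hx
    obtain ⟨z, -, rfl⟩ := List.mem_map.mp hx
    exact shiftEval_listAdditive _
  funext L
  refine hK.listAdditive_ext (shiftEval_listAdditive _) hR (fun L D hL => ?_) L
  rw [opEval, hK.shiftEval_eq _ hL]
  -- Entries and their bidegrees are zipped so that a single sequence indexed by `ℕ` carries both.
  obtain ⟨a', ha'⟩ := exists_eq_seg ((0, 0) : A × (ℤ × ℤ)) (L.zip D)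
  have hlen : (L.zip D).length = L.length := by
    rw [List.length_zip, ← hL.length_eq, min_self]
  rw [hlen] at ha'
  have hLs : L = seg (fun v => (a' v).1) 1 (L.length + 1) := by
    have := congrArg (List.map Prod.fst) ha'
    rwa [seg_map, List.map_fst_zip hL.length_eq.le] at this
  have hDs : D = seg (fun v => (a' v).2) 1 (L.length + 1) := by
    have := congrArg (List.map Prod.snd) ha'
    rwa [seg_map, List.map_snd_zip hL.length_eq.ge] at this
  set K := L.length
  have ha : ∀ v, 1 ≤ v → v ≤ K → (a' v).1 ∈ vshift 𝒜 (-1) (a' v).2 := by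
    rw [hLs, hDs] at hL
    unfold HomList seg at hL
    rw [List.forall₂_map_left_iff, List.forall₂_map_right_iff, List.forall₂_same] at hL
    intro v h1 h2
    exact hL v (by rw [List.mem_range'_1]; omega)
  -- Outside `1, …, n` the function `tuple` takes the value zero, which is homogeneous of every
  -- bidegree. The homogeneity hypothesis thus holds for all indices.
  have hb := braceValue_eq_insertSum 𝒜 n K (tuple fun s : Fin n => (z (s + 1)).1.1)
    (totalCochain 𝒜 x₀.1.2) (tuple fun s : Fin n => totalCochain 𝒜 (z (s + 1)).1.2) (fun t => by
      by_cases ht : 1 ≤ t ∧ t ≤ n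
      · rw [tuple_eq (fun t => (z t).1.1) ht.1 ht.2,
          tuple_eq (fun t => totalCochain 𝒜 (z t).1.2) ht.1 ht.2]
        exact totalCochain_mem (z t).2
      · rw [tuple, tuple, dif_neg ht, dif_neg ht]
        exact Submodule.zero_mem _)
    (tuple fun s : Fin K => (a' (s + 1)).1) (fun v => (a' v).2) (fun v h1 h2 => by
      rw [tuple_eq (fun v => (a' v).1) h1 h2]
      exact ha v h1 h2)
  have e1 : Z.map HomElt.op = seg (fun t => (tuple (fun s : Fin n => (z (s + 1)).1.1) t,
      shiftEval (shiftedTwist 𝒜) (tuple (fun s : Fin n => totalCochain 𝒜 (z (s + 1)).1.2) t)))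
        1 (n + 1) := by
    rw [hz, seg_map]
    refine seg_congr fun t h1 h2 => ?_
    rw [tuple_eq (fun t => (z t).1.1) h1 (by omega),
      tuple_eq (fun t => totalCochain 𝒜 (z t).1.2) h1 (by omega)]
    rfl
  have e2 : HomElt.elts Z = seg (fun t => (z t).1.2) 1 (n + 1) := by
    rw [hz, HomElt.elts, seg_map]
  have e3 : seg (tuple fun s : Fin K => (a' (s + 1)).1) 1 (K + 1) =
      seg (fun v => (a' v).1) 1 (K + 1) :=
    seg_congr fun v h1 h2 => tuple_eq (fun v => (a' v).1) h1 (by omega)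
  rw [e3] at hb
  rw [e1, e2, hLs, hDs, seg_map]
  refine Eq.trans ?_ hb
  rw [evalList_seg, braceEval_seg, totalCochain_suspEndBrace 𝒜
    (Fin.cons x₀.1.1 fun s : Fin n => (z (s + 1)).1.1) _
    (Fin.cases x₀.2 fun s => (z (s + 1)).2)]
  rfl

theorem HomElt.totalCochain_evalList_mem (z : HomElt 𝒜) {L : List A} {D : List (ℤ × ℤ)}
    (hL : HomList (vshift 𝒜 (-1)) L D) : z.op.2 L ∈ vshift 𝒜 (-1) (z.1.1 + D.sum) := by
  change shiftEval _ _ L ∈ _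
  rw [(isKoszulAction_shiftedTwist 𝒜).shiftEval_eq _ hL]
  exact (vshift 𝒜 (-1) _).toAddSubgroup.zsmul_mem
    (evalList_mem_vshift (totalCochain_mem z.2) hL) _

theorem HomElt.op_equivariant (z : HomElt 𝒜) :
    z.op.Equivariant (fun d => shiftedTwist 𝒜 d) :=
  (isKoszulAction_shiftedTwist 𝒜).equivariant (shiftEval_listAdditive _)
    fun _ _ hL => z.totalCochain_evalList_mem hL

/-- The brace relation, for lists of homogeneous elements. -/
theorem HomElt.braceEval_braceEval (x₀ : HomElt 𝒜) (X Y : List (HomElt 𝒜)) :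
    braceEval (suspEndBrace 𝒜) (braceEval (suspEndBrace 𝒜) x₀.1.2 (HomElt.elts X))
        (HomElt.elts Y) =
      insertSum (fun d => twist (suspEndGrading 𝒜) d) (X.map HomElt.braceOp)
        (braceEval (suspEndBrace 𝒜) x₀.1.2) (HomElt.elts Y) := by
  have hK := isKoszulAction_shiftedTwist 𝒜
  -- Insertions are carried out among homogeneous elements with recorded bidegrees. This insertion
  -- sum maps naturally to the one in `𝔰 End_A`, by forgetting bidegrees (`h1`), and to the one for
  -- operations on lists, by `HomElt.op` (`h2`), where `insertSum_insertSum` is available.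
  let τ : ℤ × ℤ → HomElt 𝒜 → HomElt 𝒜 := fun d z =>
    ⟨(z.1.1, sgn (pairing d z.1.1) • z.1.2), (suspEndGrading 𝒜 _).toAddSubgroup.zsmul_mem z.2 _⟩
  let lop : HomElt 𝒜 → Op (HomElt 𝒜) := fun x => (x.1.1, fun Z =>
    ⟨(x.1.1 + HomElt.degSum Z, braceEval (suspEndBrace 𝒜) x.1.2 (HomElt.elts Z)),
      HomElt.braceEval_mem x Z⟩)
  have hdeg : ∀ Z : List (HomElt 𝒜), opsDeg (Z.map HomElt.op) = HomElt.degSum Z := fun Z => by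
    rw [opsDeg, HomElt.degSum, List.map_map]; rfl
  have h1 : ∀ F : List (SuspEnd 𝒜) → SuspEnd 𝒜, insertSum (fun d => twist (suspEndGrading 𝒜) d)
      (X.map HomElt.braceOp) F (HomElt.elts Y) =
      insertSum τ (X.map lop) (fun U => F (HomElt.elts U)) Y := fun F => by
    refine insertSum_map (θ := fun z : HomElt 𝒜 => z.1.2) (fun d z => ?_) ?_ F Y
    · exact (twist_of_mem _ d _ z.2).symm
    · rw [List.forall₂_map_right_iff, List.forall₂_map_left_iff, List.forall₂_same]
      exact fun x _ => ⟨rfl, fun L => rfl⟩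
  have h2 : ∀ F : List (Op A) → A, insertSum Op.twist
      ((X.map HomElt.op).map (Op.lift fun d => shiftedTwist 𝒜 d)) F (Y.map HomElt.op) =
      insertSum τ (X.map lop) (fun U => F (U.map HomElt.op)) Y := fun F => by
    refine insertSum_map (fun d z => ?_) ?_ F Y
    · refine Prod.ext rfl (funext fun L => ?_)
      exact map_zsmul (opEvalHom 𝒜 L) _ _
    · rw [List.map_map, List.forall₂_map_right_iff, List.forall₂_map_left_iff, List.forall₂_same]
      refine fun x _ => ⟨rfl, fun L => Prod.ext ?_ ?_⟩
      · exact congrArg (x.1.1 + ·) (hdeg L).symm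
      · exact HomElt.opEval_braceEval x L
  refine opEval_injective 𝒜 (funext fun L => ?_)
  have h3 := HomElt.opEval_braceEval (⟨(x₀.1.1 + HomElt.degSum X,
    braceEval (suspEndBrace 𝒜) x₀.1.2 (HomElt.elts X)), HomElt.braceEval_mem x₀ X⟩ : HomElt 𝒜) Y
  rw [h1]
  refine (congrFun h3 L).trans ?_
  rw [HomElt.opEval_braceEval x₀ X, insertSum_insertSum hK.zero_act hK.add_act (fun e n v => map_zsmul _ n v) _
    (fun y hy => by
      obtain ⟨z, -, rfl⟩ := List.mem_map.mp hy
      exact z.op_equivariant) (opEval_listAdditive 𝒜 x₀.1.2), h2]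
  -- Evaluation at `L` is additive in the cochain, hence commutes with the sum over insertions.
  refine Eq.trans ?_ (map_insertSum τ (opEvalHom 𝒜 L) (X.map lop) _ Y).symm
  congr 1
  funext Z
  exact (congrFun (HomElt.opEval_braceEval x₀ Z) L).symm

end BraceRelation

end DerivedDeligne

namespace DerivedDeligne

/-! ### The brace algebra `𝔰 End_A` -/

section BraceAlgebra

variable {R A : Type*} [CommRing R] [AddCommGroup A] [Module R A] {𝒜 : ℤ × ℤ → Submodule R A}
  [DirectSum.Decomposition 𝒜]

theorem braceEval_nil (x : SuspEnd 𝒜) : braceEval (suspEndBrace 𝒜) x [] = x := by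
  refine DFunLike.congr_fun ((isKoszulAction_twist (suspEndGrading 𝒜)).hom_ext
    (f := braceHom (suspEndBrace 𝒜) []) (g := AddMonoidHom.id _) fun e a ha => ?_) x
  exact opEval_injective 𝒜 (HomElt.opEval_braceEval ⟨(e, a), ha⟩ [])

theorem HomElt.braceOp_listAdditive (z : HomElt 𝒜) : ListAdditive z.braceOp.2 :=
  braceEval_listAdditive _ _

theorem isBraceAlgebra_suspEnd : IsBraceAlgebra (suspEndGrading 𝒜) (suspEndBrace 𝒜) where
  homogeneous := suspEndBrace_homogeneous 𝒜
  brace_zero := braceEval_nil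
  relation n m x₀ α x β y hx hy := by
    have hK := isKoszulAction_twist (suspEndGrading 𝒜)
    -- The element `x₀` need not be homogeneous. Both sides are written as additive maps in `x₀`,
    -- which makes homogeneous `x₀` sufficient.
    have key : (braceHom (suspEndBrace 𝒜) (seg y 1 (m + 1))).comp
        (braceHom (suspEndBrace 𝒜) (seg x 1 (n + 1))) =
        ∑ p ∈ insertions n m,
        sgn (∑ t ∈ Finset.Icc 1 n, ∑ v ∈ Finset.Ico 1 (p.start t), pairing (α t) (β v)) •
          braceHom (suspEndBrace 𝒜)
            (weave p (fun t => braceEval (suspEndBrace 𝒜) (x t) (block p y t)) y) := by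
      refine hK.hom_ext fun e x₀ hx₀ => ?_
      have h := HomElt.braceEval_braceEval ⟨(e, x₀), hx₀⟩
        (seg (fun t => (⟨(α t, x t), hx t⟩ : HomElt 𝒜)) 1 (n + 1))
        (seg (fun v => (⟨(β v, y v), hy v⟩ : HomElt 𝒜)) 1 (m + 1))
      simp only [HomElt.elts, seg_map] at h
      rw [insertSum_seg hK.zero_act hK.add_act] at h
      refine h.trans ?_
      rw [AddMonoidHom.finsetSum_apply]
      refine Finset.sum_congr rfl fun p hp => ?_
      exact hK.eval_weave_passed (braceEval_listAdditive (suspEndBrace 𝒜) x₀)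
        (act := fun t => braceEval (suspEndBrace 𝒜) (x t))
        (fun t => braceEval_listAdditive _ _) hp α fun v _ _ => hy v
    have := DFunLike.congr_fun key x₀
    rw [AddMonoidHom.finsetSum_apply] at this
    exact this

theorem vshift_vshift (𝒢 : ℤ × ℤ → Submodule R A) : vshift (vshift 𝒢 1) (-1) = 𝒢 := by
  funext d
  simp [vshift]

end BraceAlgebra

/-! ### The relations of a derived `A_∞`-algebra, with mere Koszul signs -/

section DerivedRelation

variable {R V M : Type*} [CommRing R] [AddCommGroup V] [Module R V] [AddCommGroup M]
  {𝒢 : ℤ × ℤ → Submodule R V} {τ : ℤ × ℤ → V →ₗ[R] V}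

theorem ListAdditive.map_zero {F : List V → M} (hF : ListAdditive F) (A B : List V) :
    F (A ++ 0 :: B) = 0 := by
  obtain ⟨g, hg⟩ := hF A B
  rw [hg, _root_.map_zero]

theorem shiftEval_nil {f : Cochains R V} (h : f 0 = 0) : shiftEval τ f [] = 0 := by
  change f 0 _ = 0
  rw [h]; rfl

/-- The sum in the relation of a derived `A_∞`-algebra, with the signs from the conjugation with the
shift. -/
def shiftRelation (τ : ℤ × ℤ → V →ₗ[R] V) (m : ℕ → Cochains R V) (u : ℕ) (L : List V) : V :=
  ∑ ip ∈ Finset.HasAntidiagonal.antidiagonal u, sgn (ip.2 : ℤ) • splitSum₃ (fun A C D =>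
    shiftEval τ (m ip.1) (A.map (τ ((ip.2 : ℤ), 1 - (ip.2 : ℤ))) ++
      shiftEval τ (m ip.2) C :: D)) L

/-- Here `β` holds the degrees in the algebra itself, while `𝒢` is the grading shifted down by one.
Conjugation with the shift absorbs $(-1)^{rq+t+pj}$ and leaves $(-1)^p$ with Koszul signs. The lemma
serves twice: for `m` on `A`, to extract the relation, and for `hochM` on the Hochschild complex, to
prove it. -/
theorem IsKoszulAction.shiftRelation_eq (h : IsKoszulAction 𝒢 τ) (m : ℕ → Cochains R V)
    (h₀ : ∀ i, m i 0 = 0)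
    (hm : ∀ (i : ℕ) L D, HomList 𝒢 L D → evalList (m i) L ∈ 𝒢 (((i : ℤ), 1 - (i : ℤ)) + D.sum))
    (u v : ℕ) (β : ℕ → ℤ × ℤ) (a : ℕ → V) (ha : ∀ w, a w ∈ 𝒢 (β w + (0, -1))) :
    shiftRelation τ m u (seg a 1 (v + 1)) =
      sgn (afterSum (seg (fun w => (β w + (0, -1)).2) 1 (v + 1))) •
    ∑ ip ∈ Finset.HasAntidiagonal.antidiagonal u, ∑ r ∈ Finset.range v, ∑ q ∈ Finset.Icc 1 (v - r),
      (let i := ip.1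
       let p := ip.2
       let t := v - r - q
       let j := r + 1 + t
       sgn ((r * q + t + p * j : ℕ) +
          pairing ((p : ℤ), 2 - ((p : ℤ) + q)) (∑ w ∈ Finset.Icc 1 r, β w)) •
        evalList (m i) (seg a 1 (r + 1) ++
          evalList (m p) (seg a (r + 1) (r + q + 1)) :: seg a (r + q + 1) (v + 1))) := by
  rw [shiftRelation, Finset.smul_sum]
  refine Finset.sum_congr rfl fun ip _ => ?_
  obtain ⟨i, p⟩ := ip
  simp only
  rw [splitSum₃_seg, Finset.sum_range_succ]
  -- A full decomposition of the list also allows an empty middle part. It contributes nothing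
  -- because there is no operation of arity zero, and this removes `q = 0` and with it `r = v`.
  have hzero : ∀ r : ℕ, shiftEval τ (m i) ((seg a 1 (r + 1)).map (τ ((p : ℤ), 1 - (p : ℤ))) ++
      shiftEval τ (m p) (seg a (r + 1) (r + 0 + 1)) :: seg a (r + 0 + 1) (v + 1)) = 0 := fun r => by
    rw [add_zero, seg_self, shiftEval_nil (h₀ p)]
    exact (shiftEval_listAdditive (m i)).map_zero _ _
  rw [Nat.sub_self, zero_add, Finset.sum_range_one, hzero, add_zero, Finset.smul_sum,
    Finset.smul_sum]
  refine Finset.sum_congr rfl fun r hr => ?_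
  have hr' := Finset.mem_range.mp hr
  have hsub : ∑ q ∈ Finset.range (v - r + 1), shiftEval τ (m i)
      ((seg a 1 (r + 1)).map (τ ((p : ℤ), 1 - (p : ℤ))) ++
        shiftEval τ (m p) (seg a (r + 1) (r + q + 1)) :: seg a (r + q + 1) (v + 1)) =
      ∑ q ∈ Finset.Icc 1 (v - r), shiftEval τ (m i)
      ((seg a 1 (r + 1)).map (τ ((p : ℤ), 1 - (p : ℤ))) ++
        shiftEval τ (m p) (seg a (r + 1) (r + q + 1)) :: seg a (r + q + 1) (v + 1)) := by
    symm
    refine Finset.sum_subset (fun q hq => ?_) fun q hq hq' => ?_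
    · rw [Finset.mem_range]; have := Finset.mem_Icc.mp hq; omega
    · have h1 := Finset.mem_range.mp hq
      obtain rfl : q = 0 := by
        by_contra hne
        exact hq' (Finset.mem_Icc.mpr ⟨by omega, by omega⟩)
      exact hzero r
  rw [hsub, Finset.smul_sum, Finset.smul_sum]
  refine Finset.sum_congr rfl fun q hq => ?_
  have hq' := Finset.mem_Icc.mp hq
  obtain ⟨t, rfl⟩ : ∃ t, v = r + q + t := ⟨v - r - q, by omega⟩
  rw [show r + q + t - r - q = t by omega]
  set γ : ℕ → ℤ × ℤ := fun w => β w + (0, -1) with hγ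
  have hA : HomList 𝒢 (seg a 1 (r + 1)) (seg γ 1 (r + 1)) := HomList.seg fun v _ _ => ha v
  have hC : HomList 𝒢 (seg a (r + 1) (r + q + 1)) (seg γ (r + 1) (r + q + 1)) :=
    HomList.seg fun v _ _ => ha v
  have hD : HomList 𝒢 (seg a (r + q + 1) (r + q + t + 1)) (seg γ (r + q + 1) (r + q + t + 1)) :=
    HomList.seg fun v _ _ => ha v
  have hres : Rescaled ((seg a 1 (r + 1)).map (τ ((p : ℤ), 1 - (p : ℤ))) ++
      shiftEval τ (m p) (seg a (r + 1) (r + q + 1)) :: seg a (r + q + 1) (r + q + t + 1))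
      (seg a 1 (r + 1) ++
      evalList (m p) (seg a (r + 1) (r + q + 1)) :: seg a (r + q + 1) (r + q + t + 1)) _ :=
    (h.rescaled_map _ hA).append (Rescaled.cons (h.shiftEval_eq (m p) hC) (Rescaled.refl _))
  have hhom : HomList 𝒢 (seg a 1 (r + 1) ++
      evalList (m p) (seg a (r + 1) (r + q + 1)) :: seg a (r + q + 1) (r + q + t + 1))
      (seg γ 1 (r + 1) ++ (((p : ℤ), 1 - (p : ℤ)) + (seg γ (r + 1) (r + q + 1)).sum) ::
        seg γ (r + q + 1) (r + q + t + 1)) :=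
    List.rel_append hA (List.Forall₂.cons (hm p _ _ hC) hD)
  rw [(shiftEval_listAdditive (m i)).rescale hres, h.shiftEval_eq (m i) hhom, sgn_smul_smul,
    sgn_smul_smul, sgn_smul_smul]
  congr 1
  rw [← seg_append (fun w => (γ w).2) (show 1 ≤ r + 1 by omega) (show r + 1 ≤ r + q + t + 1 by omega),
    ← seg_append (fun w => (γ w).2) (show r + 1 ≤ r + q + 1 by omega)
      (show r + q + 1 ≤ r + q + t + 1 by omega)]
  simp only [List.map_append, List.map_cons, seg_map, afterSum_append, afterSum,
    List.length_append, List.length_cons, length_seg, sum_seg, Prod.snd_add, Prod.snd_sum]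
  have hI : Finset.Icc 1 r = Finset.Ico 1 (r + 1) := by
    ext w; simp only [Finset.mem_Icc, Finset.mem_Ico]; omega
  have hs : ∑ w ∈ Finset.Icc 1 r, β w = ∑ w ∈ Finset.Ico 1 (r + 1), γ w + (0, (r : ℤ)) := by
    rw [hI, hγ, Finset.sum_add_distrib, Finset.sum_const, Nat.card_Ico]
    refine Prod.ext ?_ ?_
    · simp
    · simp
  rw [hs, show r + q + 1 - (r + 1) = q by omega, show r + q + t + 1 - (r + q + 1) = t by omega]
  -- The difference of the exponents, after the shift of `β` by one is inserted, is `-2 * (t * p +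
  -- r)`.
  refine sgn_congr (-(t * p + r)) ?_
  simp only [pairing, Prod.fst_add, Prod.snd_add, Prod.fst_sum, Prod.snd_sum]
  push_cast
  ring

end DerivedRelation

end DerivedDeligne

namespace DerivedDeligne

/-! ### Decompositions with few nonzero terms -/

section SplitSums

variable {V M : Type*} [AddCommGroup M]

theorem insertSum_singleton {τ : ℤ × ℤ → V → V} (hτ₀ : ∀ v, τ 0 v = v)
    (hτ : ∀ d e v, τ (d + e) v = τ d (τ e v)) (x : Op V) (F : List V → M) (L : List V) :
    insertSum τ [x] F L =
      splitSum₃ (fun A C D => F (A.map (τ x.1) ++ x.2 C :: D)) L :=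
  insertSum_snoc hτ₀ hτ [] x F L

theorem insertSum_nil_right (τ : ℤ × ℤ → V → V) (X : List (Op V)) (F : List V → M) :
    insertSum τ X F [] = F (X.map fun x => x.2 []) := by
  induction X generalizing F with
  | nil => rfl
  | cons x X ih => rw [insertSum_cons]; exact ih _

theorem splitSum_eq_left {f : List V → List V → M} {L : List V} (h : ∀ a A B, f (a :: A) B = 0) :
    splitSum f L = f [] L := by
  cases L with
  | nil => rfl
  | cons a L => rw [splitSum]; simp only [h, splitSum_zero, add_zero]

theorem splitSum_eq_right {f : List V → List V → M} {L : List V} (h : ∀ A b B, f A (b :: B) = 0) :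
    splitSum f L = f L [] := by
  induction L generalizing f with
  | nil => rfl
  | cons a L ih => rw [splitSum, h, zero_add, ih fun A b B => h _ _ _]

theorem splitSum_eq_zero {f : List V → List V → M} {L : List V} (h : ∀ A B, f A B = 0) :
    splitSum f L = 0 := by
  have : f = fun _ _ => 0 := funext fun A => funext fun B => h A B
  rw [this, splitSum_zero]

theorem splitSum₃_eq_middle {f : List V → List V → List V → M} {L : List V}
    (h : ∀ A C D, A ≠ [] ∨ D ≠ [] → f A C D = 0) : splitSum₃ f L = f [] L [] := by
  rw [splitSum₃, splitSum_eq_left, splitSum_eq_right]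
  · exact fun A b B => h _ _ _ (Or.inr (List.cons_ne_nil _ _))
  · exact fun a A B => splitSum_eq_zero fun C D => h _ _ _ (Or.inl (List.cons_ne_nil _ _))

/-- A sum over the decompositions of a list, the middle part of which has at most one entry. -/
theorem splitSum₃_cons_of_short {f : List V → List V → List V → M}
    (h : ∀ A c c' C D, f A (c :: c' :: C) D = 0) (x : V) (L : List V) :
    splitSum₃ f (x :: L) =
      f [] [] (x :: L) + f [] [x] L + splitSum₃ (fun A C D => f (x :: A) C D) L := by
  rw [splitSum₃, splitSum, splitSum]
  rw [splitSum_eq_left fun a A B => h _ _ _ _ _]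
  rfl

theorem splitSum₃_sub (f g : List V → List V → List V → M) (L : List V) :
    splitSum₃ (fun A C D => f A C D - g A C D) L = splitSum₃ f L - splitSum₃ g L := by
  rw [eq_sub_iff_add_eq, ← splitSum₃_add]
  simp only [sub_add_cancel]

end SplitSums

/-! ### Auxiliary facts on homogeneous lists and shift signs -/

section ListLemmas

variable {R V M : Type*} [CommRing R] [AddCommGroup V] [Module R V] [AddCommGroup M]
  {𝒢 : ℤ × ℤ → Submodule R V} {τ : ℤ × ℤ → V →ₗ[R] V}

theorem HomList.exists_seg {L : List V} {D : List (ℤ × ℤ)} (h : HomList 𝒢 L D) :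
    ∃ (β : ℕ → ℤ × ℤ) (a : ℕ → V), (∀ w, a w ∈ 𝒢 (β w)) ∧
      L = DerivedDeligne.seg a 1 (L.length + 1) ∧
        D = DerivedDeligne.seg β 1 (L.length + 1) := by
  have : ∃ Z : List {z : (ℤ × ℤ) × V // z.2 ∈ 𝒢 z.1}, (Z.map fun z => z.1.2) = L ∧
      (Z.map fun z => z.1.1) = D := by
    unfold HomList at h
    induction h with
    | nil => exact ⟨[], rfl, rfl⟩
    | @cons x d L D hx _ ih =>
      obtain ⟨Z, rfl, rfl⟩ := ih
      exact ⟨⟨(d, x), hx⟩ :: Z, rfl, rfl⟩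
  obtain ⟨Z, rfl, rfl⟩ := this
  obtain ⟨z, hz⟩ := exists_eq_seg (⟨(0, 0), Submodule.zero_mem _⟩ :
    {z : (ℤ × ℤ) × V // z.2 ∈ 𝒢 z.1}) Z
  refine ⟨fun w => (z w).1.1, fun w => (z w).1.2, fun w => (z w).2, ?_, ?_⟩
  · rw [List.length_map, ← seg_map (fun z : {z : (ℤ × ℤ) × V // z.2 ∈ 𝒢 z.1} => z.1.2), ← hz]
  · rw [List.length_map, ← seg_map (fun z : {z : (ℤ × ℤ) × V // z.2 ∈ 𝒢 z.1} => z.1.1), ← hz]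

theorem ListAdditive.sum {ι : Type*} {s : Finset ι} {F : ι → List V → M}
    (h : ∀ i ∈ s, ListAdditive (F i)) : ListAdditive fun L => ∑ i ∈ s, F i L := by
  classical
  intro L₁ L₂
  induction s using Finset.induction_on with
  | empty => exact ⟨0, fun w => rfl⟩
  | insert i s hi ih =>
    obtain ⟨g, hg⟩ := ih fun j hj => h j (Finset.mem_insert_of_mem hj)
    obtain ⟨g', hg'⟩ := h i (Finset.mem_insert_self _ _) L₁ L₂
    refine ⟨g' + g, fun w => ?_⟩
    have := hg w
    simp only at this
    simp only [Finset.sum_insert hi, this, hg', AddMonoidHom.add_apply]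

theorem ListAdditive.zsmul {F : List V → M} (hF : ListAdditive F) (n : ℤ) :
    ListAdditive fun L => n • F L :=
  hF.comp (AddMonoidHom.mk' (fun w => n • w) fun a b => smul_add _ a b)

theorem shiftRelation_listAdditive (m : ℕ → Cochains R V) (u : ℕ) :
    ListAdditive (shiftRelation τ m u) := by
  refine ListAdditive.sum fun ip _ => (listAdditive_splitSum₃ ?_ ?_ ?_).zsmul _
  · exact fun C D => ((shiftEval_listAdditive _).append_right _).comp_map
      (τ ((ip.2 : ℤ), 1 - (ip.2 : ℤ))).toAddMonoidHom
  · exact fun A D => (shiftEval_listAdditive _).comp_entry (shiftEval_listAdditive _) _ _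
  · intro A C
    have := (shiftEval_listAdditive (τ := τ) (m ip.1)).append_left
      (A.map (τ ((ip.2 : ℤ), 1 - (ip.2 : ℤ))) ++ [shiftEval τ (m ip.2) C])
    simpa using this

theorem IsKoszulAction.act_act (h : IsKoszulAction 𝒢 τ) (d : ℤ × ℤ) (v : V) :
    τ d (τ d v) = v := by
  refine DFunLike.congr_fun (h.hom_ext (f := (τ d ∘ₗ τ d).toAddMonoidHom)
    (g := AddMonoidHom.id V) fun e a ha => ?_) v
  change τ d (τ d a) = a
  rw [h.apply _ _ _ ha, map_zsmul, h.apply _ _ _ ha, sgn_smul_self]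

theorem getElem_shiftSigns (L : List V) (s : ℕ) (hs : s < (shiftSigns τ L).length) :
    (shiftSigns τ L)[s] = τ (0, (L.length : ℤ) - (s + 1))
      (L[s]'(by rwa [length_shiftSigns] at hs)) := by
  induction L generalizing s with
  | nil => exact absurd hs (by simp [shiftSigns])
  | cons a L ih =>
    cases s with
    | zero => simp [shiftSigns]
    | succ s =>
      simp only [shiftSigns, List.getElem_cons_succ]
      rw [ih]
      simp

end ListLemmas

/-! ### The elements $m_{i\bullet}$ and the structure maps on the Hochschild complex -/

section StructureMaps

variable {R A : Type*} [CommRing R] [AddCommGroup A] [Module R A] {𝒜 : ℤ × ℤ → Submodule R A}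
  [DirectSum.Decomposition 𝒜] {m : ℕ → ∀ j : ℕ, MultilinearMap R (fun _ : Fin j => A) A}
  (hm : IsDerivedAInfinityAlgebra 𝒜 m)

/-- The relation of the derived $A_\infty$-algebra up to a sign on homogeneous lists, then on all
lists by additivity. For the empty list the sum on the other side has no terms. -/
theorem IsDerivedAInfinityAlgebra.shiftRelation_eq_zero (hm : IsDerivedAInfinityAlgebra 𝒜 m) (u : ℕ) (L : List A) :
    shiftRelation (shiftedTwist 𝒜) m u L = 0 := by
  have hK := isKoszulAction_shiftedTwist 𝒜
  refine hK.listAdditive_ext (F' := fun _ => 0) (shiftRelation_listAdditive m u)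
    (fun _ _ => ⟨0, fun _ => rfl⟩) (fun L D hL => ?_) L
  obtain ⟨β, a, ha, hLa, -⟩ := hL.exists_seg
  rw [hLa, hK.shiftRelation_eq m hm.arity_zero ?_ u _ (fun w => β w + (0, 1)) a
    fun w => by simpa [add_assoc, Prod.mk_zero_zero] using ha w]
  · rcases Nat.eq_zero_or_pos L.length with h0 | hpos
    · simp [h0]
    · rw [hm.relation u _ hpos _ _ fun w => mem_of_mem_vshift (ha w), smul_zero]
  · intro i L D hL
    have : totalCochain 𝒜 (hochMul 𝒜 m hm i) = m i := totalCochain_lof 𝒜 _ _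
    rw [← this]
    exact evalList_mem_vshift (totalCochain_mem ⟨_, rfl⟩) hL

/-- The element `m_i•` with its bidegree. -/
noncomputable def mulElt (i : ℕ) : HomElt 𝒜 :=
  ⟨(((i : ℤ), 1 - (i : ℤ)), hochMul 𝒜 m hm i), ⟨_, rfl⟩⟩

/-- The derived $A_\infty$-relations as one equation of Maurer–Cartan type in `𝔰 End_A` for each
`u`: under `opEval` the left side becomes `shiftRelation`. -/
theorem sum_brace_hochMul (u : ℕ) : ∑ ip ∈ Finset.HasAntidiagonal.antidiagonal u,
    sgn (ip.2 : ℤ) • braceEval (suspEndBrace 𝒜) (hochMul 𝒜 m hm ip.1) [hochMul 𝒜 m hm ip.2] =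
      0 := by
  have hK := isKoszulAction_shiftedTwist 𝒜
  refine opEval_injective 𝒜 (funext fun L => ?_)
  have ht : ∀ i, totalCochain 𝒜 (hochMul 𝒜 m hm i) = m i := fun i => totalCochain_lof 𝒜 _ _
  refine Eq.trans ?_ ((hm.shiftRelation_eq_zero u L).trans (map_zero (opEvalHom 𝒜 L)).symm)
  refine (map_sum (opEvalHom 𝒜 L) _ _).trans (Finset.sum_congr rfl fun ip _ => ?_)
  rw [map_zsmul]
  congr 1
  refine (congrFun (HomElt.opEval_braceEval (mulElt hm ip.1) [mulElt hm ip.2]) L).trans ?_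
  rw [List.map_singleton, insertSum_singleton hK.zero_act hK.add_act]
  simp only [HomElt.op, opEval, mulElt, ht]

/-- The terms of `b_1(x; m_i•)`, up to sign, and `m_i•` itself. -/
noncomputable def hochCorr (i : ℕ) : List (SuspEnd 𝒜) → SuspEnd 𝒜
  | [] => hochMul 𝒜 m hm i
  | [x] => braceEval (suspEndBrace 𝒜) (twist (V := SuspEnd 𝒜) (suspEndGrading 𝒜)
      ((i : ℤ), 1 - (i : ℤ)) x) [hochMul 𝒜 m hm i]
  | _ :: _ :: _ => 0

/-- The structure maps on the Hochschild complex, without the signs from the shift. -/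
noncomputable def hochP (i : ℕ) (L : List (SuspEnd 𝒜)) : SuspEnd 𝒜 :=
  braceEval (suspEndBrace 𝒜) (hochMul 𝒜 m hm i) L - hochCorr hm i L

/-- The value of `hochCorr` on the empty list is chosen to cancel $b_0(m_{i\bullet})=m_{i\bullet}$,
in agreement with the absence of structure maps of arity zero. -/
theorem hochP_nil (i : ℕ) : hochP hm i [] = 0 := by
  rw [hochP, braceEval_nil, hochCorr, sub_self]

/-- For $j\ge2$ the sign in the definition of $M_{ij}$ is exactly the sign of the conjugation with
the shift, so the two cancel. For $j=1$ there is no shift sign, and the second term is the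
correction. -/
theorem shiftEval_hochM (i : ℕ) (L : List (SuspEnd 𝒜)) :
    shiftEval (twist (suspEndGrading 𝒜)) (hochM 𝒜 m hm i) L = hochP hm i L := by
  have hK := isKoszulAction_twist (suspEndGrading 𝒜)
  rcases L with _ | ⟨x, _ | ⟨y, L⟩⟩
  · rw [hochP_nil]; rfl
  · have hx : shiftSigns (twist (suspEndGrading 𝒜)) [x] = [x] := by
      rw [shiftSigns, shiftSigns]
      exact congrArg (fun z => [z]) (hK.zero_act x)
    rw [shiftEval, hx]
    change suspEndBrace 𝒜 1 _ - suspEndBrace 𝒜 1 _ = suspEndBrace 𝒜 1 _ - suspEndBrace 𝒜 1 _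
    congr 2
    funext s
    refine Fin.cases rfl (fun s => ?_) s
    obtain rfl : s = 0 := Subsingleton.elim _ _
    rfl
  · set K := x :: y :: L with hKdef
    have hlen := length_shiftSigns (τ := twist (suspEndGrading 𝒜)) K
    rw [shiftEval, evalList_congr _ _ _ hlen, hochP]
    have : hochCorr hm i K = 0 := rfl
    rw [this, sub_zero]
    change suspEndBrace 𝒜 (L.length + 2) (Fin.cons (hochMul 𝒜 m hm i) fun s =>
      twist (suspEndGrading 𝒜) (0, ((L.length + 2 : ℕ) : ℤ) - ((s : ℤ) + 1)) _) =
      suspEndBrace 𝒜 (L.length + 2) (Fin.cons (hochMul 𝒜 m hm i) K.get)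
    congr 2
    funext s
    simp only [List.get_eq_getElem, Fin.val_cast, getElem_shiftSigns]
    -- The same sign acts twice on each entry.
    exact hK.act_act _ _

theorem hochCorr_mem (i : ℕ) (X : List (HomElt 𝒜)) :
    hochCorr hm i (HomElt.elts X) ∈
      suspEndGrading 𝒜 (((i : ℤ), 1 - (i : ℤ)) + HomElt.degSum X) := by
  rcases X with _ | ⟨x, _ | ⟨y, X⟩⟩
  · rw [HomElt.degSum, List.map_nil, List.sum_nil, add_zero]
    exact (mulElt hm i).2
  · have hx := twist_mem (suspEndGrading 𝒜) ((i : ℤ), 1 - (i : ℤ)) x.2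
    have := HomElt.braceEval_mem (⟨(x.1.1, twist (suspEndGrading 𝒜) ((i : ℤ), 1 - (i : ℤ)) x.1.2), hx⟩ :
      HomElt 𝒜) [mulElt hm i]
    simp only [HomElt.degSum, List.map_singleton, List.sum_singleton] at this ⊢
    rw [add_comm]
    exact this
  · exact Submodule.zero_mem _

theorem hochP_mem (i : ℕ) (X : List (HomElt 𝒜)) :
    hochP hm i (HomElt.elts X) ∈
      suspEndGrading 𝒜 (((i : ℤ), 1 - (i : ℤ)) + HomElt.degSum X) :=
  Submodule.sub_mem _ (HomElt.braceEval_mem (mulElt hm i) X) (hochCorr_mem hm i X)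

theorem evalList_hochM_mem (i : ℕ) {L : List (SuspEnd 𝒜)} {D : List (ℤ × ℤ)}
    (hL : HomList (suspEndGrading 𝒜) L D) :
    evalList (hochM 𝒜 m hm i) L ∈ suspEndGrading 𝒜 (((i : ℤ), 1 - (i : ℤ)) + D.sum) := by
  have h := (isKoszulAction_twist (suspEndGrading 𝒜)).shiftEval_eq (hochM 𝒜 m hm i) hL
  obtain ⟨X, rfl, rfl⟩ := HomElt.exists_of_homList hL
  rw [shiftEval_hochM] at h
  rw [← sgn_smul_self (afterSum _) (evalList _ _), ← h]
  exact (suspEndGrading 𝒜 _).toAddSubgroup.zsmul_mem (hochP_mem hm i X) _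

end StructureMaps

end DerivedDeligne

namespace DerivedDeligne

/-! ### The derived $A_\infty$-relations on the Hochschild complex -/

section HochschildRelation

variable {R A : Type*} [CommRing R] [AddCommGroup A] [Module R A] {𝒜 : ℤ × ℤ → Submodule R A}
  [DirectSum.Decomposition 𝒜] {m : ℕ → ∀ j : ℕ, MultilinearMap R (fun _ : Fin j => A) A}
  (hm : IsDerivedAInfinityAlgebra 𝒜 m)

theorem braceEval_zsmul (n : ℤ) (x : SuspEnd 𝒜) (L : List (SuspEnd 𝒜)) :
    braceEval (suspEndBrace 𝒜) (n • x) L = n • braceEval (suspEndBrace 𝒜) x L :=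
  map_zsmul (braceHom (suspEndBrace 𝒜) L) n x

theorem braceEval_sub (x y : SuspEnd 𝒜) (L : List (SuspEnd 𝒜)) :
    braceEval (suspEndBrace 𝒜) (x - y) L =
      braceEval (suspEndBrace 𝒜) x L - braceEval (suspEndBrace 𝒜) y L :=
  map_sub (braceHom (suspEndBrace 𝒜) L) x y

theorem braceEval_zero (L : List (SuspEnd 𝒜)) : braceEval (suspEndBrace 𝒜) 0 L = 0 :=
  map_zero (braceHom (suspEndBrace 𝒜) L)

theorem HomElt.opsDeg_braceOp (X : List (HomElt 𝒜)) :
    opsDeg (X.map HomElt.braceOp) = HomElt.degSum X := by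
  rw [opsDeg, List.map_map]
  rfl

theorem HomElt.map_braceOp_nil (X : List (HomElt 𝒜)) :
    ((X.map HomElt.braceOp).map fun x => x.2 []) = HomElt.elts X := by
  rw [List.map_map]
  exact List.map_congr_left fun x _ => braceEval_nil _

/-- The single entry $m_{i\bullet}$ either stays between two of the operations, which gives
$C=[\,]$, or is fed to one of them, which gives $C=[x]$; all other operations have empty blocks. On
the left $m_{i\bullet}$ is passed by the operations behind it. On the right this is expressed by the
elements in front of it (and the one it enters), at the cost of the global sign. -/
theorem insertSum_braceOp_hochMul {M : Type*} [AddCommGroup M] (i : ℕ) (X : List (HomElt 𝒜))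
    {F : List (SuspEnd 𝒜) → M} (hF : ListAdditive F) :
    insertSum (fun d => twist (suspEndGrading 𝒜) d) (X.map HomElt.braceOp) F
        [hochMul 𝒜 m hm i] =
      sgn (pairing ((i : ℤ), 1 - (i : ℤ)) (HomElt.degSum X)) • splitSum₃ (fun A C D =>
        F (A.map (twist (suspEndGrading 𝒜) ((i : ℤ), 1 - (i : ℤ))) ++ hochCorr hm i C :: D))
        (HomElt.elts X) := by
  set μ : ℤ × ℤ := ((i : ℤ), 1 - (i : ℤ)) with hμ
  have hK := isKoszulAction_twist (suspEndGrading 𝒜)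
  have hmul : ∀ d, twist (suspEndGrading 𝒜) d (hochMul 𝒜 m hm i) =
      sgn (pairing μ d) • hochMul 𝒜 m hm i := fun d => by
    rw [pairing_comm]; exact hK.apply d μ _ (mulElt hm i).2
  induction X generalizing F with
  | nil => simp [insertSum, splitSum₃, splitSum, HomElt.elts, HomElt.degSum, hochCorr, pairing, sgn]
  | cons x X ih =>
    have ih' := ih (hF.append_left [x.1.2])
    have hdeg : HomElt.degSum (x :: X) = x.1.1 + HomElt.degSum X := by simp [HomElt.degSum]
    have helts : HomElt.elts (x :: X) = x.1.2 :: HomElt.elts X := rfl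
    -- Since `hochCorr` vanishes on longer lists, the first operation gives two separate terms, with
    -- $m_{i\bullet}$ in front of it or inside it; induction covers $m_{i\bullet}$ further to the
    -- right.
    rw [helts, splitSum₃_cons_of_short (fun A c c' C D => hF.map_zero _ _), List.map_cons,
      insertSum_cons, HomElt.opsDeg_braceOp]
    have hx : x.braceOp.2 [] = x.1.2 := braceEval_nil _
    simp only [splitSum₃, splitSum, List.map_nil, List.map_cons, insertSum_nil_right,
      HomElt.map_braceOp_nil, List.nil_append, List.cons_append, hx]
    have h1 : x.braceOp.1 = x.1.1 := rfl
    rw [hmul, hmul, h1]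
    simp only [List.singleton_append] at ih'
    rw [ih']
    have hx1 : x.braceOp.2 [sgn (pairing μ (HomElt.degSum X)) • hochMul 𝒜 m hm i] =
      sgn (pairing μ (HomElt.degSum X)) •
        braceEval (suspEndBrace 𝒜) x.1.2 [hochMul 𝒜 m hm i] :=
      (x.braceOp_listAdditive.rescale (Rescaled.cons rfl Rescaled.nil)).trans
        (by rw [add_zero]; rfl)
    rw [hx1, hdeg]
    have e1 : ∀ (n : ℤ) (w : SuspEnd 𝒜) (L : List (SuspEnd 𝒜)),
        F ((sgn n • w) :: L) = sgn n • F (w :: L) := fun n w L => by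
      have := hF.rescale (Rescaled.cons (a' := sgn n • w) rfl (Rescaled.refl L))
      rwa [add_zero] at this
    rw [e1, e1, hochCorr, hochCorr, hK.apply μ _ _ x.2]
    rw [braceEval_zsmul, e1]
    simp only [e1]
    have e3 : ∀ f : List (SuspEnd 𝒜) → List (SuspEnd 𝒜) → List (SuspEnd 𝒜) → M,
        splitSum (fun A B => splitSum (fun C D => sgn (pairing μ x.1.1) • f A C D) B)
          (HomElt.elts X) =
        sgn (pairing μ x.1.1) • splitSum₃ f (HomElt.elts X) := fun f =>
      (map_splitSum₃ (AddMonoidHom.mk' (fun w : M => sgn (pairing μ x.1.1) • w)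
        fun a b => smul_add _ a b) _ _).symm
    rw [e3, pairing_add_right, smul_add, smul_add, sgn_smul_smul, sgn_smul_smul,
      sgn_congr (a := pairing μ x.1.1 + pairing μ (HomElt.degSum X) + pairing μ x.1.1)
        (b := pairing μ (HomElt.degSum X)) (pairing μ x.1.1) (by ring)]
    abel

/-- The brace relation with the single outer argument $m_{i\bullet}$. The pairing with the degrees
of `X` occurs twice, and only the sign from `x₀` survives. -/
theorem braceEval_twist_braceEval (i : ℕ) (x₀ : HomElt 𝒜) (X : List (HomElt 𝒜)) :
    braceEval (suspEndBrace 𝒜) (twist (V := SuspEnd 𝒜) (suspEndGrading 𝒜)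
        ((i : ℤ), 1 - (i : ℤ)) (braceEval (suspEndBrace 𝒜) x₀.1.2 (HomElt.elts X)))
        [hochMul 𝒜 m hm i] =
      sgn (pairing ((i : ℤ), 1 - (i : ℤ)) x₀.1.1) • splitSum₃ (fun A C D =>
        braceEval (suspEndBrace 𝒜) x₀.1.2
          (A.map (twist (suspEndGrading 𝒜) ((i : ℤ), 1 - (i : ℤ))) ++ hochCorr hm i C :: D))
        (HomElt.elts X) := by
  have hK := isKoszulAction_twist (suspEndGrading 𝒜)
  have h := HomElt.braceEval_braceEval x₀ X [mulElt hm i]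
  have h' := h.trans (insertSum_braceOp_hochMul hm i X
    (braceEval_listAdditive (suspEndBrace 𝒜) x₀.1.2))
  rw [hK.apply _ _ _ (HomElt.braceEval_mem x₀ X)]
  rw [braceEval_zsmul]
  refine (congrArg _ h').trans ?_
  rw [sgn_smul_smul, pairing_add_right]
  congr 1
  exact sgn_congr (pairing _ (HomElt.degSum X)) (by ring)

theorem sgn_pairing_hochMul (i p : ℕ) :
    sgn (pairing ((i : ℤ), 1 - (i : ℤ)) ((p : ℤ), 1 - (p : ℤ))) = - sgn ((i : ℤ) + p) := by
  have h1 : sgn 1 = -1 := by simp [sgn]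
  rw [sgn_congr (b := (i + p) + 1) ((i : ℤ) * p - i - p) (by simp only [pairing]; ring), sgn_add,
    h1, mul_neg_one]

/-- The source of the antisymmetry under the exchange of `i` and `p`: the exponent $\langle
m_{i\bullet},m_{p\bullet}\rangle$ is congruent to $i+p+1$ modulo 2. -/
theorem sgn_smul_sgn_pairing_hochMul {M : Type*} [AddCommGroup M] (i p : ℕ) (z : M) :
    sgn (p : ℤ) • sgn (pairing ((i : ℤ), 1 - (i : ℤ)) ((p : ℤ), 1 - (p : ℤ))) • z =
      - (sgn (i : ℤ) • z) := by
  rw [sgn_pairing_hochMul, neg_smul, smul_neg, sgn_smul_smul]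
  congr 2
  exact sgn_congr p (by ring)

theorem sum_antidiagonal_sub_swap {M : Type*} [AddCommGroup M] (u : ℕ) (f : ℕ → ℕ → M) :
    ∑ ip ∈ Finset.HasAntidiagonal.antidiagonal u, (f ip.1 ip.2 - f ip.2 ip.1) = 0 := by
  rw [Finset.sum_sub_distrib, sub_eq_zero]
  exact (Finset.Nat.sum_antidiagonal_swap (f := fun ip => f ip.1 ip.2)).symm

theorem sum_brace_hochMul_swap (u : ℕ) : ∑ ip ∈ Finset.HasAntidiagonal.antidiagonal u,
    sgn (ip.1 : ℤ) • braceEval (suspEndBrace 𝒜) (hochMul 𝒜 m hm ip.2) [hochMul 𝒜 m hm ip.1] =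
      0 :=
  (Finset.Nat.sum_antidiagonal_swap (f := fun ip => sgn (ip.2 : ℤ) •
    braceEval (suspEndBrace 𝒜) (hochMul 𝒜 m hm ip.1) [hochMul 𝒜 m hm ip.2])).trans
      (sum_brace_hochMul hm u)

theorem twist_hochMul (p : ℕ) (d : ℤ × ℤ) : twist (suspEndGrading 𝒜) d (hochMul 𝒜 m hm p) =
    sgn (pairing d ((p : ℤ), 1 - (p : ℤ))) • hochMul 𝒜 m hm p :=
  (isKoszulAction_twist (suspEndGrading 𝒜)).apply _ _ _ (mulElt hm p).2

/-- The brace relation for $b_1(b_1(x;m_{p\bullet});m_{i\bullet})$: the outer element lands in front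
of $m_{p\bullet}$, inside it, or behind it. -/
theorem braceEval_twist_hochCorr_singleton (i p : ℕ) (x : HomElt 𝒜) :
    braceEval (suspEndBrace 𝒜) (twist (V := SuspEnd 𝒜) (suspEndGrading 𝒜)
      ((i : ℤ), 1 - (i : ℤ)) (hochCorr hm p [x.1.2])) [hochMul 𝒜 m hm i] =
    sgn (pairing (((i : ℤ), 1 - (i : ℤ)) + ((p : ℤ), 1 - (p : ℤ))) x.1.1) •
      (braceEval (suspEndBrace 𝒜) x.1.2 [hochMul 𝒜 m hm i, hochMul 𝒜 m hm p] +
        sgn (pairing ((i : ℤ), 1 - (i : ℤ)) ((p : ℤ), 1 - (p : ℤ))) •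
          (braceEval (suspEndBrace 𝒜) x.1.2
            [braceEval (suspEndBrace 𝒜) (hochMul 𝒜 m hm p) [hochMul 𝒜 m hm i]] +
          braceEval (suspEndBrace 𝒜) x.1.2 [hochMul 𝒜 m hm p, hochMul 𝒜 m hm i])) := by
  have hK := isKoszulAction_twist (suspEndGrading 𝒜)
  have hF := braceEval_listAdditive (suspEndBrace 𝒜) x.1.2
  have hx : hochCorr hm p [x.1.2] = sgn (pairing ((p : ℤ), 1 - (p : ℤ)) x.1.1) •
      braceEval (suspEndBrace 𝒜) x.1.2 [hochMul 𝒜 m hm p] := by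
    rw [hochCorr, hK.apply _ _ _ x.2, braceEval_zsmul]
  rw [hx, map_zsmul, braceEval_zsmul]
  refine (congrArg _ (braceEval_twist_braceEval hm i x [mulElt hm p])).trans ?_
  have helts : HomElt.elts [mulElt hm p] = [hochMul 𝒜 m hm p] := rfl
  rw [helts, splitSum₃_cons_of_short (fun A c c' C D => hF.map_zero _ _)]
  simp only [splitSum₃, splitSum, List.map_nil, List.map_cons, List.nil_append, List.cons_append,
    hochCorr, twist_hochMul]
  have e1 : ∀ (n : ℤ) (w : SuspEnd 𝒜) (L : List (SuspEnd 𝒜)),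
      braceEval (suspEndBrace 𝒜) x.1.2 ((sgn n • w) :: L) =
        sgn n • braceEval (suspEndBrace 𝒜) x.1.2 (w :: L) := fun n w L => by
    have := hF.rescale (Rescaled.cons (a' := sgn n • w) rfl (Rescaled.refl L))
    rwa [add_zero] at this
  rw [braceEval_zsmul, e1, e1, sgn_smul_smul, add_assoc, ← smul_add, pairing_add_left,
    add_comm (pairing ((p : ℤ), 1 - (p : ℤ)) x.1.1)]

/-- The terms in which a component of the structure appears on the right twice cancel. -/
theorem sum_braceEval_twist_hochCorr (u : ℕ) (X : List (HomElt 𝒜)) :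
    ∑ ip ∈ Finset.HasAntidiagonal.antidiagonal u, sgn (ip.2 : ℤ) •
      braceEval (suspEndBrace 𝒜) (twist (V := SuspEnd 𝒜) (suspEndGrading 𝒜)
        ((ip.1 : ℤ), 1 - (ip.1 : ℤ)) (hochCorr hm ip.2 (HomElt.elts X)))
        [hochMul 𝒜 m hm ip.1] = 0 := by
  rcases X with _ | ⟨x, _ | ⟨y, X⟩⟩
  · have : ∀ ip : ℕ × ℕ, sgn (ip.2 : ℤ) •
        braceEval (suspEndBrace 𝒜) (twist (V := SuspEnd 𝒜) (suspEndGrading 𝒜)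
          ((ip.1 : ℤ), 1 - (ip.1 : ℤ)) (hochCorr hm ip.2 (HomElt.elts [])))
          [hochMul 𝒜 m hm ip.1] = -(sgn (ip.1 : ℤ) •
        braceEval (suspEndBrace 𝒜) (hochMul 𝒜 m hm ip.2) [hochMul 𝒜 m hm ip.1]) := fun ip => by
      rw [← sgn_smul_sgn_pairing_hochMul]
      congr 1
      rw [← braceEval_zsmul, ← twist_hochMul]
      rfl
    simp only [this, Finset.sum_neg_distrib, sum_brace_hochMul_swap, neg_zero]
  -- For a single entry, the two terms in which $m_{i\bullet}$ and $m_{p\bullet}$ stand side by side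
  -- exchange under $i\leftrightarrow p$ with opposite signs. The nested term sums to zero by
  -- `sum_brace_hochMul_swap`.
  · have : ∀ ip ∈ Finset.HasAntidiagonal.antidiagonal u, sgn (ip.2 : ℤ) •
        braceEval (suspEndBrace 𝒜) (twist (V := SuspEnd 𝒜) (suspEndGrading 𝒜)
          ((ip.1 : ℤ), 1 - (ip.1 : ℤ)) (hochCorr hm ip.2 (HomElt.elts [x])))
          [hochMul 𝒜 m hm ip.1] = sgn (pairing ((u : ℤ), 2 - (u : ℤ)) x.1.1) •
        ((sgn (ip.2 : ℤ) • braceEval (suspEndBrace 𝒜) x.1.2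
            [hochMul 𝒜 m hm ip.1, hochMul 𝒜 m hm ip.2] -
          sgn (ip.1 : ℤ) • braceEval (suspEndBrace 𝒜) x.1.2
            [hochMul 𝒜 m hm ip.2, hochMul 𝒜 m hm ip.1]) -
          sgn (ip.1 : ℤ) • braceEval (suspEndBrace 𝒜) x.1.2
            [braceEval (suspEndBrace 𝒜) (hochMul 𝒜 m hm ip.2) [hochMul 𝒜 m hm ip.1]]) := by
      intro ip hip
      have hu : (((ip.1 : ℤ), 1 - (ip.1 : ℤ)) + ((ip.2 : ℤ), 1 - (ip.2 : ℤ)) : ℤ × ℤ) =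
          ((u : ℤ), 2 - (u : ℤ)) := by
        rw [← Finset.HasAntidiagonal.mem_antidiagonal.mp hip]
        refine Prod.ext ?_ ?_
        · push_cast; rfl
        · push_cast; simp only [Prod.mk_add_mk]; ring
      have := braceEval_twist_hochCorr_singleton hm ip.1 ip.2 x
      refine (congrArg _ this).trans ?_
      rw [hu, smul_comm]
      congr 1
      rw [smul_add, sgn_smul_sgn_pairing_hochMul, smul_add]
      abel
    rw [Finset.sum_congr rfl this, ← Finset.smul_sum, Finset.sum_sub_distrib,
      sum_antidiagonal_sub_swap u fun i p => sgn (p : ℤ) • braceEval (suspEndBrace 𝒜) x.1.2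
        [hochMul 𝒜 m hm i, hochMul 𝒜 m hm p]]
    -- The sum over `ip` is moved into the slot of $b_1(x;-)$.
    obtain ⟨g, hg⟩ := braceEval_listAdditive (suspEndBrace 𝒜) x.1.2 [] []
    simp only [List.nil_append] at hg
    simp only [hg, ← map_zsmul]
    rw [← map_sum, sum_brace_hochMul_swap, map_zero, sub_zero, smul_zero]
  · refine Finset.sum_eq_zero fun ip _ => ?_
    have : hochCorr hm ip.2 (HomElt.elts (x :: y :: X)) = 0 := rfl
    rw [this, map_zero, braceEval_zero, smul_zero]

/-- The list `A.map g ++ f C :: D` has at least two entries unless `A` and `D` are empty, and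
`hochCorr` vanishes on such lists. -/
theorem splitSum₃_hochCorr (i : ℕ) (g : SuspEnd 𝒜 → SuspEnd 𝒜)
    (f : List (SuspEnd 𝒜) → SuspEnd 𝒜) (L : List (SuspEnd 𝒜)) :
    splitSum₃ (fun A C D => hochCorr hm i (A.map g ++ f C :: D)) L = hochCorr hm i [f L] := by
  rw [splitSum₃_eq_middle]
  · rfl
  · rintro A C D (h | h)
    · obtain ⟨a, A, rfl⟩ := List.exists_cons_of_ne_nil h
      cases A <;> rfl
    · obtain ⟨d, D, rfl⟩ := List.exists_cons_of_ne_nil h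
      rcases A with _ | ⟨a, _ | ⟨b, A⟩⟩ <;> rfl

/-- Only the term $c_i([P_p(X)])$ survives. Its part $b(m_{p\bullet};X)$ is again a brace of
$m_{p\bullet}$ with corrections, by `braceEval_twist_braceEval`; its other part is a double
correction. -/
theorem splitSum₃_hochCorr_hochP (i p : ℕ) (X : List (HomElt 𝒜)) :
    splitSum₃ (fun A C D => hochCorr hm i
      (A.map (twist (suspEndGrading 𝒜) ((p : ℤ), 1 - (p : ℤ))) ++ hochP hm p C :: D))
      (HomElt.elts X) =
    sgn (pairing ((i : ℤ), 1 - (i : ℤ)) ((p : ℤ), 1 - (p : ℤ))) • splitSum₃ (fun A C D =>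
      braceEval (suspEndBrace 𝒜) (hochMul 𝒜 m hm p)
        (A.map (twist (suspEndGrading 𝒜) ((i : ℤ), 1 - (i : ℤ))) ++ hochCorr hm i C :: D))
        (HomElt.elts X) -
      braceEval (suspEndBrace 𝒜) (twist (V := SuspEnd 𝒜) (suspEndGrading 𝒜)
        ((i : ℤ), 1 - (i : ℤ)) (hochCorr hm p (HomElt.elts X))) [hochMul 𝒜 m hm i] := by
  rw [splitSum₃_hochCorr, hochCorr, hochP, map_sub, braceEval_sub]
  exact congrArg (· - _) (braceEval_twist_braceEval hm i (mulElt hm p) X)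

/-- Expanding both occurrences of `hochP` leaves a double brace of $m_{i\bullet}$ and
$m_{p\bullet}$, the terms `T i p` and `T p i` with one correction, and the double correction `S i
p`. After summation these vanish by `sum_brace_hochMul`, by antisymmetry in `i` and `p`, and by
`sum_braceEval_twist_hochCorr`. -/
theorem sum_hochP_hochP (u : ℕ) (X : List (HomElt 𝒜)) :
    ∑ ip ∈ Finset.HasAntidiagonal.antidiagonal u, sgn (ip.2 : ℤ) • splitSum₃ (fun A C D =>
      hochP hm ip.1 (A.map (twist (suspEndGrading 𝒜) ((ip.2 : ℤ), 1 - (ip.2 : ℤ))) ++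
        hochP hm ip.2 C :: D)) (HomElt.elts X) = 0 := by
  have hK := isKoszulAction_twist (suspEndGrading 𝒜)
  set T : ℕ → ℕ → SuspEnd 𝒜 := fun i p => splitSum₃ (fun A C D =>
    braceEval (suspEndBrace 𝒜) (hochMul 𝒜 m hm i)
      (A.map (twist (suspEndGrading 𝒜) ((p : ℤ), 1 - (p : ℤ))) ++ hochCorr hm p C :: D))
      (HomElt.elts X) with hT
  set S : ℕ → ℕ → SuspEnd 𝒜 := fun i p => braceEval (suspEndBrace 𝒜)
    (twist (V := SuspEnd 𝒜) (suspEndGrading 𝒜) ((i : ℤ), 1 - (i : ℤ))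
      (hochCorr hm p (HomElt.elts X))) [hochMul 𝒜 m hm i] with hS
  have key : ∀ i p : ℕ, splitSum₃ (fun A C D =>
      hochP hm i (A.map (twist (suspEndGrading 𝒜) ((p : ℤ), 1 - (p : ℤ))) ++
        hochP hm p C :: D)) (HomElt.elts X) =
      braceEval (suspEndBrace 𝒜) (braceEval (suspEndBrace 𝒜) (hochMul 𝒜 m hm i)
        [hochMul 𝒜 m hm p]) (HomElt.elts X) - T i p -
        (sgn (pairing ((i : ℤ), 1 - (i : ℤ)) ((p : ℤ), 1 - (p : ℤ))) • T p i - S i p) := by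
    intro i p
    have h1 : ∀ A C D : List (SuspEnd 𝒜), hochP hm i (A.map (twist (suspEndGrading 𝒜) ((p : ℤ), 1 - (p : ℤ))) ++
        hochP hm p C :: D) =
        braceEval (suspEndBrace 𝒜) (hochMul 𝒜 m hm i)
          (A.map (twist (suspEndGrading 𝒜) ((p : ℤ), 1 - (p : ℤ))) ++
            braceEval (suspEndBrace 𝒜) (hochMul 𝒜 m hm p) C :: D) -
        braceEval (suspEndBrace 𝒜) (hochMul 𝒜 m hm i)
          (A.map (twist (suspEndGrading 𝒜) ((p : ℤ), 1 - (p : ℤ))) ++ hochCorr hm p C :: D) -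
        hochCorr hm i (A.map (twist (suspEndGrading 𝒜) ((p : ℤ), 1 - (p : ℤ))) ++
          hochP hm p C :: D) := by
      intro A C D
      obtain ⟨g, hg⟩ := braceEval_listAdditive (suspEndBrace 𝒜) (hochMul 𝒜 m hm i)
        (A.map (twist (suspEndGrading 𝒜) ((p : ℤ), 1 - (p : ℤ)))) D
      rw [hg, hg, ← map_sub, ← hg]
      rfl
    simp only [h1]
    rw [splitSum₃_sub, splitSum₃_sub]
    congr 2
    · have := HomElt.braceEval_braceEval (mulElt hm i) [mulElt hm p] X
      rw [List.map_singleton, insertSum_singleton hK.zero_act hK.add_act] at this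
      exact this.symm
    · exact splitSum₃_hochCorr_hochP hm i p X
  have hsum := sum_brace_hochMul hm u
  have h4 := sum_braceEval_twist_hochCorr hm u X
  have e : ∀ ip : ℕ × ℕ, sgn (ip.2 : ℤ) • splitSum₃ (fun A C D =>
      hochP hm ip.1 (A.map (twist (suspEndGrading 𝒜) ((ip.2 : ℤ), 1 - (ip.2 : ℤ))) ++
        hochP hm ip.2 C :: D)) (HomElt.elts X) =
      braceHom (suspEndBrace 𝒜) (HomElt.elts X) (sgn (ip.2 : ℤ) • braceEval (suspEndBrace 𝒜)
        (hochMul 𝒜 m hm ip.1) [hochMul 𝒜 m hm ip.2]) -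
      (sgn (ip.2 : ℤ) • T ip.1 ip.2 - sgn (ip.1 : ℤ) • T ip.2 ip.1) +
      sgn (ip.2 : ℤ) • S ip.1 ip.2 := by
    intro ip
    rw [key, smul_sub, smul_sub, smul_sub, sgn_smul_sgn_pairing_hochMul, map_zsmul, braceHom_apply]
    abel
  simp only [e]
  rw [Finset.sum_add_distrib, Finset.sum_sub_distrib, ← map_sum, hsum, map_zero,
    sum_antidiagonal_sub_swap u fun i p => sgn (p : ℤ) • T i p, h4]
  simp

theorem isDerivedAInfinityAlgebra_hochM :
    IsDerivedAInfinityAlgebra (vshift (suspEndGrading 𝒜) 1) (hochM 𝒜 m hm) where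
  arity_zero i := rfl
  homogeneous i j _ β a ha := by
    have hL : HomList (suspEndGrading 𝒜) (seg (tuple a) 1 (j + 1))
        (seg (fun v => tuple β v + (0, -1)) 1 (j + 1)) := HomList.seg fun v h1 h2 => by
      have := tuple_prop (P := fun x d => x ∈ vshift (suspEndGrading 𝒜) 1 d) ha v h1 (by omega)
      have hd : tuple β v + (0, -1) = ((tuple β v).1, (tuple β v).2 - 1) :=
        Prod.ext (add_zero _) rfl
      rw [hd]
      exact this
    have h := evalList_hochM_mem hm i hL
    rw [evalList_seg, sum_seg, Finset.sum_add_distrib, tuple_sum] at h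
    simp only [tuple_succ] at h
    change _ ∈ suspEndGrading 𝒜 _
    convert h using 2
    refine Prod.ext ?_ ?_
    · simp
    · simp; ring
  relation u v hv β a ha := by
    have hK := isKoszulAction_twist (suspEndGrading 𝒜)
    have ha' : ∀ w, a w ∈ suspEndGrading 𝒜 (β w + (0, -1)) := fun w => by
      have hd : β w + (0, -1) = ((β w).1, (β w).2 - 1) := Prod.ext (add_zero _) rfl
      rw [hd]
      exact ha w
    -- The natural grading of `𝔰 End_A` is that of the Hochschild complex shifted down by one. The
    -- relation to be proved is therefore, up to one invertible sign, `shiftRelation` for `hochM`.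
    have h := hK.shiftRelation_eq (hochM 𝒜 m hm) (fun i => rfl)
      (fun i L D hL => evalList_hochM_mem hm i hL) u v β a ha'
    refine sgn_smul_injective _ (h.symm.trans ?_)
    have hs := sum_hochP_hochP hm u
      (seg (fun w => (⟨(β w + (0, -1), a w), ha' w⟩ : HomElt 𝒜)) 1 (v + 1))
    rw [HomElt.elts, seg_map] at hs
    rw [shiftRelation, smul_zero]
    simp only [shiftEval_hochM]
    exact hs

end HochschildRelation

end DerivedDeligne

namespace DerivedDeligne

/-! ### The sign exponents of a derived `J`-algebra -/

section Signs

theorem afterSum_seg (u : ℕ → ℤ) (a l : ℕ) : afterSum (seg u a (a + l)) =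
    ∑ v ∈ Finset.Ico a (a + l), ((a : ℤ) + l - 1 - v) * u v := by
  induction l with
  | zero => rw [add_zero, seg_self, Finset.Ico_self]; rfl
  | succ l ih =>
    rw [← add_assoc, seg_snoc u (Nat.le_add_right a l), afterSum_append, ih, sum_seg,
      Finset.sum_Ico_succ_top (Nat.le_add_right a l)]
    simp only [List.length_singleton, Nat.cast_one, one_mul, afterSum, List.length_nil,
      Nat.cast_zero, zero_mul, add_zero]
    rw [← Finset.sum_add_distrib]
    push_cast
    rw [show ((a : ℤ) + (l + 1) - 1 - (a + l)) * u (a + l) = 0 by ring, add_zero]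
    exact Finset.sum_congr rfl fun v _ => by ring

theorem afterSum_seg_one (u : ℕ → ℤ) (n : ℕ) : afterSum (seg u 1 (n + 1)) =
    ∑ v ∈ Finset.Icc 1 n, ((n : ℤ) - v) * u v := by
  rw [add_comm n, afterSum_seg, add_comm 1]
  have hI : Finset.Icc 1 n = Finset.Ico 1 (n + 1) := by
    ext w; simp only [Finset.mem_Icc, Finset.mem_Ico]; omega
  rw [hI]
  exact Finset.sum_congr rfl fun v _ => by push_cast; ring

theorem sum_block_sign (u : ℕ → ℤ) (a l : ℕ) (ha : 1 ≤ a) :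
    ∑ v ∈ Finset.Icc 1 l, u (a + v - 1) * ((l : ℤ) - v) = afterSum (seg u a (a + l)) := by
  rw [afterSum_seg, Finset.sum_Ico_eq_sum_range, Nat.add_sub_cancel_left]
  have hI : Finset.Icc 1 l = Finset.Ico 1 (l + 1) := by
    ext w; simp only [Finset.mem_Icc, Finset.mem_Ico]; omega
  rw [hI, Finset.sum_Ico_eq_sum_range, Nat.add_sub_cancel]
  refine Finset.sum_congr rfl fun v _ => ?_
  rw [show a + (1 + v) - 1 = a + v by omega]
  push_cast
  ring

theorem sum_range_sum_Ico {M : Type*} [AddCommMonoid M] (i : ℕ → ℕ) (f : ℕ → M) (l : ℕ)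
    (h : ∀ t < l, i t ≤ i (t + 1)) :
    ∑ t ∈ Finset.range l, ∑ v ∈ Finset.Ico (i t) (i (t + 1)), f v =
      ∑ v ∈ Finset.Ico (i 0) (i l), f v := by
  induction l with
  | zero => simp
  | succ l ih =>
    have h0 : i 0 ≤ i l := by
      clear ih
      induction l with
      | zero => rfl
      | succ l ih => exact (ih fun t ht => h t (by omega)).trans (h l (by omega))
    rw [Finset.sum_range_succ, ih fun t ht => h t (by omega),
      Finset.sum_Ico_consecutive f h0 (h l (by omega))]

/-- Brings $\varepsilon$ into the form produced by `shiftEval_weave`, up to the shift sign of the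
$x_t$ contained in $M_{ij}$. The second and fourth sums of $\varepsilon$ add up to
$(i_l-1)\,\mathrm{vdeg}(S^{1-k_l}x_l)$, and the third contains the same term, since it pairs with
$Sy_v$ rather than $y_v$; modulo 2 these cancel. -/
theorem sgn_jSign {j n : ℕ} {p : InsertionData j n} (hp : p ∈ insertions j n)
    (α β : ℕ → ℤ × ℤ) :
    sgn (jSign p α β) = sgn (afterSum (seg (fun t => (α t).2) 1 (j + 1)) +
      ∑ t ∈ Finset.Icc 1 j, (∑ v ∈ Finset.Ico 1 (p.start t), pairing (α t) (β v) +
        (afterSum (seg (fun v => (β v).2) (p.start t) (p.start t + p.len t)) +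
          ((p.len t : ℤ) - 1) * ∑ v ∈ Finset.Ico 1 (p.start t), (β v).2 -
          (α t).2 * ((j : ℤ) - t + ∑ l ∈ Finset.Icc t j, p.gap l)))) := by
  have hmono := mem_insertions hp
  have h3 : ∀ l ∈ Finset.Icc 1 j, ∑ t ∈ Finset.range l, ∑ v ∈ Finset.Ico (p.start t)
      (p.start (t + 1)), pairing ((β v).1, (β v).2 + 1) ((α l).1, (α l).2 + 1 - p.len l) =
      ∑ v ∈ Finset.Ico 1 (p.start l), pairing (α l) (β v) +
        (1 - (p.len l : ℤ)) * ∑ v ∈ Finset.Ico 1 (p.start l), (β v).2 +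
        ((p.start l : ℤ) - 1) * ((α l).2 + 1 - p.len l) := by
    intro l hl
    have hl' := Finset.mem_Icc.mp hl
    rw [sum_range_sum_Ico p.start _ l fun t ht => by have := hmono t (by omega); omega,
      start_zero, ← sum_pairing_shift (α l) β (p.len l) (insertion_bounds hp hl'.2).1]
    refine Finset.sum_congr rfl fun v _ => ?_
    rw [pairing_comm]
    congr 1
    exact Prod.ext (add_zero _).symm rfl
  have h24 : ∀ l ∈ Finset.Icc 1 j,
      ∑ v ∈ Finset.Ico 1 l, (p.len v : ℤ) * ((α l).2 + 1 - p.len l) +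
      ∑ v ∈ Finset.range l, p.gap v * ((α l).2 + 1 - p.len l) =
      ((p.start l : ℤ) - 1) * ((α l).2 + 1 - p.len l) := by
    intro l hl
    rw [← Finset.sum_mul, ← Finset.sum_mul, ← add_mul, add_comm,
      sum_gap_add_sum_len p (Finset.mem_Icc.mp hl).1]
  have h1 : ∀ t ∈ Finset.Icc 1 j, ∑ v ∈ Finset.Icc 1 (p.len t),
      (β (p.start t + v - 1)).2 * ((p.len t : ℤ) - v) =
      afterSum (seg (fun v => (β v).2) (p.start t) (p.start t + p.len t)) := fun t ht =>
    sum_block_sign (fun v => (β v).2) _ _ (insertion_bounds hp (Finset.mem_Icc.mp ht).2).1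
  have hj : jSign p α β =
      ∑ t ∈ Finset.Icc 1 j, afterSum (seg (fun v => (β v).2) (p.start t) (p.start t + p.len t)) +
      ∑ l ∈ Finset.Icc 1 j, (∑ v ∈ Finset.Ico 1 (p.start l), pairing (α l) (β v) +
        (1 - (p.len l : ℤ)) * ∑ v ∈ Finset.Ico 1 (p.start l), (β v).2 +
        ((p.start l : ℤ) - 1) * ((α l).2 + 1 - p.len l)) +
      ∑ l ∈ Finset.Icc 1 j, ((p.start l : ℤ) - 1) * ((α l).2 + 1 - p.len l) +
      ∑ t ∈ Finset.Icc 1 j, (α t).2 * ∑ l ∈ Finset.Icc t j, p.gap l := by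
    rw [← Finset.sum_congr rfl h1, ← Finset.sum_congr rfl h3, ← Finset.sum_congr rfl h24,
      ← sum_Icc_sum_Icc, Finset.sum_add_distrib]
    simp only [jSign]
    ring
  rw [hj, afterSum_seg_one]
  refine sgn_congr (∑ t ∈ Finset.Icc 1 j, ((1 - (p.len t : ℤ)) *
    ∑ v ∈ Finset.Ico 1 (p.start t), (β v).2 + ((p.start t : ℤ) - 1) * ((α t).2 + 1 - p.len t) +
      (α t).2 * ∑ l ∈ Finset.Icc t j, p.gap l)) ?_
  rw [Finset.mul_sum]
  simp only [← Finset.sum_add_distrib]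
  exact Finset.sum_congr rfl fun t _ => by ring

/-- The right-hand side is the exponent of `shiftEval_weave` for a single block. -/
theorem sgn_jSignOuter {n : ℕ} {p : InsertionData 1 n} (hp : p ∈ insertions 1 n) (α : ℤ × ℤ)
    (β : ℕ → ℤ × ℤ) :
    sgn (jSignOuter p α β) =
      sgn (∑ t ∈ Finset.Icc 1 1, (∑ v ∈ Finset.Ico 1 (p.start t), pairing α (β v) +
        (afterSum (seg (fun v => (β v).2) (p.start t) (p.start t + p.len t)) +
          ((p.len t : ℤ) - 1) * ∑ v ∈ Finset.Ico 1 (p.start t), (β v).2 -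
          α.2 * (((1 : ℕ) : ℤ) - t + ∑ l ∈ Finset.Icc t 1, p.gap l)))) := by
  have h1 := sum_block_sign (fun v => (β v).2) (p.start 1) (p.len 1)
    (insertion_bounds hp le_rfl).1
  have h2 : p.gap 1 = (n : ℤ) + 1 - p.start 1 - p.len 1 := by
    rw [InsertionData.gap, start_last]; push_cast; rfl
  have h3 : ∑ v ∈ Finset.Ico 1 (p.start 1), pairing (β v) (α.1, α.2 + 1 - p.len 1) =
      ∑ v ∈ Finset.Ico 1 (p.start 1), pairing α (β v) +
        (1 - (p.len 1 : ℤ)) * ∑ v ∈ Finset.Ico 1 (p.start 1), (β v).2 := by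
    rw [Finset.mul_sum, ← Finset.sum_add_distrib]
    exact Finset.sum_congr rfl fun v _ => by simp only [pairing]; ring
  simp only [Finset.Icc_self, Finset.sum_singleton]
  rw [jSignOuter, h1, h2, h3]
  refine sgn_congr ((1 - (p.len 1 : ℤ)) * ∑ v ∈ Finset.Ico 1 (p.start 1), (β v).2 +
    α.2 * ((n : ℤ) + 1 - p.start 1 - p.len 1)) ?_
  push_cast
  ring

/-- The right-hand side combines the sign in front of the left-hand side of the relation, the Koszul
sign of $m_{i\bullet}$ passing the entries in front of the block, and the shift sign of the block
inside $M_{il}$. -/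
theorem sgn_jSignInner {n : ℕ} {p : InsertionData 1 n} (hp : p ∈ insertions 1 n) (i : ℕ)
    (β : ℕ → ℤ × ℤ) :
    sgn (jSignInner i p β) =
      sgn (afterSum (seg (fun v => (β v).2) 1 (n + 1)) +
        (∑ t ∈ Finset.Icc 1 1, ∑ v ∈ Finset.Ico 1 (p.start t),
          pairing ((i : ℤ), 1 - (i : ℤ)) (β v) +
        afterSum (seg (fun v => (β v).2) (p.start 1) (p.start 1 + p.len 1)))) := by
  obtain ⟨hb1, hb2⟩ := insertion_bounds hp le_rfl
  rw [afterSum_seg_one, afterSum_seg, Finset.Icc_self, Finset.sum_singleton, jSignInner]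
  set a := p.start 1
  set l := p.len 1
  have hI : Finset.Icc 1 n = Finset.Ico 1 (n + 1) := by
    ext w; simp only [Finset.mem_Icc, Finset.mem_Ico]; omega
  have hJ : Finset.Icc a (n - l) = Finset.Ico a (n - l + 1) := by
    ext w; simp only [Finset.mem_Icc, Finset.mem_Ico]; omega
  -- Behind the block the coefficients agree exactly, because $k-v-1=n-(v+l)$; in front of it (`h5`)
  -- and inside it (`h6`) they agree only modulo 2.
  have h4 : ∑ v ∈ Finset.Ico a (n - l + 1), ((n : ℤ) - l + 1 - v - 1) * (β (v + l)).2 =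
      ∑ v ∈ Finset.Ico (a + l) (n + 1), ((n : ℤ) - v) * (β v).2 := by
    rw [show n + 1 = (n - l + 1) + l by omega,
      ← Finset.sum_Ico_add' (fun v => ((n : ℤ) - v) * (β v).2) a (n - l + 1) l]
    exact Finset.sum_congr rfl fun v _ => by push_cast; ring
  have h5 : ∑ v ∈ Finset.Ico 1 a, ((n : ℤ) - l + 1 - v) * (β v).2 +
      ∑ v ∈ Finset.Ico 1 a, pairing (β v) ((i : ℤ), 2 - ((i : ℤ) + l)) =
      ∑ v ∈ Finset.Ico 1 a, ((n : ℤ) - v) * (β v).2 +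
        ∑ v ∈ Finset.Ico 1 a, pairing ((i : ℤ), 1 - (i : ℤ)) (β v) +
        2 * ∑ v ∈ Finset.Ico 1 a, (1 - (l : ℤ)) * (β v).2 := by
    rw [Finset.mul_sum, ← Finset.sum_add_distrib, ← Finset.sum_add_distrib,
      ← Finset.sum_add_distrib]
    exact Finset.sum_congr rfl fun v _ => by simp only [pairing]; ring
  have h6 : ∑ v ∈ Finset.Ico a (a + l), ((n : ℤ) - l + 1 - a) * (β v).2 =
      ∑ v ∈ Finset.Ico a (a + l), ((n : ℤ) - v) * (β v).2 +
        ∑ v ∈ Finset.Ico a (a + l), ((a : ℤ) + l - 1 - v) * (β v).2 +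
        2 * ∑ v ∈ Finset.Ico a (a + l), ((v : ℤ) + 1 - a - l) * (β v).2 := by
    rw [Finset.mul_sum, ← Finset.sum_add_distrib, ← Finset.sum_add_distrib]
    exact Finset.sum_congr rfl fun v _ => by ring
  rw [hI, hJ, h4, ← Finset.sum_Ico_consecutive _ hb1 (show a ≤ n + 1 by omega),
    ← Finset.sum_Ico_consecutive _ (Nat.le_add_right a l) hb2]
  refine sgn_congr (∑ v ∈ Finset.Ico 1 a, (1 - (l : ℤ)) * (β v).2 +
    ∑ v ∈ Finset.Ico a (a + l), ((v : ℤ) + 1 - a - l) * (β v).2) ?_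
  rw [h5, h6]
  ring

end Signs

end DerivedDeligne

namespace DerivedDeligne

theorem weave_smul {V : Type*} [AddCommGroup V] {F : List V → V} (hF : ListAdditive F) {n : ℕ} {p : InsertionData 1 n} (z y : ℕ → V) (e : ℤ) (z' : ℕ → V)
    (hz : z' 1 = sgn e • z 1) : F (weave p z' y) = sgn e • F (weave p z y) := by
  simp only [weave, weaveUpTo]
  rw [hz]
  have := hF.rescale ((Rescaled.refl (seg y (p.start 0 + p.len 0) (p.start 1))).append
    (Rescaled.cons (a' := sgn e • z 1) rfl
      (Rescaled.refl (seg y (p.start 1 + p.len 1) (p.start 2)))))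
  rwa [zero_add, add_zero] at this

/-! ### The relations of a derived `J`-algebra on the Hochschild complex -/

section JRelations

variable {R A : Type*} [CommRing R] [AddCommGroup A] [Module R A] {𝒜 : ℤ × ℤ → Submodule R A}
  [DirectSum.Decomposition 𝒜] {m : ℕ → ∀ j : ℕ, MultilinearMap R (fun _ : Fin j => A) A}
  (hm : IsDerivedAInfinityAlgebra 𝒜 m)

theorem braceEval_seg_eq_insertSum (x₀ : HomElt 𝒜) (j n : ℕ) (α : ℕ → ℤ × ℤ)
    (x : ℕ → SuspEnd 𝒜) (β : ℕ → ℤ × ℤ) (y : ℕ → SuspEnd 𝒜)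
    (hx : ∀ t, x t ∈ suspEndGrading 𝒜 (α t)) (hy : ∀ v, y v ∈ suspEndGrading 𝒜 (β v)) :
    braceEval (suspEndBrace 𝒜) (braceEval (suspEndBrace 𝒜) x₀.1.2 (seg x 1 (j + 1)))
        (seg y 1 (n + 1)) =
      insertSum (fun d => twist (suspEndGrading 𝒜) d)
        (seg (fun t => (α t, braceEval (suspEndBrace 𝒜) (x t))) 1 (j + 1))
        (braceEval (suspEndBrace 𝒜) x₀.1.2) (seg y 1 (n + 1)) := by
  have h := HomElt.braceEval_braceEval x₀
    (seg (fun t => (⟨(α t, x t), hx t⟩ : HomElt 𝒜)) 1 (j + 1))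
    (seg (fun v => (⟨(β v, y v), hy v⟩ : HomElt 𝒜)) 1 (n + 1))
  simp only [HomElt.elts, seg_map] at h
  exact h

theorem braceEval_block_mem {j n : ℕ} (p : InsertionData j n) {α : ℤ × ℤ} {x : SuspEnd 𝒜}
    {β : ℕ → ℤ × ℤ} {y : ℕ → SuspEnd 𝒜} (hx : x ∈ suspEndGrading 𝒜 α)
    (hy : ∀ v, y v ∈ suspEndGrading 𝒜 (β v)) (t : ℕ) :
    braceEval (suspEndBrace 𝒜) x (block p y t) ∈ suspEndGrading 𝒜
      (α + ∑ v ∈ Finset.Ico (p.start t) (p.start t + p.len t), β v) := by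
  have h := HomElt.braceEval_mem (⟨(α, x), hx⟩ : HomElt 𝒜)
    (seg (fun v => (⟨(β v, y v), hy v⟩ : HomElt 𝒜)) (p.start t) (p.start t + p.len t))
  rw [HomElt.elts, HomElt.degSum, seg_map, seg_map, sum_seg] at h
  exact h

theorem two_le_length_weave {X : Type*} {j n : ℕ} (p : InsertionData (j + 2) n) (z y : ℕ → X) :
    ∃ a b L, weave p z y = a :: b :: L := by
  have h : 2 ≤ (weave p z y).length := by
    simp only [weave, weaveUpTo, List.length_append, List.length_cons]
    omega
  match weave p z y, h with
  | a :: b :: L, _ => exact ⟨a, b, L, rfl⟩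

theorem hochCorr_weave (i : ℕ) {j n : ℕ} (p : InsertionData (j + 2) n) (z y : ℕ → SuspEnd 𝒜) :
    hochCorr hm i (weave p z y) = 0 := by
  obtain ⟨a, b, L, h⟩ := two_le_length_weave p z y
  rw [h]
  rfl

/-- For at least two inserted elements no correction occurs, neither in $M_{ij}$ nor in the woven
lists, which have at least two entries. What remains is the brace relation for $m_{i\bullet}$, with
signs compared by `shiftEval_weave` and `sgn_jSign`. -/
theorem hochM_relation_many (i j n : ℕ) (hj : 1 < j) (α : ℕ → ℤ × ℤ) (x : ℕ → SuspEnd 𝒜)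
    (β : ℕ → ℤ × ℤ) (y : ℕ → SuspEnd 𝒜) (hx : ∀ t, x t ∈ suspEndGrading 𝒜 (α t))
    (hy : ∀ v, y v ∈ suspEndGrading 𝒜 (β v)) :
    sgn (∑ v ∈ Finset.Icc 1 n, ((n : ℤ) - v) * (β v).2) •
        braceEval (suspEndBrace 𝒜) (evalList (hochM 𝒜 m hm i) (seg x 1 (j + 1)))
          (seg y 1 (n + 1)) =
      ∑ p ∈ insertions j n, sgn (jSign p α β) •
        evalList (hochM 𝒜 m hm i)
          (weave p (fun t => braceEval (suspEndBrace 𝒜) (x t) (block p y t)) y) := by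
  obtain ⟨j, rfl⟩ : ∃ k, j = k + 2 := ⟨j - 2, by omega⟩
  have hK := isKoszulAction_twist (suspEndGrading 𝒜)
  have hM := hK.shiftEval_eq (hochM 𝒜 m hm i) (HomList.seg (a := 1) (e := j + 2 + 1)
    fun t _ _ => hx t)
  have hcorr : hochCorr hm i (seg x 1 (j + 2 + 1)) = 0 := by
    rw [seg_cons x (by omega), seg_cons x (by omega)]
    rfl
  rw [shiftEval_hochM, hochP, hcorr, sub_zero, seg_map] at hM
  have hM' : evalList (hochM 𝒜 m hm i) (seg x 1 (j + 2 + 1)) =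
      sgn (afterSum (seg (fun t => (α t).2) 1 (j + 2 + 1))) •
        braceEval (suspEndBrace 𝒜) (hochMul 𝒜 m hm i) (seg x 1 (j + 2 + 1)) := by
    rw [hM, sgn_smul_self]
  rw [hM', braceEval_zsmul]
  have hB := braceEval_seg_eq_insertSum (mulElt hm i) (j + 2) n α x β y hx hy
  rw [insertSum_seg hK.zero_act hK.add_act] at hB
  refine (congrArg (fun z => sgn _ • sgn _ • z) hB).trans ?_
  rw [smul_comm, Finset.smul_sum, Finset.smul_sum]
  refine Finset.sum_congr rfl fun p hp => ?_
  have hw := hK.shiftEval_weave (hochM 𝒜 m hm i)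
    (act := fun t => braceEval (suspEndBrace 𝒜) (x t))
    (fun t => braceEval_listAdditive _ _) hp α (fun v _ _ => hy v)
    fun t _ _ => braceEval_block_mem p (hx t) hy t
  rw [shiftEval_hochM, hochP, hochCorr_weave, sub_zero] at hw
  rw [sgn_jSign hp, sgn_add, mul_smul, ← hw, afterSum_seg_one (fun v => (β v).2)]
  rfl

/-- The brace relation expands both terms of $M_{i1}(x)$. Replacing the braces of $m_{i\bullet}$ by
`hochP` introduces $c_i([b(x;Y)])$ in the first sum and $b(x;\dots,c_i(C),\dots)$ in the second;
these are equal up to the required sign by `braceEval_twist_braceEval`, and cancel. -/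
theorem hochM_brace_one (i : ℕ) (x : HomElt 𝒜) (Y : List (HomElt 𝒜)) :
    braceEval (suspEndBrace 𝒜) (evalList (hochM 𝒜 m hm i) [x.1.2]) (HomElt.elts Y) =
      splitSum₃ (fun A C D => hochP hm i (A.map (twist (suspEndGrading 𝒜) x.1.1) ++
        braceEval (suspEndBrace 𝒜) x.1.2 C :: D)) (HomElt.elts Y) -
      sgn (pairing x.1.1 ((i : ℤ), 1 - (i : ℤ))) • splitSum₃ (fun A C D =>
        braceEval (suspEndBrace 𝒜) x.1.2
          (A.map (twist (suspEndGrading 𝒜) ((i : ℤ), 1 - (i : ℤ))) ++ hochP hm i C :: D))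
        (HomElt.elts Y) := by
  have hK := isKoszulAction_twist (suspEndGrading 𝒜)
  have hM : evalList (hochM 𝒜 m hm i) [x.1.2] =
      braceEval (suspEndBrace 𝒜) (hochMul 𝒜 m hm i) [x.1.2] -
        sgn (pairing x.1.1 ((i : ℤ), 1 - (i : ℤ))) •
          braceEval (suspEndBrace 𝒜) x.1.2 [hochMul 𝒜 m hm i] := by
    have h := hK.shiftEval_eq (hochM 𝒜 m hm i) (HomElt.homList [x])
    have h0 : afterSum ([(x.1.1)].map Prod.snd) = 0 := by simp [afterSum]
    rw [List.map_singleton, h0, sgn_zero, one_smul, shiftEval_hochM] at h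
    refine h.symm.trans ?_
    change _ - hochCorr hm i [x.1.2] = _
    rw [hochCorr, hK.apply _ _ _ x.2, braceEval_zsmul, pairing_comm]
    rfl
  have h1 := HomElt.braceEval_braceEval (mulElt hm i) [x] Y
  have h2 := HomElt.braceEval_braceEval x [mulElt hm i] Y
  rw [List.map_singleton, insertSum_singleton hK.zero_act hK.add_act] at h1 h2
  have h3 := splitSum₃_hochCorr hm i (twist (suspEndGrading 𝒜) x.1.1)
    (braceEval (suspEndBrace 𝒜) x.1.2) (HomElt.elts Y)
  have h4 := braceEval_twist_braceEval hm i x Y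
  have e1 : splitSum₃ (fun A C D => hochP hm i (A.map (twist (suspEndGrading 𝒜) x.1.1) ++
        braceEval (suspEndBrace 𝒜) x.1.2 C :: D)) (HomElt.elts Y) =
      braceEval (suspEndBrace 𝒜) (braceEval (suspEndBrace 𝒜) (hochMul 𝒜 m hm i) [x.1.2])
        (HomElt.elts Y) - hochCorr hm i [braceEval (suspEndBrace 𝒜) x.1.2 (HomElt.elts Y)] := by
    rw [← h3]
    exact (splitSum₃_sub _ _ _).trans (congrArg (· - _) h1.symm)
  have e2 : splitSum₃ (fun A C D => braceEval (suspEndBrace 𝒜) x.1.2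
        (A.map (twist (suspEndGrading 𝒜) ((i : ℤ), 1 - (i : ℤ))) ++ hochP hm i C :: D))
        (HomElt.elts Y) =
      braceEval (suspEndBrace 𝒜) (braceEval (suspEndBrace 𝒜) x.1.2 [hochMul 𝒜 m hm i])
        (HomElt.elts Y) -
      splitSum₃ (fun A C D => braceEval (suspEndBrace 𝒜) x.1.2
        (A.map (twist (suspEndGrading 𝒜) ((i : ℤ), 1 - (i : ℤ))) ++ hochCorr hm i C :: D))
        (HomElt.elts Y) := by
    refine Eq.trans ?_ ((splitSum₃_sub _ _ _).trans (congrArg (· - _) h2.symm))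
    refine splitSum₃_congr fun A C D _ => ?_
    obtain ⟨g, hg⟩ := braceEval_listAdditive (suspEndBrace 𝒜) x.1.2
      (A.map (twist (suspEndGrading 𝒜) ((i : ℤ), 1 - (i : ℤ)))) D
    rw [hg, hochP, map_sub, ← hg, ← hg]
    rfl
  rw [hM, braceEval_sub, braceEval_zsmul, e1, e2, hochCorr, h4, smul_sub,
    pairing_comm x.1.1]
  abel

theorem hochM_relation_one (i n : ℕ) (α : ℤ × ℤ) (x : SuspEnd 𝒜) (β : ℕ → ℤ × ℤ)
    (y : ℕ → SuspEnd 𝒜) (hx : x ∈ suspEndGrading 𝒜 α)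
    (hy : ∀ v, y v ∈ suspEndGrading 𝒜 (β v)) :
    sgn (∑ v ∈ Finset.Icc 1 n, ((n : ℤ) - v) * (β v).2) •
        braceEval (suspEndBrace 𝒜) (evalList (hochM 𝒜 m hm i) [x]) (seg y 1 (n + 1)) =
      ∑ p ∈ insertions 1 n, sgn (jSignOuter p α β) •
          evalList (hochM 𝒜 m hm i)
            (weave p (fun t => braceEval (suspEndBrace 𝒜) x (block p y t)) y) -
        sgn (pairing α ((i : ℤ), 1 - (i : ℤ))) •
          ∑ p ∈ insertions 1 n with 1 ≤ p.len 1, sgn (jSignInner i p β) •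
            braceEval (suspEndBrace 𝒜) x
              (weave p (fun t => evalList (hochM 𝒜 m hm i) (block p y t)) y) := by
  have hK := isKoszulAction_twist (suspEndGrading 𝒜)
  have hF := braceEval_listAdditive (suspEndBrace 𝒜) x
  have h := hochM_brace_one hm i (⟨(α, x), hx⟩ : HomElt 𝒜)
    (seg (fun v => (⟨(β v, y v), hy v⟩ : HomElt 𝒜)) 1 (n + 1))
  rw [HomElt.elts, seg_map] at h
  have hs1 : ∀ X : Op (SuspEnd 𝒜), seg (fun _ => X) 1 (1 + 1) = [X] := fun X => rfl
  -- The two sums over decompositions of `hochM_brace_one` are insertions of a single operation: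
  -- that of `x` into $P_i$, and that of $P_i$ into the brace of `x`.
  have o1 := insertSum_seg (τ := fun d => twist (suspEndGrading 𝒜) d) hK.zero_act hK.add_act 1 n
    (fun _ => (α, braceEval (suspEndBrace 𝒜) x)) (hochP hm i) y
  have o2 := insertSum_seg (τ := fun d => twist (suspEndGrading 𝒜) d) hK.zero_act hK.add_act 1 n
    (fun _ => (((i : ℤ), 1 - (i : ℤ)), hochP hm i)) (braceEval (suspEndBrace 𝒜) x) y
  rw [hs1, insertSum_singleton hK.zero_act hK.add_act] at o1 o2
  rw [← afterSum_seg_one (fun v => (β v).2)]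
  refine (congrArg _ (h.trans (congrArg₂ (fun a b => a - sgn _ • b) o1 o2))).trans ?_
  rw [smul_sub, smul_comm (sgn (afterSum _)) (sgn (pairing _ _)), Finset.smul_sum, Finset.smul_sum]
  congr 1
  · refine Finset.sum_congr rfl fun p hp => ?_
    have hw := hK.shiftEval_weave (hochM 𝒜 m hm i)
      (act := fun _ => braceEval (suspEndBrace 𝒜) x)
      (fun t => hF) hp (fun _ => α) (fun v _ _ => hy v)
      fun t _ _ => braceEval_block_mem p hx hy t
    rw [shiftEval_hochM] at hw
    rw [sgn_jSignOuter hp]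
    exact hw
  · congr 1
    rw [Finset.sum_filter]
    refine Finset.sum_congr rfl fun p hp => ?_
    have hP : ∀ L, shiftEval (twist (suspEndGrading 𝒜)) (hochM 𝒜 m hm i) L = hochP hm i L :=
      shiftEval_hochM hm i
    have hPadd : ListAdditive (hochP hm i) := fun L₁ L₂ => by
      simp only [← hP]
      exact shiftEval_listAdditive _ L₁ L₂
    have hw := hK.eval_weave_passed hF (act := fun _ => hochP hm i) (fun _ => hPadd) hp
      (fun _ => ((i : ℤ), 1 - (i : ℤ))) (fun v _ _ => hy v)
    have hz : hochP hm i (block p y 1) =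
        sgn (afterSum (seg (fun v => (β v).2) (p.start 1) (p.start 1 + p.len 1))) •
          evalList (hochM 𝒜 m hm i) (block p y 1) := by
      rw [← hP, block, hK.shiftEval_eq _ (HomList.seg fun v _ _ => hy v), seg_map]
    refine (congrArg _ (hw.trans (congrArg _ (weave_smul hF
      (fun t => evalList (hochM 𝒜 m hm i) (block p y t)) y _ _ hz)))).trans ?_
    rw [sgn_smul_smul, sgn_smul_smul]
    -- The condition $l\ge1$ only omits zero terms: on an empty block the inner structure map has
    -- arity zero and vanishes.
    split_ifs with hlen
    · rw [sgn_jSignInner hp, add_assoc]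
    · have hl : p.len 1 = 0 := by omega
      have : evalList (hochM 𝒜 m hm i) (block p y 1) = 0 := by
        rw [block, hl, add_zero, seg_self]
        rfl
      have hzero : braceEval (suspEndBrace 𝒜) x
          (weave p (fun t => evalList (hochM 𝒜 m hm i) (block p y t)) y) = 0 := by
        simp only [weave, weaveUpTo]
        rw [this]
        exact hF.map_zero _ _
      rw [hzero, smul_zero]

end JRelations

end DerivedDeligne

theorem mainTheorem5 {R A : Type*} [CommRing R] [AddCommGroup A] [Module R A]
    (𝒜 : ℤ × ℤ → Submodule R A) [DirectSum.Decomposition 𝒜]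
    (hbdd : DerivedDeligne.HorizontallyBoundedRight 𝒜)
    (m : ℕ → ∀ j : ℕ, MultilinearMap R (fun _ : Fin j => A) A)
    (hm : DerivedDeligne.IsDerivedAInfinityAlgebra 𝒜 m) :
    DerivedDeligne.IsDerivedJAlgebra (V := DerivedDeligne.SuspEnd 𝒜)
      (DerivedDeligne.vshift (DerivedDeligne.suspEndGrading 𝒜) 1)
      (DerivedDeligne.hochM 𝒜 m hm) (DerivedDeligne.suspEndBrace 𝒜) := by
  refine ⟨DerivedDeligne.isDerivedAInfinityAlgebra_hochM hm, ?_, ?_, ?_⟩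
  -- For $V=S\,\mathfrak s\mathrm{End}_A$ the grading of $S^{-1}V$ is again the natural one of `𝔰
  -- End_A`.
  all_goals rw [DerivedDeligne.vshift_vshift]
  · exact DerivedDeligne.isBraceAlgebra_suspEnd
  · exact DerivedDeligne.hochM_relation_one hm
  · exact DerivedDeligne.hochM_relation_many hm
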